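/- Write $\mathcal P=\mathbb C[z]$, $\mathcal Q=\mathbb C(z)$, $D=d/dz$. For a differential operator $L=\sum_j a_jD^j$ with $a_j\in\mathcal Q$ put $\deg L=\max_j(\deg a_j-j)$, where the degree of a rational function is the degree of its numerator minus that of its denominator (and $\deg 0=-\infty$). A second-order operator $T=pD^2+qD+r$ ($p,q,r\in\mathcal Q$, $p\ne0$) is called *exceptional* if for all but finitely many $k\in\mathbb N$ it has a polynomial eigenfunction of degree exactly $k$. It is called a *Bochner operator* if $p,q,r\in\mathcal P$ and $\deg T=0$. Its weight is $W=\frac1p\exp\left(\int\frac qp\,dz\right)$, which is determined up to a nonzero multiplicative constant. The *primary poles* of $T$ are the poles of $q$ and $r$. Let $\mathcal U\subset\mathcal P$ be the largest $T$-invariant space of polynomials, and for $\zeta\in\mathbb C$ let the *gap cardinality* $\nu_\zeta$ be the number of $k\in\mathbb N$ that are not the order of vanishing at $\zeta$ of a nonzero element of $\mathcal U$. **Theorem.** Let $T=pD^2+qD+r$ be an exceptional operator with primary poles $\zeta_1,\dots,\zeta_N$ and corresponding gap cardinalities $\nu_i=\nu_{\zeta_i}$. Then $p$ is a polynomial of degree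 at most $2$, all the gap cardinalities $\nu_\zeta$, $\zeta\in\mathbb C$, are finite, and there is a Bochner operator $T_{\mathrm B}$ such that: 1. $T$ is Darboux connected to $T_{\mathrm B}$ through an intertwiner with polynomial coefficients, that is, there is a nonzero operator $L=\sum_j a_jD^j$ with all $a_j\in\mathcal P$ such that $TL=LT_{\mathrm B}$; 2. the weights $W$, $W_{\mathrm B}$ of $T$, $T_{\mathrm B}$ satisfy, up to a nonzero multiplicative constant, $$W(z)=W_{\mathrm B}(z)\,\frac{\chi(z)}{\eta(z)^2},\qquad \eta(z)=\prod_{i=1}^N(z-\zeta_i)^{\nu_i},$$ where $\chi\in\mathcal Q$ is a nonzero rational function with $\dfrac{\chi'(z)}{\chi(z)}=\dfrac{k}{p(z)}$ for some constant $k\in\mathbb C$. This relation holds for all determinations of $W$ and $W_{\mathrm B}$ on every connected open set that contains no pole of $p,q,r$ and no zero of $p$ (the constant depending on the determinations). -/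

import Mathlib

open Polynomial

noncomputable section

namespace ExcOp

/-- The derivative `f'` of a rational function `f = num / denom`, by the quotient rule. -/
def rderiv (f : RatFunc ℂ) : RatFunc ℂ :=
  algebraMap ℂ[X] (RatFunc ℂ)
      (derivative f.num * f.denom - f.num * derivative f.denom) /
    algebraMap ℂ[X] (RatFunc ℂ) f.denom ^ 2

/-- The quotient rule holds for every way of writing a rational function as a fraction. -/
theorem rderiv_div (a b : ℂ[X]) (hb : b ≠ 0) :
    rderiv (algebraMap ℂ[X] (RatFunc ℂ) a / algebraMap ℂ[X] (RatFunc ℂ) b) =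
      algebraMap ℂ[X] (RatFunc ℂ) (derivative a * b - a * derivative b) /
        algebraMap ℂ[X] (RatFunc ℂ) b ^ 2 := by
  generalize hf : algebraMap ℂ[X] (RatFunc ℂ) a / algebraMap ℂ[X] (RatFunc ℂ) b = f
  have hd : f.denom ≠ 0 := RatFunc.denom_ne_zero f
  have hb' : algebraMap ℂ[X] (RatFunc ℂ) b ≠ 0 := RatFunc.algebraMap_ne_zero hb
  have hd' : algebraMap ℂ[X] (RatFunc ℂ) f.denom ≠ 0 := RatFunc.algebraMap_ne_zero hd
  have h : f.num * b = a * f.denom := by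
    have h2 := (RatFunc.num_div_denom f).trans hf.symm
    rw [div_eq_div_iff hd' hb', ← map_mul, ← map_mul] at h2
    exact RatFunc.algebraMap_injective ℂ h2
  unfold rderiv
  generalize f.num = n at *
  generalize f.denom = d at *
  have hD := congrArg derivative h
  rw [derivative_mul, derivative_mul] at hD
  have key : (derivative n * d - n * derivative d) * b ^ 2 =
      (derivative a * b - a * derivative b) * d ^ 2 := by
    linear_combination (b * d) * hD - (derivative d * b + d * derivative b) * h
  rw [div_eq_div_iff (pow_ne_zero 2 hd') (pow_ne_zero 2 hb'), ← map_pow, ← map_pow, ← map_mul,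
    ← map_mul, key]

theorem rderiv_add (f g : RatFunc ℂ) : rderiv (f + g) = rderiv f + rderiv g := by
  have hf : algebraMap ℂ[X] (RatFunc ℂ) f.denom ≠ 0 :=
    RatFunc.algebraMap_ne_zero (RatFunc.denom_ne_zero f)
  have hg : algebraMap ℂ[X] (RatFunc ℂ) g.denom ≠ 0 :=
    RatFunc.algebraMap_ne_zero (RatFunc.denom_ne_zero g)
  have h : f + g = algebraMap ℂ[X] (RatFunc ℂ) (f.num * g.denom + f.denom * g.num) /
      algebraMap ℂ[X] (RatFunc ℂ) (f.denom * g.denom) := by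
    conv_lhs => rw [← RatFunc.num_div_denom f, ← RatFunc.num_div_denom g]
    rw [div_add_div _ _ hf hg]
    simp only [map_add, map_mul]
  rw [h, rderiv_div _ _ (mul_ne_zero (RatFunc.denom_ne_zero f) (RatFunc.denom_ne_zero g))]
  unfold rderiv
  simp only [derivative_mul, map_add, map_sub, map_mul]
  field_simp
  ring

theorem rderiv_smul (c : ℂ) (f : RatFunc ℂ) : rderiv (c • f) = c • rderiv f := by
  have h : c • f = algebraMap ℂ[X] (RatFunc ℂ) (C c * f.num) /
      algebraMap ℂ[X] (RatFunc ℂ) f.denom := by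
    conv_lhs => rw [← RatFunc.num_div_denom f]
    rw [map_mul, RatFunc.algebraMap_C, RatFunc.smul_eq_C_mul, mul_div_assoc]
  rw [h, rderiv_div _ _ (RatFunc.denom_ne_zero f)]
  unfold rderiv
  rw [RatFunc.smul_eq_C_mul, ← RatFunc.algebraMap_C, mul_div_assoc', ← map_mul]
  congr 2
  simp only [derivative_mul, derivative_C]
  ring

/-- Linear differential operators `L = ∑ⱼ aⱼ(z) Dʲ` with rational coefficients,
given by the finitely supported sequence of their coefficients `L j = aⱼ`. -/
abbrev DiffOp := ℕ →₀ RatFunc ℂ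

/-- The action `y ↦ L[y] = ∑ⱼ aⱼ y⁽ʲ⁾` on rational functions. -/
def act (L : DiffOp) (y : RatFunc ℂ) : RatFunc ℂ :=
  L.sum fun j a => a * rderiv^[j] y

theorem act_add (L : DiffOp) (f g : RatFunc ℂ) : act L (f + g) = act L f + act L g := by
  have h : ∀ j : ℕ, rderiv^[j] (f + g) = rderiv^[j] f + rderiv^[j] g := by
    intro j
    induction j with
    | zero => rfl
    | succ j ih => simp only [Function.iterate_succ_apply', ih, rderiv_add]
  simp only [act, Finsupp.sum, h, mul_add, Finset.sum_add_distrib]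

theorem act_smul (L : DiffOp) (c : ℂ) (f : RatFunc ℂ) : act L (c • f) = c • act L f := by
  have h : ∀ j : ℕ, rderiv^[j] (c • f) = c • rderiv^[j] f := by
    intro j
    induction j with
    | zero => rfl
    | succ j ih => simp only [Function.iterate_succ_apply', ih, rderiv_smul]
  simp only [act, Finsupp.sum, h, mul_smul_comm, Finset.smul_sum]

/-- `L` has order exactly `ρ`. -/
def HasOrder (L : DiffOp) (ρ : ℕ) : Prop :=
  L ρ ≠ 0 ∧ ∀ j, ρ < j → L j = 0

/-- All coefficients of `L` are polynomials. -/
def HasPolyCoeffs (L : DiffOp) : Prop :=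
  ∀ j, ∃ a : ℂ[X], L j = algebraMap ℂ[X] (RatFunc ℂ) a

/-- `deg L = maxⱼ (deg aⱼ - j)`, where the degree of a rational function is the degree of the
numerator minus that of the denominator; zero coefficients (degree `-∞`) do not contribute. -/
def opDegree (L : DiffOp) : WithBot ℤ :=
  L.support.sup fun j => (((L j).intDegree - (j : ℤ) : ℤ) : WithBot ℤ)

/-- Bochner (classical) operators: second order, polynomial coefficients, degree zero. -/
def IsBochner (T : DiffOp) : Prop :=
  HasOrder T 2 ∧ HasPolyCoeffs T ∧ opDegree T = 0

/-- `T` has a polynomial eigenfunction of degree exactly `k`. -/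
def HasEigenpolynomial (T : DiffOp) (k : ℕ) : Prop :=
  ∃ (y : ℂ[X]) (lam : ℂ), y.degree = (k : WithBot ℕ) ∧
    act T (algebraMap ℂ[X] (RatFunc ℂ) y) = lam • algebraMap ℂ[X] (RatFunc ℂ) y

/-- Exceptional operators: second order, with eigenpolynomials of all but finitely many degrees. -/
def IsExceptional (T : DiffOp) : Prop :=
  HasOrder T 2 ∧ {k : ℕ | ¬ HasEigenpolynomial T k}.Finite

/-- `L` is a nonzero operator with `T' L = L T`. Two elements of `Diff(ℂ(z))` are equal if and
only if they act in the same way on rational functions. -/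
def IsIntertwiner (T' T L : DiffOp) : Prop :=
  L ≠ 0 ∧ ∀ y : RatFunc ℂ, act T' (act L y) = act L (act T y)

/-- `T'` is Darboux connected to `T`. -/
def DarbouxConnected (T' T : DiffOp) : Prop :=
  ∃ L : DiffOp, IsIntertwiner T' T L

/-- The space `V` of polynomials is mapped to itself by `T`. -/
def IsInvariant (T : DiffOp) (V : Submodule ℂ ℂ[X]) : Prop :=
  ∀ y ∈ V, ∃ w ∈ V, act T (algebraMap ℂ[X] (RatFunc ℂ) y) = algebraMap ℂ[X] (RatFunc ℂ) w

/-- The maximal invariant polynomial subspace of `T`. -/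
def maxInvariant (T : DiffOp) : Submodule ℂ ℂ[X] :=
  sSup {V | IsInvariant T V}

theorem isGreatest_maxInvariant (T : DiffOp) :
    IsGreatest {V | IsInvariant T V} (maxInvariant T) := by
  refine ⟨?_, fun V hV => le_sSup hV⟩
  intro y hy
  rw [maxInvariant, sSup_eq_iSup'] at hy ⊢
  induction hy using Submodule.iSup_induction' with
  | mem V y hy =>
    obtain ⟨w, hw, h⟩ := V.2 y hy
    exact ⟨w, Submodule.mem_iSup_of_mem V hw, h⟩
  | zero =>
    refine ⟨0, Submodule.zero_mem _, ?_⟩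
    have := act_smul T 0 0
    simpa using this
  | add y₁ y₂ _ _ h₁ h₂ =>
    obtain ⟨w₁, hw₁, e₁⟩ := h₁
    obtain ⟨w₂, hw₂, e₂⟩ := h₂
    exact ⟨w₁ + w₂, Submodule.add_mem _ hw₁ hw₂, by rw [map_add, act_add, e₁, e₂, map_add]⟩

/-- The gaps of the order sequence at `ζ`: the natural numbers that are not the order of vanishing
at `ζ` of a nonzero element of the maximal invariant polynomial subspace. -/
def orderGaps (T : DiffOp) (ζ : ℂ) : Set ℕ :=
  {k | ¬ ∃ y ∈ maxInvariant T, y ≠ 0 ∧ y.rootMultiplicity ζ = k}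

/-- The gap cardinality `ν_ζ`. -/
def gapCard (T : DiffOp) (ζ : ℂ) : ℕ := (orderGaps T ζ).ncard

/-- `ζ` is a pole of the rational function `f` (`num` and `denom` are coprime). -/
def IsPole (f : RatFunc ℂ) (ζ : ℂ) : Prop := f.denom.eval ζ = 0

/-- The primary poles of `T = p D² + q D + r`: the poles of `q` or of `r`. -/
def primaryPoles (T : DiffOp) : Finset ℂ :=
  ((T 1).denom * (T 0).denom).roots.toFinset

theorem mem_primaryPoles (T : DiffOp) (ζ : ℂ) :
    ζ ∈ primaryPoles T ↔ IsPole (T 1) ζ ∨ IsPole (T 0) ζ := by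
  have h : (T 1).denom * (T 0).denom ≠ 0 :=
    mul_ne_zero (RatFunc.denom_ne_zero _) (RatFunc.denom_ne_zero _)
  rw [primaryPoles, Multiset.mem_toFinset, mem_roots h, IsRoot.def, eval_mul, mul_eq_zero]
  rfl

/-- `η(z) = ∏ᵢ (z - ζᵢ) ^ νᵢ`, the product over the primary poles. -/
def eta (T : DiffOp) : ℂ[X] :=
  ∏ ζ ∈ primaryPoles T, (X - C ζ) ^ gapCard T ζ

/-- The value of a rational function at a complex number (which should not be a pole). -/
def evalAt (z : ℂ) (f : RatFunc ℂ) : ℂ := f.eval (RingHom.id ℂ) z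

/-- `z` is not a pole of a coefficient of `T`, and not a zero of the leading coefficient `p`. -/
def IsRegularAt (T : DiffOp) (z : ℂ) : Prop :=
  (∀ j, ¬ IsPole (T j) z) ∧ evalAt z (T 2) ≠ 0

/-- `W` is, on the set `Ω`, a determination of the weight `W = P / p`, `P = exp (∫ q / p)`,
of `T = p D² + q D + r`. -/
def IsWeight (T : DiffOp) (Ω : Set ℂ) (W : ℂ → ℂ) : Prop :=
  ∃ F : ℂ → ℂ, ∀ z ∈ Ω,
    HasDerivAt F (evalAt z (T 1 / T 2)) z ∧ W z = Complex.exp (F z) / evalAt z (T 2)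

end ExcOp

end

/-!
The classical operator to which `T = p D² + q D + r` is connected is `T_B = p D² + q̃ D + c` with
`q̃ = q + 2 p η' / η` and a suitable constant `c`. With this choice the weights satisfy
`W = W_B / η²`, so `χ = 1` and `k = 0` will do.

*Local analysis.* Let `U` be the maximal invariant space of polynomials. The eigenpolynomials show
that `U` has finite codimension, so there are finitely many gaps at each point. At a point `ζ`, the
operator `T` lowers orders of vanishing by a fixed number `e`, except at the roots of the indicial
polynomial (`LocForm.order_step`). If `e > 0`, every class of orders modulo `e` has a smallest
element, which must be an indicial root; as the indicial polynomial is quadratic, `e ≤ 2`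
(`LocForm.le_add_two`). Hence `p` is a polynomial, and comparing degrees in the eigenvalue equations
gives `deg p ≤ 2`. If `e = 2`, the two indicial roots have opposite parities, the gaps are
the numbers below the root of the same parity, and the sum of the roots shows that `q` has residue
`-2 ν p(ζ)` at `ζ` (`LocForm.of_eq_add_two`). This occurs exactly when `p(ζ) ≠ 0`. If `ζ` is a
primary pole with `p(ζ) = 0`, then `e = 1` and all elements of `U` have order at least `ν`
(`IsExceptional.preserve_of_eq_zero`). It follows that `q̃` is a polynomial, of degree at most one.

*Gauge transformation.* Let `μ` be the part of `η` belonging to zeros of `p`, and `η₀` the other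
part. Then `μ⁻¹ T μ = T₀ - σ X + ρ` with `T₀ = p D² + q̃ D`, `X = [T₀, z] = 2 p D + q̃`,
`σ = η₀' / η₀`, and `ρ` has poles only at the zeros of `η₀`.

*Existence of the intertwiner.* Call `M = Σ (uᵢ + vᵢ X) T₀ⁱ` with polynomials `uᵢ`, `vᵢ` admissible
if all `(T₀ - σ X + ρ)ᵏ M` map polynomials to functions regular at the zeros of `η₀`. The operation
`δ M = (T₀ - σ X + ρ) M - M T₀` preserves admissibility (`Adm.delta`). The leading coefficient of a
nonzero admissible operator is divisible by `η₀`, because `δ` would lower a smaller order of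
vanishing again and again (`Adm.no_small_order`). On the other hand, the polynomials all of whose
images under `(T₀ - σ X + ρ)ᵏ` are regular at `ζ` have codimension at most `ν_ζ`
(`IsExceptional.exists_local_space`), so a count of dimensions provides a nonzero admissible `M`
with coefficients of degree at most `deg η₀` (`exists_adm_of_finrank`). After subtraction of a
constant from `ρ`, the leading terms of the coefficients of `δ M` cancel (`delta_asy`); being
admissible with coefficients of degree less than `deg η₀`, the operator `δ M` vanishes. So `μ M`
intertwines `T` with `T_B`.
-/

noncomputable section

namespace ExcOp

local notation "ι" => algebraMap ℂ[X] (RatFunc ℂ)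

/-! ### The derivation of the field of rational functions -/

theorem rderiv_algebraMap (a : ℂ[X]) : rderiv (ι a) = ι (derivative a) := by
  have h := rderiv_div a 1 one_ne_zero
  simpa using h

theorem rderiv_mul (f g : RatFunc ℂ) : rderiv (f * g) = rderiv f * g + f * rderiv g := by
  have hf : ι f.denom ≠ 0 := RatFunc.algebraMap_ne_zero (RatFunc.denom_ne_zero f)
  have hg : ι g.denom ≠ 0 := RatFunc.algebraMap_ne_zero (RatFunc.denom_ne_zero g)
  have h : f * g = ι (f.num * g.num) / ι (f.denom * g.denom) := by
    conv_lhs => rw [← RatFunc.num_div_denom f, ← RatFunc.num_div_denom g]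
    rw [div_mul_div_comm, map_mul, map_mul]
  rw [h, rderiv_div _ _ (mul_ne_zero (RatFunc.denom_ne_zero f) (RatFunc.denom_ne_zero g))]
  conv_rhs =>
    enter [1, 2]
    rw [← RatFunc.num_div_denom g]
  conv_rhs =>
    enter [2, 1]
    rw [← RatFunc.num_div_denom f]
  unfold rderiv
  simp only [derivative_mul, map_add, map_sub, map_mul]
  field_simp
  ring

/-- The derivation `d/dz` as a `ℂ`-linear map. -/
def rD : RatFunc ℂ →ₗ[ℂ] RatFunc ℂ where
  toFun := rderiv
  map_add' := rderiv_add
  map_smul' := rderiv_smul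

theorem rD_apply (f : RatFunc ℂ) : rD f = rderiv f := rfl

theorem rD_mul (f g : RatFunc ℂ) : rD (f * g) = rD f * g + f * rD g := rderiv_mul f g

theorem rD_algebraMap (a : ℂ[X]) : rD (ι a) = ι (derivative a) := rderiv_algebraMap a

theorem rD_one : rD 1 = 0 := by
  have := rD_algebraMap 1
  simpa using this

/-! ### Rational functions regular at a point -/

/-- The local ring of rational functions without a pole at `ζ`. -/
def regAt (ζ : ℂ) : Subalgebra ℂ[X] (RatFunc ℂ) where
  carrier := {f | ∃ a b : ℂ[X], b.eval ζ ≠ 0 ∧ f = ι a / ι b}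
  mul_mem' := by
    rintro _ _ ⟨a, b, hb, rfl⟩ ⟨c, d, hd, rfl⟩
    exact ⟨a * c, b * d, by simp [hb, hd], by rw [map_mul, map_mul, div_mul_div_comm]⟩
  add_mem' := by
    rintro _ _ ⟨a, b, hb, rfl⟩ ⟨c, d, hd, rfl⟩
    refine ⟨a * d + b * c, b * d, by simp [hb, hd], ?_⟩
    have hb' : ι b ≠ 0 := RatFunc.algebraMap_ne_zero (by rintro rfl; simp at hb)
    have hd' : ι d ≠ 0 := RatFunc.algebraMap_ne_zero (by rintro rfl; simp at hd)
    rw [div_add_div _ _ hb' hd']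
    simp only [map_add, map_mul]
  algebraMap_mem' := fun a => ⟨a, 1, by simp, by simp⟩

theorem algebraMap_mem_regAt (ζ : ℂ) (a : ℂ[X]) : ι a ∈ regAt ζ :=
  (regAt ζ).algebraMap_mem a

theorem smul_mem_regAt {ζ : ℂ} {f : RatFunc ℂ} (c : ℂ) (hf : f ∈ regAt ζ) : c • f ∈ regAt ζ := by
  rw [RatFunc.smul_eq_C_mul, ← RatFunc.algebraMap_C]
  exact mul_mem (algebraMap_mem_regAt ζ _) hf

theorem ne_zero_of_eval {a : ℂ[X]} {ζ : ℂ} (h : a.eval ζ ≠ 0) : a ≠ 0 := by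
  rintro rfl
  simp at h

theorem algebraMap_ne_zero_of_eval {a : ℂ[X]} {ζ : ℂ} (h : a.eval ζ ≠ 0) : ι a ≠ 0 :=
  RatFunc.algebraMap_ne_zero (ne_zero_of_eval h)

theorem div_mem_regAt {ζ : ℂ} {f : RatFunc ℂ} (hf : f ∈ regAt ζ) {b : ℂ[X]}
    (hb : b.eval ζ ≠ 0) : f / ι b ∈ regAt ζ := by
  rw [div_eq_mul_inv]
  refine mul_mem hf ⟨1, b, hb, by simp⟩

theorem mem_regAt_of_mul {ζ : ℂ} {f : RatFunc ℂ} {b : ℂ[X]}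
    (hb : b.eval ζ ≠ 0) (hf : ι b * f ∈ regAt ζ) : f ∈ regAt ζ := by
  have h := div_mem_regAt hf hb
  rwa [mul_div_cancel_left₀ _ (algebraMap_ne_zero_of_eval hb)] at h

theorem rD_mem_regAt {ζ : ℂ} {f : RatFunc ℂ} (hf : f ∈ regAt ζ) : rD f ∈ regAt ζ := by
  obtain ⟨a, b, hb, rfl⟩ := hf
  refine ⟨derivative a * b - a * derivative b, b ^ 2, by simp [hb], ?_⟩
  rw [rD_apply, rderiv_div _ _ (ne_zero_of_eval hb), map_pow]

theorem mem_regAt_iff_denom {ζ : ℂ} {f : RatFunc ℂ} : f ∈ regAt ζ ↔ f.denom.eval ζ ≠ 0 := by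
  constructor
  · rintro ⟨a, b, hb, rfl⟩ h
    obtain ⟨c, hc⟩ := RatFunc.denom_div_dvd a b
    apply hb
    rw [hc, eval_mul, h, zero_mul]
  · exact fun h => ⟨f.num, f.denom, h, (RatFunc.num_div_denom f).symm⟩

theorem not_isPole_iff {ζ : ℂ} {f : RatFunc ℂ} : ¬ IsPole f ζ ↔ f ∈ regAt ζ :=
  mem_regAt_iff_denom.symm

theorem exists_polynomial_of_forall_mem_regAt {f : RatFunc ℂ} (h : ∀ ζ, f ∈ regAt ζ) :
    ∃ a : ℂ[X], f = ι a := by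
  have hd : f.denom.degree = 0 := by
    by_contra hne
    obtain ⟨ζ, hζ⟩ := IsAlgClosed.exists_root f.denom hne
    exact mem_regAt_iff_denom.1 (h ζ) hζ
  have h1 : f.denom = 1 := by
    rw [eq_C_of_degree_eq_zero hd]
    have := RatFunc.monic_denom f
    rw [eq_C_of_degree_eq_zero hd, Monic, leadingCoeff_C] at this
    rw [this, C_1]
  exact ⟨f.num, by conv_lhs => rw [← RatFunc.num_div_denom f, h1, map_one, div_one]⟩

/-! ### Orders of growth at infinity -/

/-- The degree (numerator minus denominator) of `f` is at most `n`; the zero function qualifies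
for every `n`. -/
def DegLE (f : RatFunc ℂ) (n : ℤ) : Prop := f = 0 ∨ f.intDegree ≤ n

theorem DegLE.zero (n : ℤ) : DegLE 0 n := Or.inl rfl

theorem DegLE.mono {f : RatFunc ℂ} {m n : ℤ} (h : DegLE f m) (hmn : m ≤ n) : DegLE f n :=
  h.imp_right fun h => h.trans hmn

theorem DegLE.add {f g : RatFunc ℂ} {n : ℤ} (hf : DegLE f n) (hg : DegLE g n) :
    DegLE (f + g) n := by
  by_cases hf0 : f = 0
  · simpa [hf0] using hg
  by_cases hg0 : g = 0
  · simpa [hg0] using hf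
  by_cases h : f + g = 0
  · exact Or.inl h
  · exact Or.inr ((RatFunc.intDegree_add_le hg0 h).trans
      (max_le (hf.resolve_left hf0) (hg.resolve_left hg0)))

theorem DegLE.neg {f : RatFunc ℂ} {n : ℤ} (hf : DegLE f n) : DegLE (-f) n :=
  hf.imp (fun h => by simp [h]) (fun h => by rwa [RatFunc.intDegree_neg])

theorem DegLE.sub {f g : RatFunc ℂ} {n : ℤ} (hf : DegLE f n) (hg : DegLE g n) :
    DegLE (f - g) n := by
  rw [sub_eq_add_neg]
  exact hf.add hg.neg

theorem DegLE.mul {f g : RatFunc ℂ} {m n : ℤ} (hf : DegLE f m) (hg : DegLE g n) :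
    DegLE (f * g) (m + n) := by
  by_cases hf0 : f = 0
  · exact Or.inl (by simp [hf0])
  by_cases hg0 : g = 0
  · exact Or.inl (by simp [hg0])
  · refine Or.inr ?_
    rw [RatFunc.intDegree_mul hf0 hg0]
    exact add_le_add (hf.resolve_left hf0) (hg.resolve_left hg0)

theorem degLE_algebraMap {a : ℂ[X]} {n : ℕ} : DegLE (ι a) n ↔ a.natDegree ≤ n := by
  by_cases ha : a = 0
  · simp [ha, DegLE]
  · simp [DegLE, ha]

theorem degree_lt_of_degLE {a : ℂ[X]} {n : ℤ} (h : DegLE (ι a) n) {m : ℕ} (hn : n < m) :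
    a.degree < m := by
  rcases h with h | h
  · have : a = 0 := by simpa using h
    simp [this]
  · rw [RatFunc.intDegree_polynomial] at h
    by_cases ha : a = 0
    · simp [ha]
    · rw [degree_eq_natDegree ha]
      exact_mod_cast h.trans_lt hn

theorem DegLE.algebraMap_of_degree_lt {a : ℂ[X]} {m : ℕ} (h : a.degree < m) :
    DegLE (ι a) ((m : ℤ) - 1) := by
  by_cases ha : a = 0
  · exact Or.inl (by simp [ha])
  · right
    rw [RatFunc.intDegree_polynomial]
    rw [degree_eq_natDegree ha] at h
    have : a.natDegree < m := by exact_mod_cast h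
    omega

theorem degLE_C (c : ℂ) : DegLE (RatFunc.C c) 0 := Or.inr (by simp)

theorem degLE_C_mul_zpow (c : ℂ) (n : ℤ) : DegLE (RatFunc.C c * RatFunc.X ^ n) n := by
  have h : DegLE ((RatFunc.X : RatFunc ℂ) ^ n) n := by
    right
    have hnat : ∀ m : ℕ, ((RatFunc.X : RatFunc ℂ) ^ m).intDegree = m := by
      intro m
      rw [← RatFunc.algebraMap_X, ← map_pow, RatFunc.intDegree_polynomial, natDegree_X_pow]
    obtain ⟨m, rfl | rfl⟩ := n.eq_nat_or_neg
    · rw [zpow_natCast, hnat]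
    · rw [zpow_neg, zpow_natCast, RatFunc.intDegree_inv, hnat]
  simpa using (degLE_C c).mul h

/-- `f = c zⁿ + ` terms of lower degree at infinity; the coefficient `c` may vanish. -/
def Asy (f : RatFunc ℂ) (n : ℤ) (c : ℂ) : Prop :=
  DegLE (f - RatFunc.C c * RatFunc.X ^ n) (n - 1)

theorem Asy.degLE {f : RatFunc ℂ} {n : ℤ} {c : ℂ} (h : Asy f n c) : DegLE f n := by
  have := (h.mono (show n - 1 ≤ n by omega)).add (degLE_C_mul_zpow c n)
  simpa using this

theorem Asy.degLE_pred {f : RatFunc ℂ} {n : ℤ} {c : ℂ} (h : Asy f n c) (hc : c = 0) :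
    DegLE f (n - 1) := by
  simpa [Asy, hc] using h

theorem Asy.congr {f : RatFunc ℂ} {m n : ℤ} {c d : ℂ} (h : Asy f n c) (hn : n = m) (hc : c = d) :
    Asy f m d := by
  subst hn hc
  exact h

theorem Asy.zero (n : ℤ) : Asy 0 n 0 := by
  simpa [Asy] using DegLE.zero _

theorem Asy.add {f g : RatFunc ℂ} {n : ℤ} {c d : ℂ} (hf : Asy f n c) (hg : Asy g n d) :
    Asy (f + g) n (c + d) := by
  have := DegLE.add hf hg
  rw [Asy]
  convert this using 1
  rw [map_add]
  ring

theorem Asy.neg {f : RatFunc ℂ} {n : ℤ} {c : ℂ} (hf : Asy f n c) : Asy (-f) n (-c) := by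
  have := DegLE.neg hf
  rw [Asy]
  convert this using 1
  rw [map_neg]
  ring

theorem Asy.sub {f g : RatFunc ℂ} {n : ℤ} {c d : ℂ} (hf : Asy f n c) (hg : Asy g n d) :
    Asy (f - g) n (c - d) := by
  rw [sub_eq_add_neg, sub_eq_add_neg]
  exact hf.add hg.neg

theorem Asy.mul {f g : RatFunc ℂ} {m n : ℤ} {c d : ℂ} (hf : Asy f m c) (hg : Asy g n d) :
    Asy (f * g) (m + n) (c * d) := by
  have h1 := DegLE.mul hf hg.degLE
  have h2 := DegLE.mul (degLE_C_mul_zpow c m) hg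
  have := (h1.mono (show m - 1 + n ≤ m + n - 1 by omega)).add
    (h2.mono (show m + (n - 1) ≤ m + n - 1 by omega))
  rw [Asy]
  convert this using 1
  rw [map_mul, zpow_add₀ RatFunc.X_ne_zero]
  ring

theorem Asy.const_mul {f : RatFunc ℂ} {n : ℤ} {c : ℂ} (a : ℂ) (hf : Asy f n c) :
    Asy (RatFunc.C a * f) n (a * c) := by
  have := DegLE.mul (degLE_C a) hf
  rw [Asy]
  convert this using 1
  · rw [map_mul]
    ring
  · omega

theorem asy_algebraMap {a : ℂ[X]} {n : ℕ} (h : a.natDegree ≤ n) : Asy (ι a) n (a.coeff n) := by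
  have h1 : (a - C (a.coeff n) * X ^ n).degree < (n : WithBot ℕ) := by
    rw [degree_lt_iff_coeff_zero]
    intro m hm
    rw [coeff_sub, coeff_C_mul, coeff_X_pow]
    rcases hm.eq_or_lt with rfl | hm
    · simp
    · rw [if_neg hm.ne', coeff_eq_zero_of_natDegree_lt (h.trans_lt hm)]
      simp
  have h2 := DegLE.algebraMap_of_degree_lt h1
  rw [Asy]
  convert h2 using 1
  simp

theorem asy_derivative {a : ℂ[X]} {n : ℕ} (h : a.natDegree ≤ n) :
    Asy (ι (derivative a)) ((n : ℤ) - 1) (n * a.coeff n) := by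
  rcases n with _ | n
  · rw [eq_C_of_natDegree_le_zero h]
    simpa using Asy.zero (-1)
  · have h1 : (derivative a).natDegree ≤ n := (natDegree_derivative_le a).trans (by omega)
    refine (asy_algebraMap h1).congr (by push_cast; ring) ?_
    rw [coeff_derivative]
    push_cast
    ring

theorem asy_eq_zero {f : RatFunc ℂ} {n : ℤ} {c : ℂ} (h : Asy f n c) (hf : DegLE f (n - 1)) :
    c = 0 := by
  by_contra hc
  have h1 : DegLE (RatFunc.C c * RatFunc.X ^ n) (n - 1) := by
    simpa using hf.sub h
  have h2 := (degLE_C_mul_zpow c⁻¹ (-n)).mul h1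
  have h3 : RatFunc.C c⁻¹ * RatFunc.X ^ (-n) * (RatFunc.C c * RatFunc.X ^ n) = (1 : RatFunc ℂ) := by
    rw [mul_mul_mul_comm, ← map_mul, inv_mul_cancel₀ hc, ← zpow_add₀ RatFunc.X_ne_zero]
    simp
  rw [h3] at h2
  rcases h2 with h2 | h2
  · exact one_ne_zero h2
  · rw [RatFunc.intDegree_one] at h2
    omega

theorem asy_div {a b : ℂ[X]} {m n : ℕ} (hb : b.Monic) (hn : b.natDegree = n)
    (h : a.natDegree ≤ m) : Asy (ι a / ι b) ((m : ℤ) - n) (a.coeff m) := by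
  have hb0 : ι b ≠ 0 := RatFunc.algebraMap_ne_zero hb.ne_zero
  have ha := asy_algebraMap h
  have hb1 : Asy (ι b) n 1 := by
    have := asy_algebraMap hn.le
    rwa [← hn, hb.coeff_natDegree, hn] at this
  have hbi : DegLE (ι b)⁻¹ (-n) := Or.inr (by
    rw [RatFunc.intDegree_inv, RatFunc.intDegree_polynomial, hn])
  have h1 := ha.degLE
  -- `b⁻¹ - z⁻ⁿ = -b⁻¹ z⁻ⁿ (b - zⁿ)`
  have hbi' : Asy (ι b)⁻¹ (-n) 1 := by
    have h2 := ((hbi.mul (degLE_C_mul_zpow 1 (-(n : ℤ)))).mul hb1).neg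
    rw [Asy]
    convert h2 using 1
    · simp only [map_one, one_mul, zpow_neg]
      have : (RatFunc.X : RatFunc ℂ) ^ (n : ℤ) ≠ 0 := zpow_ne_zero _ RatFunc.X_ne_zero
      field_simp
      ring
    · omega
  rw [div_eq_mul_inv]
  exact (ha.mul hbi').congr (by ring) (by ring)

theorem exists_asy_of_degLE {f : RatFunc ℂ} (h : DegLE f 0) : ∃ c, Asy f 0 c := by
  rcases h with rfl | h
  · exact ⟨0, Asy.zero 0⟩
  · have h1 : f.num.natDegree ≤ f.denom.natDegree := by
      rw [RatFunc.intDegree] at h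
      omega
    have h2 := asy_div (RatFunc.monic_denom f) rfl h1
    rw [RatFunc.num_div_denom, sub_self] at h2
    exact ⟨_, h2⟩

/-! ### Second-order operators and the operators `Σ (uᵢ + vᵢ X) T₀ⁱ` -/

/-- The operator `p D² + q D + r` as a linear map on rational functions. -/
def op2 (p q r : RatFunc ℂ) : Module.End ℂ (RatFunc ℂ) :=
  LinearMap.mulLeft ℂ p ∘ₗ rD ∘ₗ rD + LinearMap.mulLeft ℂ q ∘ₗ rD + LinearMap.mulLeft ℂ r

theorem op2_apply (p q r y : RatFunc ℂ) :
    op2 p q r y = p * rD (rD y) + q * rD y + r * y := rfl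

/-- The classical operator `T₀ = p D² + q D` with polynomial coefficients. -/
def opT (p q : ℂ[X]) : Module.End ℂ (RatFunc ℂ) := op2 (ι p) (ι q) 0

/-- The commutator `2 p D + q` of `T₀` with multiplication by `z` (if `q` stands for the
first-order coefficient of `T₀`). -/
def opX (p q : ℂ[X]) : Module.End ℂ (RatFunc ℂ) := op2 0 (ι (2 * p)) (ι q)

/-- The operator `Σ (uᵢ + vᵢ X) T₀ⁱ`, the sum extending over `i < n`. -/
def opM (p q : ℂ[X]) (n : ℕ) (w : ℕ → RatFunc ℂ × RatFunc ℂ) : Module.End ℂ (RatFunc ℂ) :=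
  ∑ i ∈ Finset.range n, (LinearMap.mulLeft ℂ (w i).1 ∘ₗ (opT p q ^ i) +
    LinearMap.mulLeft ℂ (w i).2 ∘ₗ opX p q ∘ₗ (opT p q ^ i))

theorem opT_apply (p q : ℂ[X]) (y : RatFunc ℂ) :
    opT p q y = ι p * rD (rD y) + ι q * rD y := by
  simp [opT, op2_apply]

theorem opX_apply (p q : ℂ[X]) (y : RatFunc ℂ) :
    opX p q y = 2 * ι p * rD y + ι q * y := by
  simp only [opX, op2_apply, map_mul, map_ofNat]
  ring

theorem opM_apply (p q : ℂ[X]) (n : ℕ) (w : ℕ → RatFunc ℂ × RatFunc ℂ) (y : RatFunc ℂ) :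
    opM p q n w y = ∑ i ∈ Finset.range n, ((w i).1 * (opT p q ^ i) y +
      (w i).2 * opX p q ((opT p q ^ i) y)) := by
  simp [opM, LinearMap.sum_apply]

/-- The polynomial `τ` in `X² = 4 p T₀ + 2 p' X + τ`. -/
def tauP (p q : ℂ[X]) : ℂ[X] := q ^ 2 - 2 * derivative p * q + 2 * p * derivative q

/-- The polynomial `ε` in `[T₀, X] = 2 p' T₀ + p'' X + ε`. -/
def epsP (p q : ℂ[X]) : ℂ[X] := q * (derivative q - derivative (derivative p))

/-- The coefficient of `T₀` in `T (u + v X) - (u + v X) T₀`, where `T = T₀ - σ X + ρ`. -/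
def dA (p : ℂ[X]) (σ : RatFunc ℂ) (v : RatFunc ℂ) : RatFunc ℂ :=
  4 * ι p * rD v + 2 * ι (derivative p) * v - 4 * ι p * σ * v

/-- The coefficient of `X` in `T (u + v X) - (u + v X) T₀`, where `T = T₀ - σ X + ρ`. -/
def dB (p : ℂ[X]) (σ ρ : RatFunc ℂ) (u v : RatFunc ℂ) : RatFunc ℂ :=
  rD u - σ * u + (ι p * rD (rD v) + 2 * ι (derivative p) * rD v - 2 * ι (derivative p) * σ * v
    - 2 * ι p * σ * rD v + (ι (derivative (derivative p)) + ρ) * v)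

/-- The coefficient of `1` in `T (u + v X) - (u + v X) T₀`, where `T = T₀ - σ X + ρ`. -/
def dC (p q : ℂ[X]) (σ ρ : RatFunc ℂ) (u v : RatFunc ℂ) : RatFunc ℂ :=
  ι p * rD (rD u) - 2 * ι p * σ * rD u + ρ * u + ι (tauP p q) * (rD v - σ * v) + ι (epsP p q) * v

/-- The coefficients of `T M - M T₀` for `M = Σ (uᵢ + vᵢ X) T₀ⁱ` and `T = T₀ - σ X + ρ`. -/
def delta (p q : ℂ[X]) (σ ρ : RatFunc ℂ) (w : ℕ → RatFunc ℂ × RatFunc ℂ) :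
    ℕ → RatFunc ℂ × RatFunc ℂ := fun i =>
  (dC p q σ ρ (w i).1 (w i).2 + (if i = 0 then 0 else dA p σ (w (i - 1)).2),
    dB p σ ρ (w i).1 (w i).2)

/-- The operator `T = T₀ - σ X + ρ`. -/
def opS (p q : ℂ[X]) (σ ρ : RatFunc ℂ) : Module.End ℂ (RatFunc ℂ) :=
  opT p q - LinearMap.mulLeft ℂ σ ∘ₗ opX p q + LinearMap.mulLeft ℂ ρ

theorem opS_apply (p q : ℂ[X]) (σ ρ y : RatFunc ℂ) :
    opS p q σ ρ y = opT p q y - σ * opX p q y + ρ * y := rfl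

/-- The identity behind `opS_comp_sub`, in an arbitrary differential ring. -/
theorem commutator_identity {R : Type*} [CommRing R] (D : R → R)
    (hadd : ∀ a b, D (a + b) = D a + D b) (hmul : ∀ a b, D (a * b) = D a * b + a * D b)
    (h0 : D 0 = 0) (h2 : D 2 = 0) (p q σ ρ u v w : R) (hq : D (D q) = 0)
    (T X : R → R) (hT : ∀ y, T y = p * D (D y) + q * D y) (hX : ∀ y, X y = 2 * p * D y + q * y) :
    T (u * w + v * X w) - σ * X (u * w + v * X w) + ρ * (u * w + v * X w) -
      (u * T w + v * X (T w)) =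
    (4 * p * D v + 2 * D p * v - 4 * p * σ * v) * T w +
    (D u - σ * u + (p * D (D v) + 2 * D p * D v - 2 * D p * σ * v - 2 * p * σ * D v +
      (D (D p) + ρ) * v)) * X w +
    (p * D (D u) - 2 * p * σ * D u + ρ * u + (q ^ 2 - 2 * D p * q + 2 * p * D q) * (D v - σ * v) +
      q * (D q - D (D p)) * v) * w := by
  simp only [hT, hX, hadd, hmul, h0, h2, hq]
  ring

theorem opS_comp_sub (p q : ℂ[X]) (hq : q.natDegree ≤ 1)
    (σ ρ u v w : RatFunc ℂ) :
    opS p q σ ρ (u * w + v * opX p q w) - (u * opT p q w + v * opX p q (opT p q w)) =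
      dA p σ v * opT p q w + dB p σ ρ u v * opX p q w + dC p q σ ρ u v * w := by
  have hq2 : rD (rD (ι q)) = 0 := by
    have h1 : (derivative (derivative q)) = 0 := by
      have := iterate_derivative_eq_zero (p := q) (x := 2) (by omega)
      simpa using this
    rw [rD_algebraMap, rD_algebraMap, h1, map_zero]
  have h2 : rD (2 : RatFunc ℂ) = 0 := by
    rw [← map_ofNat (ι) 2, rD_algebraMap, derivative_ofNat, map_zero]
  have key := commutator_identity rD (map_add rD) rD_mul (map_zero rD) h2 (ι p) (ι q) σ ρ u v w hq2
    (opT p q) (opX p q) (opT_apply p q) (opX_apply p q)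
  have hτ : ι (tauP p q) =
      ι q ^ 2 - 2 * ι (derivative p) * ι q + 2 * ι p * ι (derivative q) := by
    simp [tauP, map_ofNat]
  have hε : ι (epsP p q) = ι q * (ι (derivative q) - ι (derivative (derivative p))) := by
    simp [epsP]
  simpa only [opS_apply, dA, dB, dC, hτ, hε, rD_algebraMap] using key

theorem opS_opM (p q : ℂ[X]) (hq : q.natDegree ≤ 1)
    (σ ρ : RatFunc ℂ) (n : ℕ) (w : ℕ → RatFunc ℂ × RatFunc ℂ) (hw : ∀ i, n ≤ i → w i = 0)
    (y : RatFunc ℂ) :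
    opS p q σ ρ (opM p q n w y) - opM p q n w (opT p q y) =
      opM p q (n + 1) (delta p q σ ρ w) y := by
  have hT : ∀ i, (opT p q ^ i) (opT p q y) = opT p q ((opT p q ^ i) y) := by
    intro i
    rw [← Module.End.mul_apply, ← Module.End.mul_apply, ← pow_succ, ← pow_succ']
  have hL : opS p q σ ρ (opM p q n w y) - opM p q n w (opT p q y) =
      ∑ i ∈ Finset.range n, (dA p σ (w i).2 * (opT p q ^ (i + 1)) y +
        (dB p σ ρ (w i).1 (w i).2 * opX p q ((opT p q ^ i) y) +
          dC p q σ ρ (w i).1 (w i).2 * (opT p q ^ i) y)) := by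
    rw [opM_apply, opM_apply, map_sum, ← Finset.sum_sub_distrib]
    refine Finset.sum_congr rfl fun i _ => ?_
    rw [hT i, opS_comp_sub p q hq, pow_succ', Module.End.mul_apply]
    ring
  have hn : w n = 0 := hw n le_rfl
  rw [hL, opM_apply, Finset.sum_add_distrib]
  have h1 : ∀ i, (delta p q σ ρ w i).1 * (opT p q ^ i) y +
      (delta p q σ ρ w i).2 * opX p q ((opT p q ^ i) y) =
      (if i = 0 then 0 else dA p σ (w (i - 1)).2) * (opT p q ^ i) y +
      (dB p σ ρ (w i).1 (w i).2 * opX p q ((opT p q ^ i) y) +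
          dC p q σ ρ (w i).1 (w i).2 * (opT p q ^ i) y) := by
    intro i
    simp only [delta]
    ring
  simp only [h1]
  rw [Finset.sum_add_distrib (s := Finset.range (n + 1)), Finset.sum_range_succ' (fun i =>
    (if i = 0 then 0 else dA p σ (w (i - 1)).2) * (opT p q ^ i) y),
    Finset.sum_range_succ (fun i => dB p σ ρ (w i).1 (w i).2 * opX p q ((opT p q ^ i) y) +
          dC p q σ ρ (w i).1 (w i).2 * (opT p q ^ i) y)]
  simp [hn, dB, dC]

theorem delta_eq_zero (p q : ℂ[X]) (σ ρ : RatFunc ℂ) (n : ℕ)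
    (w : ℕ → RatFunc ℂ × RatFunc ℂ) (hw : ∀ i, n ≤ i → w i = 0) :
    ∀ i, n + 1 ≤ i → delta p q σ ρ w i = 0 := by
  intro i hi
  have h1 := hw i (by omega)
  have h2 := hw (i - 1) (by omega)
  simp [delta, h1, h2, dA, dB, dC]

/-! ### Differential operators with polynomial coefficients -/

theorem act_eq_sum_of_support_subset (L : DiffOp) (s : Finset ℕ) (hs : L.support ⊆ s)
    (y : RatFunc ℂ) : act L y = ∑ j ∈ s, L j * rderiv^[j] y := by
  rw [act, Finsupp.sum]
  exact Finset.sum_subset hs fun j _ hj => by simp [Finsupp.notMem_support_iff.1 hj]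

theorem act_single (j : ℕ) (a y : RatFunc ℂ) :
    act (Finsupp.single j a) y = a * rderiv^[j] y := by
  simp [act]

theorem act_add_left (L L' : DiffOp) (y : RatFunc ℂ) :
    act (L + L') y = act L y + act L' y := by
  unfold act
  exact Finsupp.sum_add_index' (by simp) (by intros; ring)

/-- `L` realizes the linear map `φ`, has polynomial coefficients and order at most `N`. -/
def Realizes (L : DiffOp) (φ : Module.End ℂ (RatFunc ℂ)) (N : ℕ) : Prop :=
  (∀ y, act L y = φ y) ∧ HasPolyCoeffs L ∧ ∀ j, N < j → L j = 0

theorem Realizes.add {L L' : DiffOp} {φ φ' : Module.End ℂ (RatFunc ℂ)} {N : ℕ}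
    (h : Realizes L φ N) (h' : Realizes L' φ' N) : Realizes (L + L') (φ + φ') N := by
  refine ⟨fun y => by rw [act_add_left, h.1, h'.1]; rfl, fun j => ?_, fun j hj => ?_⟩
  · obtain ⟨a, ha⟩ := h.2.1 j
    obtain ⟨b, hb⟩ := h'.2.1 j
    exact ⟨a + b, by rw [Finsupp.add_apply, ha, hb, map_add]⟩
  · rw [Finsupp.add_apply, h.2.2 j hj, h'.2.2 j hj, add_zero]

theorem act_mapRange_mul (a : RatFunc ℂ) (L : DiffOp) (y : RatFunc ℂ) :
    act (L.mapRange (a * ·) (mul_zero a)) y = a * act L y := by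
  rw [act, Finsupp.sum_mapRange_index (by simp), act, Finsupp.mul_sum]
  simp only [mul_assoc]

theorem Realizes.mul {L : DiffOp} {φ : Module.End ℂ (RatFunc ℂ)} {N : ℕ} (a : ℂ[X])
    (h : Realizes L φ N) :
    Realizes (L.mapRange (ι a * ·) (mul_zero _)) (LinearMap.mulLeft ℂ (ι a) ∘ₗ φ) N := by
  refine ⟨fun y => ?_, fun j => ?_, fun j hj => ?_⟩
  · rw [act_mapRange_mul, h.1]; rfl
  · obtain ⟨b, hb⟩ := h.2.1 j
    exact ⟨a * b, by rw [Finsupp.mapRange_apply, hb, map_mul]⟩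
  · rw [Finsupp.mapRange_apply, h.2.2 j hj, mul_zero]

theorem rderiv_zero : rderiv 0 = 0 := rD.map_zero

/-- The composition `D ∘ L = Σ (aⱼ' Dʲ + aⱼ Dʲ⁺¹)`. -/
def derivComp (L : DiffOp) : DiffOp :=
  L.mapRange rderiv rderiv_zero + L.mapDomain Nat.succ

theorem derivComp_zero (L : DiffOp) : derivComp L 0 = rderiv (L 0) := by
  rw [derivComp, Finsupp.add_apply, Finsupp.mapRange_apply,
    Finsupp.mapDomain_of_notMem_range _ _ (by simp), add_zero]

theorem derivComp_succ (L : DiffOp) (j : ℕ) :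
    derivComp L (j + 1) = rderiv (L (j + 1)) + L j := by
  rw [derivComp, Finsupp.add_apply, Finsupp.mapRange_apply]
  congr 1
  exact Finsupp.mapDomain_apply Nat.succ_injective L j

theorem act_derivComp (L : DiffOp) (y : RatFunc ℂ) : act (derivComp L) y = rD (act L y) := by
  rw [derivComp, act_add_left, act, act, act,
    Finsupp.sum_mapRange_index (by simp), Finsupp.sum_mapDomain_index (by simp) (by intros; ring)]
  simp only [Finsupp.sum, map_sum, ← Finset.sum_add_distrib]
  refine Finset.sum_congr rfl fun j _ => ?_
  rw [rD_mul, Function.iterate_succ_apply']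
  rfl

theorem Realizes.deriv {L : DiffOp} {φ : Module.End ℂ (RatFunc ℂ)} {N : ℕ}
    (h : Realizes L φ N) : Realizes (derivComp L) (rD ∘ₗ φ) (N + 1) := by
  refine ⟨fun y => by rw [act_derivComp, h.1]; rfl, fun j => ?_, fun j hj => ?_⟩
  · rcases j with _ | j
    · obtain ⟨a, ha⟩ := h.2.1 0
      exact ⟨derivative a, by rw [derivComp_zero, ha, rderiv_algebraMap]⟩
    · obtain ⟨a, ha⟩ := h.2.1 (j + 1)
      obtain ⟨b, hb⟩ := h.2.1 j
      exact ⟨derivative a + b, by rw [derivComp_succ, ha, hb, rderiv_algebraMap, map_add]⟩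
  · rcases j with _ | j
    · omega
    · rw [derivComp_succ, h.2.2 _ (by omega), h.2.2 j (by omega)]
      simp [rderiv_zero]

theorem Realizes.mono {L : DiffOp} {φ : Module.End ℂ (RatFunc ℂ)} {N M : ℕ}
    (h : Realizes L φ N) (hNM : N ≤ M) : Realizes L φ M :=
  ⟨h.1, h.2.1, fun j hj => h.2.2 j (by omega)⟩

theorem exists_realizes_opX (p q : ℂ[X]) {L : DiffOp} {φ : Module.End ℂ (RatFunc ℂ)} {N : ℕ}
    (h : Realizes L φ N) :
    ∃ L', Realizes L' (opX p q ∘ₗ φ) (N + 1) ∧ L' (N + 1) = 2 * ι p * L N := by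
  refine ⟨_, ⟨?_, ((h.deriv.mul (2 * p)).add ((h.mul q).mono N.le_succ)).2⟩, ?_⟩
  · intro y
    rw [((h.deriv.mul (2 * p)).add ((h.mul q).mono N.le_succ)).1]
    simp [opX_apply, map_ofNat, mul_assoc]
  · simp [derivComp_succ, h.2.2 (N + 1) (by omega), ← rD_apply, map_ofNat]

theorem exists_realizes_opT (p q : ℂ[X]) {L : DiffOp} {φ : Module.End ℂ (RatFunc ℂ)} {N : ℕ}
    (h : Realizes L φ N) :
    ∃ L', Realizes L' (opT p q ∘ₗ φ) (N + 2) ∧ L' (N + 2) = ι p * L N := by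
  refine ⟨_, ⟨?_, ((h.deriv.deriv.mul p).add ((h.deriv.mul q).mono (N + 1).le_succ)).2⟩, ?_⟩
  · intro y
    rw [((h.deriv.deriv.mul p).add ((h.deriv.mul q).mono (N + 1).le_succ)).1]
    simp [opT_apply]
  · simp [derivComp_succ, h.2.2 (N + 1) (by omega), h.2.2 (N + 2) (by omega), ← rD_apply]

theorem exists_realizes_opT_pow (p q : ℂ[X]) (i : ℕ) :
    ∃ L, Realizes L (opT p q ^ i) (2 * i) ∧ L (2 * i) = ι (p ^ i) := by
  induction i with
  | zero =>
    refine ⟨Finsupp.single 0 1, ⟨fun y => by simp [act_single], fun j => ?_, fun j hj => ?_⟩, ?_⟩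
    · by_cases hj : j = 0
      · exact ⟨1, by simp [hj]⟩
      · exact ⟨0, by simp [Ne.symm hj]⟩
    · simp [show (0 : ℕ) ≠ j by omega]
    · simp
  | succ i ih =>
    obtain ⟨L, hL, hc⟩ := ih
    obtain ⟨L', hL', hc'⟩ := exists_realizes_opT p q hL
    refine ⟨L', ?_, ?_⟩
    · rw [pow_succ']
      exact hL'
    · rw [show 2 * (i + 1) = 2 * i + 2 by ring, hc', hc, ← map_mul, pow_succ']

theorem exists_realizes_opM (p q : ℂ[X]) (n : ℕ) (w : ℕ → RatFunc ℂ × RatFunc ℂ)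
    (hw : ∀ i, (∃ a, (w i).1 = ι a) ∧ ∃ a, (w i).2 = ι a) :
    ∃ L N, Realizes L (opM p q n w) N := by
  induction n with
  | zero =>
    refine ⟨0, 0, fun y => by simp [opM, act], fun j => ⟨0, by simp⟩, fun j _ => rfl⟩
  | succ n ih =>
    obtain ⟨L, N, hL⟩ := ih
    obtain ⟨L₁, h₁, -⟩ := exists_realizes_opT_pow p q n
    obtain ⟨L₂, h₂, -⟩ := exists_realizes_opX p q h₁
    obtain ⟨⟨a, ha⟩, ⟨b, hb⟩⟩ := hw n
    have h := (hL.mono (le_max_left N (2 * n + 1))).add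
      (((h₁.mul a).mono ((Nat.le_succ _).trans (le_max_right N (2 * n + 1)))).add
      ((h₂.mul b).mono (le_max_right N (2 * n + 1))))
    refine ⟨_, _, fun y => ?_, h.2⟩
    rw [h.1, opM, opM, Finset.sum_range_succ, ha, hb]

/-! ### Recovering coefficients from the action on polynomials -/

theorem iterate_rderiv_algebraMap (j : ℕ) (a : ℂ[X]) :
    rderiv^[j] (ι a) = ι (derivative^[j] a) := by
  induction j with
  | zero => rfl
  | succ j ih => rw [Function.iterate_succ_apply', ih, rderiv_algebraMap,
      Function.iterate_succ_apply']

/-- If `L` maps polynomials into a `ℂ[z]`-module `S` of rational functions, then the coefficients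
of `L` lie in `S`: apply `L` to the powers of `z`, in increasing order. -/
theorem coeff_mem_of_act_mem (S : Submodule ℂ[X] (RatFunc ℂ)) (L : DiffOp)
    (h : ∀ a : ℂ[X], act L (ι a) ∈ S) (j : ℕ) : L j ∈ S := by
  induction j using Nat.strong_induction_on with
  | _ j ih =>
  have hsupp : L.support ⊆ Finset.range (j + 1) ∪ L.support := Finset.subset_union_right
  have h1 := h (X ^ j)
  rw [act_eq_sum_of_support_subset L _ hsupp] at h1
  have h2 : ∑ i ∈ Finset.range (j + 1) ∪ L.support, L i * rderiv^[i] (ι (X ^ j)) =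
      ∑ i ∈ Finset.range (j + 1), L i * rderiv^[i] (ι (X ^ j)) := by
    refine (Finset.sum_subset Finset.subset_union_left fun i _ hi => ?_).symm
    rw [iterate_rderiv_algebraMap, iterate_derivative_eq_zero, map_zero, mul_zero]
    rw [natDegree_X_pow]
    simpa using hi
  rw [h2, Finset.sum_range_succ] at h1
  have h3 : ∑ i ∈ Finset.range j, L i * rderiv^[i] (ι (X ^ j)) ∈ S := by
    refine S.sum_mem fun i hi => ?_
    rw [iterate_rderiv_algebraMap, mul_comm, ← Algebra.smul_def]
    exact S.smul_mem _ (ih i (by simpa using hi))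
  have h4 := (S.add_mem_iff_right h3).1 h1
  rw [iterate_rderiv_algebraMap, iterate_derivative_X_pow_eq_C_mul, Nat.sub_self, pow_zero,
    mul_one, Nat.descFactorial_self] at h4
  have h5 := S.smul_mem (C (j.factorial : ℂ)⁻¹) h4
  rw [Algebra.smul_def, mul_left_comm, ← map_mul, ← C_mul, inv_mul_cancel₀, C_1, map_one,
    mul_one] at h5
  · exact h5
  · exact_mod_cast j.factorial_ne_zero

theorem X_sub_C_pow_dvd_derivative {ζ : ℂ} {k : ℕ} {a : ℂ[X]} (h : (X - C ζ) ^ (k + 1) ∣ a) :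
    (X - C ζ) ^ k ∣ derivative a := by
  obtain ⟨b, rfl⟩ := h
  refine ⟨C ((k : ℂ) + 1) * b + (X - C ζ) * derivative b, ?_⟩
  rw [derivative_mul, derivative_X_sub_C_pow]
  push_cast
  simp only [C_add, C_1, map_natCast]
  ring

theorem exists_opT_pow_algebraMap (p q : ℂ[X]) (i : ℕ) (a : ℂ[X]) :
    ∃ b, (opT p q ^ i) (ι a) = ι b ∧
      ∀ (ζ : ℂ) (k : ℕ), (X - C ζ) ^ (k + 2 * i) ∣ a → (X - C ζ) ^ k ∣ b := by
  induction i with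
  | zero => exact ⟨a, rfl, fun _ _ h => h⟩
  | succ i ih =>
    obtain ⟨b, hb, hd⟩ := ih
    refine ⟨p * derivative (derivative b) + q * derivative b, ?_, fun ζ k h => ?_⟩
    · rw [pow_succ', Module.End.mul_apply, hb, opT_apply, rD_algebraMap, rD_algebraMap]
      simp
    · have h1 := hd ζ (k + 2) (by convert h using 2; ring)
      have h2 := X_sub_C_pow_dvd_derivative h1
      exact dvd_add ((X_sub_C_pow_dvd_derivative h2).mul_left _)
        (((pow_dvd_pow _ k.le_succ).trans h2).mul_left _)

theorem exists_opX_algebraMap (p q : ℂ[X]) (a : ℂ[X]) :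
    ∃ b, opX p q (ι a) = ι b ∧
      ∀ (ζ : ℂ) (k : ℕ), (X - C ζ) ^ (k + 1) ∣ a → (X - C ζ) ^ k ∣ b := by
  refine ⟨2 * p * derivative a + q * a, ?_, fun ζ k h => ?_⟩
  · rw [opX_apply, rD_algebraMap]
    simp [map_ofNat]
  · exact dvd_add ((X_sub_C_pow_dvd_derivative h).mul_left _)
      (((pow_dvd_pow _ k.le_succ).trans h).mul_left _)

theorem exists_act_eq_opM (p q : ℂ[X]) (n : ℕ) (w : ℕ → RatFunc ℂ × RatFunc ℂ) :
    ∃ L : DiffOp, (∀ y, act L y = opM p q n w y) ∧ ∀ j, 2 * n ≤ j → L j = 0 := by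
  induction n with
  | zero => exact ⟨0, fun y => by simp [opM, act], fun j _ => rfl⟩
  | succ n ih =>
    obtain ⟨L, hL, h0⟩ := ih
    obtain ⟨L₁, h₁, -⟩ := exists_realizes_opT_pow p q n
    obtain ⟨L₂, h₂, -⟩ := exists_realizes_opX p q h₁
    refine ⟨L + (L₁.mapRange ((w n).1 * ·) (mul_zero _) + L₂.mapRange ((w n).2 * ·) (mul_zero _)),
      fun y => ?_, fun j hj => ?_⟩
    · rw [act_add_left, act_add_left, act_mapRange_mul, act_mapRange_mul, hL, h₁.1, h₂.1,
        opM, opM, Finset.sum_range_succ]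
      rfl
    · simp [h0 j (by omega), h₁.2.2 j (by omega), h₂.2.2 j (by omega)]

theorem mem_of_pow_mul_mem (S : Submodule ℂ[X] (RatFunc ℂ)) (p : ℂ[X])
    (hS : ∀ f, ι p * f ∈ S → f ∈ S) (n : ℕ) : ∀ f, ι (p ^ n) * f ∈ S → f ∈ S := by
  induction n with
  | zero => intro f hf; simpa using hf
  | succ n ih =>
    intro f hf
    rw [pow_succ, map_mul, mul_assoc] at hf
    exact hS _ (ih _ hf)

/-- If `Σ (uᵢ + vᵢ X) T₀ⁱ` maps polynomials into a module `S` in which division by `p` is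
possible, then all `uᵢ`, `vᵢ` lie in `S`. The coefficients are found from the top down, as
`T₀ⁱ` and `X T₀ⁱ` have leading coefficients `pⁱ` and `2 pⁱ⁺¹`. -/
theorem mem_of_opM_mem (S : Submodule ℂ[X] (RatFunc ℂ)) (p q : ℂ[X])
    (hS : ∀ f, ι p * f ∈ S → f ∈ S) (n : ℕ) (w : ℕ → RatFunc ℂ × RatFunc ℂ)
    (h : ∀ a : ℂ[X], opM p q n w (ι a) ∈ S) : ∀ i < n, (w i).1 ∈ S ∧ (w i).2 ∈ S := by
  induction n with
  | zero => intro i hi; omega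
  | succ n ih =>
    obtain ⟨L, hL, h0⟩ := exists_act_eq_opM p q n w
    obtain ⟨L₁, h₁, c₁⟩ := exists_realizes_opT_pow p q n
    obtain ⟨L₂, h₂, c₂⟩ := exists_realizes_opX p q h₁
    have hexp : ∀ y, opM p q (n + 1) w y = opM p q n w y + ((w n).1 * (opT p q ^ n) y +
        (w n).2 * opX p q ((opT p q ^ n) y)) := fun y => by
      rw [opM_apply, opM_apply, Finset.sum_range_succ]
    have hv : (w n).2 ∈ S := by
      have h3 := coeff_mem_of_act_mem S (L + (L₁.mapRange ((w n).1 * ·) (mul_zero _) +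
        L₂.mapRange ((w n).2 * ·) (mul_zero _))) (fun a => by
          rw [act_add_left, act_add_left, act_mapRange_mul, act_mapRange_mul, hL, h₁.1, h₂.1]
          have := h a
          rwa [hexp] at this) (2 * n + 1)
      simp only [Finsupp.add_apply, Finsupp.mapRange_apply, h0 (2 * n + 1) (by omega),
        h₁.2.2 (2 * n + 1) (by omega), c₂, c₁, mul_zero, zero_add] at h3
      have h4 := S.smul_mem (C (2 : ℂ)⁻¹) h3
      refine hS _ (mem_of_pow_mul_mem S p hS n _ ?_)
      convert h4 using 1
      have h2 : ι (C (2 : ℂ)⁻¹) * 2 = 1 := by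
        rw [← map_ofNat ι 2, ← map_mul, ← C_ofNat, ← C_mul, inv_mul_cancel₀ two_ne_zero, C_1,
          map_one]
      rw [Algebra.smul_def]
      linear_combination (-(ι (p ^ n) * (ι p * (w n).2))) * h2
    have hsub : ∀ a : ℂ[X], opM p q n w (ι a) + (w n).1 * (opT p q ^ n) (ι a) ∈ S := by
      intro a
      obtain ⟨b, hb, -⟩ := exists_opT_pow_algebraMap p q n a
      obtain ⟨c, hc, -⟩ := exists_opX_algebraMap p q b
      have h3 := h a
      rw [hexp, ← add_assoc] at h3
      refine (S.add_mem_iff_left ?_).1 h3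
      rw [hb, hc, mul_comm, ← Algebra.smul_def]
      exact S.smul_mem _ hv
    have hu : (w n).1 ∈ S := by
      have h3 := coeff_mem_of_act_mem S (L + L₁.mapRange ((w n).1 * ·) (mul_zero _)) (fun a => by
          rw [act_add_left, act_mapRange_mul, hL, h₁.1]
          exact hsub a) (2 * n)
      simp only [Finsupp.add_apply, Finsupp.mapRange_apply, h0 (2 * n) le_rfl, c₁,
        zero_add] at h3
      exact mem_of_pow_mul_mem S p hS n _ (by rwa [mul_comm])
    have hlow : ∀ a : ℂ[X], opM p q n w (ι a) ∈ S := by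
      intro a
      obtain ⟨b, hb, -⟩ := exists_opT_pow_algebraMap p q n a
      refine (S.add_mem_iff_left ?_).1 (hsub a)
      rw [hb, mul_comm, ← Algebra.smul_def]
      exact S.smul_mem _ hu
    intro i hi
    rcases Nat.lt_succ_iff_lt_or_eq.1 hi with hi | rfl
    · exact ih hlow i hi
    · exact ⟨hu, hv⟩

theorem eq_zero_of_opM_eq_zero (p q : ℂ[X]) (hp : p ≠ 0) (n : ℕ) (w : ℕ → RatFunc ℂ × RatFunc ℂ)
    (h : ∀ y, opM p q n w y = 0) : ∀ i < n, w i = 0 := by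
  intro i hi
  have h1 := mem_of_opM_mem ⊥ p q (fun f hf => by
    rw [Submodule.mem_bot] at hf ⊢
    exact (mul_eq_zero.1 hf).resolve_left (RatFunc.algebraMap_ne_zero hp)) n w
    (fun a => by rw [h]; exact Submodule.zero_mem _) i hi
  exact Prod.ext ((Submodule.mem_bot _).1 h1.1) ((Submodule.mem_bot _).1 h1.2)

/-! ### Operators mapping polynomials into the invariant spaces -/

/-- For `σ = η' / η`, the map `b ↦ c = κ₁ (b' - σ b) + κ₂ b` lowers the order of vanishing at `ζ` by
one where it is smaller than that of `η`. In particular this order is positive if `c` is a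
polynomial. -/
theorem order_drop {ζ : ℂ} {m a : ℕ} {b c η θ κ₁ κ₂ : ℂ[X]} (ham : a < m)
    (hη : η = (X - C ζ) ^ m * θ) (hθ : θ.eval ζ ≠ 0) (hκ : κ₁.eval ζ ≠ 0)
    (hb : ∃ b₁, b = (X - C ζ) ^ a * b₁ ∧ b₁.eval ζ ≠ 0)
    (hc : η * c = κ₁ * (η * derivative b - derivative η * b) + κ₂ * b * η) :
    ∃ a', a = a' + 1 ∧ ∃ c₁, c = (X - C ζ) ^ a' * c₁ ∧ c₁.eval ζ ≠ 0 := by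
  obtain ⟨b₁, rfl, hb₁⟩ := hb
  obtain ⟨m, rfl⟩ : ∃ m', m = m' + 1 := ⟨m - 1, by omega⟩
  have hX : (X - C ζ : ℂ[X]) ≠ 0 := X_sub_C_ne_zero ζ
  have key : (X - C ζ) * c * θ = (X - C ζ) ^ a *
      (κ₁ * (C ((a : ℂ) - (m + 1)) * b₁ * θ + (X - C ζ) * (θ * derivative b₁ - derivative θ * b₁))
        + κ₂ * b₁ * θ * (X - C ζ)) := by
    apply mul_left_cancel₀ (pow_ne_zero m hX)
    have hder : ∀ k : ℕ, (X - C ζ : ℂ[X]) * derivative ((X - C ζ) ^ k) =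
        C (k : ℂ) * (X - C ζ) ^ k := by
      intro k
      rcases k with _ | k
      · simp
      · rw [derivative_X_sub_C_pow]
        simp only [Nat.add_sub_cancel]
        rw [pow_succ]
        simp only [map_natCast]
        ring
    subst hη
    apply mul_left_cancel₀ hX
    rw [derivative_mul, derivative_mul] at hc
    have h1 := hder a
    have h2 := hder (m + 1)
    have e : (C ((a : ℂ) - (m + 1)) : ℂ[X]) = C (a : ℂ) - C ((m + 1 : ℕ) : ℂ) := by
      rw [← C_sub]
      push_cast
      rfl
    rw [e]
    linear_combination (X - C ζ) * hc + κ₁ * (X - C ζ) ^ (m + 1) * θ * b₁ * h1 -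
      κ₁ * θ * (X - C ζ) ^ a * b₁ * h2
  set d := κ₁ * (C ((a : ℂ) - (m + 1)) * b₁ * θ +
      (X - C ζ) * (θ * derivative b₁ - derivative θ * b₁)) + κ₂ * b₁ * θ * (X - C ζ) with hd
  have hd0 : d.eval ζ ≠ 0 := by
    have : ((a : ℂ) - (m + 1)) ≠ 0 := by
      rw [sub_ne_zero]
      exact_mod_cast ham.ne
    simp [hd, hκ, hb₁, hθ, this]
  rcases a with _ | a
  · exfalso
    have := congrArg (eval ζ) key
    simp only [eval_mul, eval_sub, eval_X, eval_C, sub_self, zero_mul, pow_zero, one_mul] at this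
    exact hd0 this.symm
  · refine ⟨a, rfl, ?_⟩
    have h1 : c * θ = (X - C ζ) ^ a * d := by
      apply mul_left_cancel₀ hX
      rw [pow_succ] at key
      linear_combination key
    have hco : IsCoprime ((X - C ζ) ^ a) θ := by
      apply IsCoprime.pow_left
      rwa [(irreducible_X_sub_C ζ).coprime_iff_not_dvd, dvd_iff_isRoot, IsRoot.def]
    obtain ⟨c₁, rfl⟩ := hco.dvd_of_dvd_mul_right (Dvd.intro d h1.symm)
    refine ⟨c₁, rfl, fun h0 => hd0 ?_⟩
    have h2 : c₁ * θ = d := by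
      apply mul_left_cancel₀ (pow_ne_zero a hX)
      linear_combination h1
    rw [← h2, eval_mul, h0, zero_mul]

/-- The coefficients `w` of an operator `M = Σ (uᵢ + vᵢ X) T₀ⁱ`, `i < n`, are polynomials, and
all `Tᵏ M`, `T = T₀ - σ X + ρ`, map polynomials to functions without poles in `Z`. -/
structure Adm (p q : ℂ[X]) (σ ρ : RatFunc ℂ) (Z : Set ℂ) (n : ℕ)
    (w : ℕ → RatFunc ℂ × RatFunc ℂ) : Prop where
  poly : ∀ i, (∃ a, (w i).1 = ι a) ∧ ∃ a, (w i).2 = ι a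
  zero : ∀ i, n ≤ i → w i = 0
  reg : ∀ ζ ∈ Z, ∀ (k : ℕ) (a : ℂ[X]), (opS p q σ ρ ^ k) (opM p q n w (ι a)) ∈ regAt ζ

theorem dA_mem_regAt {p : ℂ[X]} {σ v : RatFunc ℂ} {ζ : ℂ} (hσ : σ ∈ regAt ζ)
    (hv : v ∈ regAt ζ) : dA p σ v ∈ regAt ζ := by
  have hp := algebraMap_mem_regAt ζ
  have h1 := rD_mem_regAt hv
  unfold dA
  exact sub_mem (add_mem (mul_mem (mul_mem (ofNat_mem _ 4) (hp _)) h1)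
    (mul_mem (mul_mem (ofNat_mem _ 2) (hp _)) hv))
    (mul_mem (mul_mem (mul_mem (ofNat_mem _ 4) (hp _)) hσ) hv)

theorem dB_mem_regAt {p : ℂ[X]} {σ ρ u v : RatFunc ℂ} {ζ : ℂ} (hσ : σ ∈ regAt ζ)
    (hρ : ρ ∈ regAt ζ) (hu : u ∈ regAt ζ) (hv : v ∈ regAt ζ) : dB p σ ρ u v ∈ regAt ζ := by
  have hp := algebraMap_mem_regAt ζ
  have h1 := rD_mem_regAt hv
  have h2 := rD_mem_regAt h1
  have h3 := rD_mem_regAt hu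
  have t := ofNat_mem (regAt ζ) 2
  unfold dB
  exact add_mem (sub_mem h3 (mul_mem hσ hu)) (add_mem (sub_mem (sub_mem (add_mem (mul_mem (hp _) h2)
    (mul_mem (mul_mem t (hp _)) h1)) (mul_mem (mul_mem (mul_mem t (hp _)) hσ) hv))
    (mul_mem (mul_mem (mul_mem t (hp _)) hσ) h1)) (mul_mem (add_mem (hp _) hρ) hv))

theorem dC_mem_regAt {p q : ℂ[X]} {σ ρ u v : RatFunc ℂ} {ζ : ℂ} (hσ : σ ∈ regAt ζ)
    (hρ : ρ ∈ regAt ζ) (hu : u ∈ regAt ζ) (hv : v ∈ regAt ζ) : dC p q σ ρ u v ∈ regAt ζ := by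
  have hp := algebraMap_mem_regAt ζ
  have h1 := rD_mem_regAt hv
  have h3 := rD_mem_regAt hu
  have h4 := rD_mem_regAt h3
  have t := ofNat_mem (regAt ζ) 2
  unfold dC
  exact add_mem (add_mem (add_mem (sub_mem (mul_mem (hp _) h4)
    (mul_mem (mul_mem (mul_mem t (hp _)) hσ) h3)) (mul_mem hρ hu))
    (mul_mem (hp _) (sub_mem h1 (mul_mem hσ hv)))) (mul_mem (hp _) hv)

/-- `M ↦ T M - M T₀` preserves admissibility: at the points of `Z` the coefficients are regular
because `p` does not vanish there, elsewhere because `σ` and `ρ` are regular. -/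
theorem Adm.delta {p q : ℂ[X]} {σ ρ : RatFunc ℂ} {Z : Set ℂ} {n : ℕ}
    {w : ℕ → RatFunc ℂ × RatFunc ℂ} (hq : q.natDegree ≤ 1) (hpZ : ∀ ζ ∈ Z, p.eval ζ ≠ 0)
    (hσ : ∀ ζ ∉ Z, σ ∈ regAt ζ) (hρ : ∀ ζ ∉ Z, ρ ∈ regAt ζ)
    (h : Adm p q σ ρ Z n w) : Adm p q σ ρ Z (n + 1) (delta p q σ ρ w) := by
  have hreg : ∀ ζ ∈ Z, ∀ (k : ℕ) (a : ℂ[X]),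
      (opS p q σ ρ ^ k) (opM p q (n + 1) (ExcOp.delta p q σ ρ w) (ι a)) ∈ regAt ζ := by
    intro ζ hζ k a
    rw [← opS_opM p q hq σ ρ n w h.zero, map_sub]
    refine sub_mem ?_ ?_
    · rw [← Module.End.mul_apply, ← pow_succ]
      exact h.reg ζ hζ (k + 1) a
    · obtain ⟨b, hb, -⟩ := exists_opT_pow_algebraMap p q 1 a
      rw [pow_one] at hb
      rw [hb]
      exact h.reg ζ hζ k b
  have hz := delta_eq_zero p q σ ρ n w h.zero
  have hboth : ∀ i ζ, (ExcOp.delta p q σ ρ w i).1 ∈ regAt ζ ∧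
      (ExcOp.delta p q σ ρ w i).2 ∈ regAt ζ := by
    intro i ζ
    by_cases hi : n + 1 ≤ i
    · rw [hz i hi]
      exact ⟨zero_mem _, zero_mem _⟩
    by_cases hζ : ζ ∈ Z
    · exact mem_of_opM_mem (Subalgebra.toSubmodule (regAt ζ)) p q
        (fun f hf => mem_regAt_of_mul (hpZ ζ hζ) hf) (n + 1) _
        (fun a => by simpa using hreg ζ hζ 0 a) i (by omega)
    · have hmem : ∀ i, (w i).1 ∈ regAt ζ ∧ (w i).2 ∈ regAt ζ := by
        intro i
        obtain ⟨⟨a, ha⟩, b, hb⟩ := h.poly i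
        rw [ha, hb]
        exact ⟨algebraMap_mem_regAt ζ a, algebraMap_mem_regAt ζ b⟩
      refine ⟨add_mem (dC_mem_regAt (hσ ζ hζ) (hρ ζ hζ) (hmem i).1 (hmem i).2) ?_,
        dB_mem_regAt (hσ ζ hζ) (hρ ζ hζ) (hmem i).1 (hmem i).2⟩
      split_ifs
      · exact zero_mem _
      · exact dA_mem_regAt (hσ ζ hζ) (hmem _).2
  exact ⟨fun i => ⟨exists_polynomial_of_forall_mem_regAt fun ζ => (hboth i ζ).1,
    exists_polynomial_of_forall_mem_regAt fun ζ => (hboth i ζ).2⟩, hz, hreg⟩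

/-- The leading coefficient of an admissible operator vanishes at `ζ` to at least the order `m` of
`η`: otherwise `M ↦ T M - M T₀` would lower this order again and again. If `vᵢ` is the leading
coefficient, then that of `T M - M T₀` is the coefficient `4 p (vᵢ' - σ vᵢ) + 2 p' vᵢ` of `T₀ⁱ⁺¹`;
if `vᵢ = 0` and `uᵢ` is the leading coefficient, it is the coefficient `uᵢ' - σ uᵢ` of `X T₀ⁱ`. -/
theorem Adm.no_small_order {p q η θ : ℂ[X]} {ρ : RatFunc ℂ} {Z : Set ℂ}
    (hq : q.natDegree ≤ 1) (hpZ : ∀ ζ ∈ Z, p.eval ζ ≠ 0)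
    (hσ : ∀ ζ ∉ Z, ι (derivative η) / ι η ∈ regAt ζ) (hρ : ∀ ζ ∉ Z, ρ ∈ regAt ζ)
    {ζ : ℂ} (hζ : ζ ∈ Z) {m : ℕ} (hη : η = (X - C ζ) ^ m * θ) (hθ : θ.eval ζ ≠ 0) (a : ℕ)
    (ham : a < m) : ∀ (n : ℕ) (w : ℕ → RatFunc ℂ × RatFunc ℂ) (i : ℕ),
      Adm p q (ι (derivative η) / ι η) ρ Z n w → (∀ j, i < j → w j = 0) → ∀ b : ℂ[X],
      (∃ b₁, b = (X - C ζ) ^ a * b₁ ∧ b₁.eval ζ ≠ 0) →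
      ((w i).2 = ι b → False) ∧ ((w i).2 = 0 → (w i).1 = ι b → False) := by
  have hη0 : ι η ≠ 0 := RatFunc.algebraMap_ne_zero
    (by rw [hη]; exact mul_ne_zero (pow_ne_zero _ (X_sub_C_ne_zero ζ)) (ne_zero_of_eval hθ))
  induction a with
  | zero =>
    intro n w i hw hi b hb
    have hd := hw.delta hq hpZ hσ hρ
    constructor
    · intro hv
      obtain ⟨⟨c, hc⟩, -⟩ := hd.poly (i + 1)
      have h1 : ExcOp.delta p q (ι (derivative η) / ι η) ρ w (i + 1) =
          (dA p (ι (derivative η) / ι η) (w i).2, 0) := by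
        simp [ExcOp.delta, hi (i + 1) (by omega), dB, dC]
      rw [h1] at hc
      obtain ⟨a', ha', -⟩ := order_drop (κ₁ := 4 * p) (κ₂ := 2 * derivative p) (c := c) ham hη hθ
        (by simpa using hpZ ζ hζ) hb (by
          apply RatFunc.algebraMap_injective ℂ
          rw [map_mul, ← hc, hv, dA, rD_algebraMap]
          simp only [map_mul, map_add, map_sub, map_ofNat]
          field_simp
          ring)
      omega
    · intro hv hu
      obtain ⟨-, ⟨c, hc⟩⟩ := hd.poly i
      have h1 : (ExcOp.delta p q (ι (derivative η) / ι η) ρ w i).2 =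
          ι (derivative b) - (ι (derivative η) / ι η) * ι b := by
        simp [ExcOp.delta, hv, hu, dB, rD_algebraMap]
      rw [h1] at hc
      obtain ⟨a', ha', -⟩ := order_drop (κ₁ := 1) (κ₂ := 0) (c := c) ham hη hθ
        (by simp) hb (by
          apply RatFunc.algebraMap_injective ℂ
          rw [map_mul, ← hc]
          simp only [map_mul, map_add, map_sub, map_one, map_zero]
          field_simp
          ring)
      omega
  | succ a ih =>
    intro n w i hw hi b hb
    have hd := hw.delta hq hpZ hσ hρ
    constructor
    · intro hv
      obtain ⟨⟨c, hc⟩, -⟩ := hd.poly (i + 1)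
      have h1 : ExcOp.delta p q (ι (derivative η) / ι η) ρ w (i + 1) =
          (dA p (ι (derivative η) / ι η) (w i).2, 0) := by
        simp [ExcOp.delta, hi (i + 1) (by omega), dB, dC]
      have h2 := hc
      rw [h1] at hc
      obtain ⟨a', ha', hc₁⟩ := order_drop (κ₁ := 4 * p) (κ₂ := 2 * derivative p) (c := c) ham hη hθ
        (by simpa using hpZ ζ hζ) hb (by
          apply RatFunc.algebraMap_injective ℂ
          rw [map_mul, ← hc, hv, dA, rD_algebraMap]
          simp only [map_mul, map_add, map_sub, map_ofNat]
          field_simp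
          ring)
      obtain rfl : a = a' := by omega
      refine (ih (by omega) (n + 1) _ (i + 1) hd (fun j hj => ?_) c hc₁).2 (by rw [h1]) h2
      simp [ExcOp.delta, hi j (by omega), hi (j - 1) (by omega), dA, dB, dC]
    · intro hv hu
      obtain ⟨-, ⟨c, hc⟩⟩ := hd.poly i
      have h1 : (ExcOp.delta p q (ι (derivative η) / ι η) ρ w i).2 =
          ι (derivative b) - (ι (derivative η) / ι η) * ι b := by
        simp [ExcOp.delta, hv, hu, dB, rD_algebraMap]
      have h2 := hc
      rw [h1] at hc
      obtain ⟨a', ha', hc₁⟩ := order_drop (κ₁ := 1) (κ₂ := 0) (c := c) ham hη hθ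
        (by simp) hb (by
          apply RatFunc.algebraMap_injective ℂ
          rw [map_mul, ← hc]
          simp only [map_mul, map_add, map_sub, map_one, map_zero]
          field_simp
          ring)
      obtain rfl : a = a' := by omega
      refine (ih (by omega) (n + 1) _ i hd (fun j hj => ?_) c hc₁).1 h2
      have h3 : (w (j - 1)).2 = 0 := by
        rcases (show j - 1 = i ∨ i < j - 1 by omega) with h | h
        · rw [h, hv]
        · rw [hi _ h]
          rfl
      simp [ExcOp.delta, hi j hj, h3, dA, dB, dC]

/-- The product `η = ∏ (z - ζ) ^ ν(ζ)` over a finite set of points. -/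
def etaProd (Z : Finset ℂ) (ν : ℂ → ℕ) : ℂ[X] := ∏ ζ ∈ Z, (X - C ζ) ^ ν ζ

theorem etaProd_monic (Z : Finset ℂ) (ν : ℂ → ℕ) : (etaProd Z ν).Monic :=
  monic_prod_of_monic _ _ fun ζ _ => (monic_X_sub_C ζ).pow _

theorem natDegree_etaProd (Z : Finset ℂ) (ν : ℂ → ℕ) :
    (etaProd Z ν).natDegree = ∑ ζ ∈ Z, ν ζ := by
  rw [etaProd, natDegree_prod_of_monic _ _ fun ζ _ => (monic_X_sub_C ζ).pow _]
  simp

theorem eval_etaProd_ne_zero {Z : Finset ℂ} {ν : ℂ → ℕ} {z : ℂ} (hz : z ∉ Z) :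
    (etaProd Z ν).eval z ≠ 0 := by
  rw [etaProd, eval_prod, Finset.prod_ne_zero_iff]
  intro ζ hζ
  have : z - ζ ≠ 0 := sub_ne_zero.2 fun h => hz (h ▸ hζ)
  simp [this]

theorem etaProd_eq_mul {Z : Finset ℂ} (ν : ℂ → ℕ) {ζ : ℂ} (hζ : ζ ∈ Z) :
    etaProd Z ν = (X - C ζ) ^ ν ζ * etaProd (Z.erase ζ) ν :=
  (Finset.mul_prod_erase Z _ hζ).symm

theorem etaProd_dvd {Z : Finset ℂ} {ν : ℂ → ℕ} {b : ℂ[X]}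
    (h : ∀ ζ ∈ Z, (X - C ζ) ^ ν ζ ∣ b) : etaProd Z ν ∣ b := by
  refine Finset.prod_dvd_of_coprime (fun x _ y _ hxy => ?_) h
  exact (isCoprime_X_sub_C_of_isUnit_sub (sub_ne_zero.2 hxy).isUnit).pow

theorem logDeriv_mem_regAt {η : ℂ[X]} {ζ : ℂ} (h : η.eval ζ ≠ 0) :
    ι (derivative η) / ι η ∈ regAt ζ :=
  div_mem_regAt (algebraMap_mem_regAt ζ _) h

/-- An admissible operator whose coefficients all have degree less than `deg η` vanishes. -/
theorem Adm.eq_zero_of_degree_lt {p q : ℂ[X]} {ρ : RatFunc ℂ} {Z : Finset ℂ} {ν : ℂ → ℕ}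
    (hq : q.natDegree ≤ 1) (hpZ : ∀ ζ ∈ Z, p.eval ζ ≠ 0) (hρ : ∀ ζ ∉ Z, ρ ∈ regAt ζ)
    {n : ℕ} {w : ℕ → RatFunc ℂ × RatFunc ℂ}
    (hw : Adm p q (ι (derivative (etaProd Z ν)) / ι (etaProd Z ν)) ρ Z n w)
    (hdeg : ∀ i (a : ℂ[X]), (w i).1 = ι a ∨ (w i).2 = ι a → a.degree < (etaProd Z ν).degree) :
    w = 0 := by
  by_contra hne
  have hex : ∃ i, w i ≠ 0 := by
    by_contra h
    push Not at h
    exact hne (funext h)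
  have hbound : ∀ i, w i ≠ 0 → i ≤ n := fun i hi => by
    by_contra h
    exact hi (hw.zero i (by omega))
  classical
  obtain ⟨i₀, hi₀⟩ := hex
  set i := Nat.findGreatest (fun i => w i ≠ 0) n with hidef
  have hi : w i ≠ 0 := Nat.findGreatest_spec (P := fun i => w i ≠ 0) (hbound i₀ hi₀) hi₀
  have hgt : ∀ j, i < j → w j = 0 := by
    intro j hj
    by_contra h
    exact absurd (Nat.le_findGreatest (P := fun i => w i ≠ 0) (hbound j h) h) (by omega)
  have key : ∀ b : ℂ[X], b ≠ 0 → ((w i).2 = ι b ∨ ((w i).2 = 0 ∧ (w i).1 = ι b)) → False := by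
    intro b hb0 hb
    have hdvd : etaProd Z ν ∣ b := by
      refine etaProd_dvd fun ζ hζ => ?_
      rw [← le_rootMultiplicity_iff hb0]
      by_contra hlt
      obtain ⟨b₁, hb₁, hnd⟩ := exists_eq_pow_rootMultiplicity_mul_and_not_dvd b hb0 ζ
      rw [dvd_iff_isRoot, IsRoot.def] at hnd
      have h1 := Adm.no_small_order hq hpZ
        (fun ζ' h' => logDeriv_mem_regAt (eval_etaProd_ne_zero (by simpa using h'))) hρ hζ
        (etaProd_eq_mul ν hζ) (eval_etaProd_ne_zero (by simp)) _ (not_le.1 hlt) n w i hw hgt b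
        ⟨b₁, hb₁, hnd⟩
      rcases hb with hb | hb
      · exact h1.1 hb
      · exact h1.2 hb.1 hb.2
    have h2 := hdeg i b (hb.elim Or.inr fun h => Or.inl h.2)
    exact absurd (degree_le_of_dvd hdvd hb0) (not_le.2 h2)
  obtain ⟨⟨a, ha⟩, b, hb⟩ := hw.poly i
  by_cases hb0 : b = 0
  · have ha0 : a ≠ 0 := by
      rintro rfl
      exact hi (Prod.ext (by simpa using ha) (by simpa [hb0] using hb))
    exact key a ha0 (Or.inr ⟨by simpa [hb0] using hb, ha⟩)
  · exact key b hb0 (Or.inl hb)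

/-! ### Spaces of coefficient sequences -/

/-- Coefficient sequences built from polynomials of degree less than `d₁` and `d₂`. -/
def coeffSeq (n d₁ d₂ : ℕ) :
    (Fin n → degreeLT ℂ d₁ × degreeLT ℂ d₂) →ₗ[ℂ] (ℕ → RatFunc ℂ × RatFunc ℂ) where
  toFun x i := if h : i < n then (ι (x ⟨i, h⟩).1, ι (x ⟨i, h⟩).2) else 0
  map_add' x y := by
    funext i
    by_cases h : i < n <;> simp [h]
  map_smul' c x := by
    have hC : ∀ a : ℂ[X], ι (c • a) = c • ι a := fun a => by
      rw [smul_eq_C_mul, map_mul, RatFunc.algebraMap_C, RatFunc.smul_eq_C_mul]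
    funext i
    by_cases h : i < n <;> simp [h, hC]

instance finiteDimensional_degreeLT (d : ℕ) : FiniteDimensional ℂ (degreeLT ℂ d) :=
  (degreeLTEquiv ℂ d).symm.finiteDimensional

theorem finrank_degreeLT (d : ℕ) : Module.finrank ℂ (degreeLT ℂ d) = d := by
  rw [(degreeLTEquiv ℂ d).finrank_eq, Module.finrank_fin_fun]

theorem coeffSeq_poly {n d₁ d₂ : ℕ} (x : Fin n → degreeLT ℂ d₁ × degreeLT ℂ d₂) (i : ℕ) :
    ∃ a b : ℂ[X], coeffSeq n d₁ d₂ x i = (ι a, ι b) ∧ a.degree < d₁ ∧ b.degree < d₂ := by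
  by_cases h : i < n
  · exact ⟨(x ⟨i, h⟩).1, (x ⟨i, h⟩).2, by simp [coeffSeq, h], mem_degreeLT.1 (x ⟨i, h⟩).1.2,
      mem_degreeLT.1 (x ⟨i, h⟩).2.2⟩
  · refine ⟨0, 0, by simp [coeffSeq, h]; rfl, ?_, ?_⟩ <;> simp

theorem coeffSeq_zero {n d₁ d₂ : ℕ} (x : Fin n → degreeLT ℂ d₁ × degreeLT ℂ d₂) (i : ℕ)
    (hi : n ≤ i) : coeffSeq n d₁ d₂ x i = 0 := by
  simp [coeffSeq, not_lt.2 hi]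

theorem eq_zero_of_coeffSeq_eq_zero {n d₁ d₂ : ℕ} {x : Fin n → degreeLT ℂ d₁ × degreeLT ℂ d₂}
    (h : coeffSeq n d₁ d₂ x = 0) : x = 0 := by
  funext i
  have := congrFun h i
  simp only [coeffSeq, LinearMap.coe_mk, AddHom.coe_mk, i.2, dite_true, Pi.zero_apply,
    Prod.mk_eq_zero, map_eq_zero_iff _ (RatFunc.algebraMap_injective ℂ)] at this
  exact Prod.ext (Subtype.ext this.1) (Subtype.ext this.2)

/-! ### Degrees of derivatives -/

theorem DegLE.derivative {a : ℂ[X]} {n : ℤ} (h : DegLE (ι a) n) :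
    DegLE (ι (derivative a)) (n - 1) := by
  by_cases hd : a.natDegree = 0
  · rw [eq_C_of_natDegree_eq_zero hd]
    simpa using DegLE.zero _
  · rcases h with h | h
    · exact Or.inl (by simp [(map_eq_zero_iff _ (RatFunc.algebraMap_injective ℂ)).1 h])
    · rw [RatFunc.intDegree_polynomial] at h
      refine Or.inr ?_
      rw [RatFunc.intDegree_polynomial]
      have := natDegree_derivative_le a
      omega

theorem asy_logDeriv {η : ℂ[X]} (hη : η.Monic) :
    Asy (ι (derivative η) / ι η) (-1) η.natDegree := by
  rcases Nat.eq_zero_or_pos η.natDegree with h | h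
  · rw [h, eq_C_of_natDegree_eq_zero h]
    simpa using Asy.zero _
  · have h1 := asy_div (a := derivative η) hη rfl (natDegree_derivative_le η)
    refine h1.congr (by omega) ?_
    rw [coeff_derivative, Nat.sub_add_cancel h, hη.coeff_natDegree, one_mul, Nat.cast_sub h]
    simp

/-! ### Existence of an intertwiner -/

theorem asy_derivative_derivative {a : ℂ[X]} {n : ℕ} (h : a.natDegree ≤ n) :
    Asy (ι (derivative (derivative a))) ((n : ℤ) - 2) (n * ((n : ℂ) - 1) * a.coeff n) := by
  rcases n with _ | n
  · rw [eq_C_of_natDegree_le_zero h]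
    simpa using Asy.zero (-2)
  · have h1 : (derivative a).natDegree ≤ n := (natDegree_derivative_le a).trans (by omega)
    refine (asy_derivative h1).congr (by push_cast; ring) ?_
    rw [coeff_derivative]
    push_cast
    ring

/-- With `ρ(∞) = p₂ ν (ν + 1)`, the operation `M ↦ T M - M T₀` lowers the degree of operators of
degree at most `ν = deg η`. -/
theorem delta_asy {p q : ℂ[X]} {σ ρ : RatFunc ℂ} {ν : ℕ} (hp : p.natDegree ≤ 2)
    (hq : q.natDegree ≤ 1) (hσ : Asy σ (-1) ν) (hρ : Asy ρ 0 (p.coeff 2 * ν * (ν + 1)))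
    {a b : ℂ[X]} (ha : a.natDegree ≤ ν) (hb : b.degree < ν) :
    DegLE (dA p σ (ι b)) (ν - 1) ∧ DegLE (dB p σ ρ (ι a) (ι b)) (ν - 2) ∧
      DegLE (dC p q σ ρ (ι a) (ι b)) (ν - 1) := by
  have hp0 := asy_algebraMap hp
  have hp1 := asy_derivative hp
  have hp2 := asy_derivative_derivative hp
  have hq0 := asy_algebraMap hq
  have hq1 := asy_derivative hq
  have ha0 := asy_algebraMap ha
  have ha1 := asy_derivative ha
  have ha2 := asy_derivative_derivative ha
  set p₂ := p.coeff 2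
  set q₁ := q.coeff 1
  set α := a.coeff ν
  obtain ⟨β, hb0, hb1, hb2⟩ : ∃ β : ℂ, Asy (ι b) (ν - 1) β ∧
      Asy (ι (derivative b)) (ν - 2) ((ν - 1) * β) ∧
      Asy (ι (derivative (derivative b))) (ν - 3) ((ν - 1) * (ν - 2) * β) := by
    rcases ν with _ | n
    · have : b = 0 := degree_eq_bot.1 (Nat.WithBot.lt_zero_iff.1 (by simpa using hb))
      subst this
      refine ⟨0, ?_, ?_, ?_⟩ <;> simp only [mul_zero, map_zero] <;>
        exact Asy.zero _
    · have hb' : b.natDegree ≤ n := by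
        by_cases h0 : b = 0
        · simp [h0]
        · rw [degree_eq_natDegree h0] at hb
          exact Nat.lt_succ_iff.1 (by exact_mod_cast hb)
      refine ⟨b.coeff n, (asy_algebraMap hb').congr (by push_cast; ring) rfl,
        (asy_derivative hb').congr (by push_cast; ring) (by push_cast; ring),
        (asy_derivative_derivative hb').congr (by push_cast; ring) (by push_cast; ring)⟩
  have two : ∀ {f : RatFunc ℂ} {n : ℤ} {c : ℂ}, Asy f n c → Asy (2 * f) n (2 * c) := fun hf => by
    have := hf.const_mul 2
    rwa [map_ofNat] at this
  have four : ∀ {f : RatFunc ℂ} {n : ℤ} {c : ℂ}, Asy f n c → Asy (4 * f) n (4 * c) := fun hf => by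
    have := hf.const_mul 4
    rwa [map_ofNat] at this
  have hτ : Asy (ι (tauP p q)) 2 (q₁ * q₁ - 2 * (2 * p₂ * q₁) + 2 * (p₂ * q₁)) := by
    have e : ι (tauP p q) = ι q * ι q - 2 * (ι (derivative p) * ι q) +
        2 * (ι p * ι (derivative q)) := by
      simp only [tauP, map_add, map_sub, map_mul, map_pow, map_ofNat]
      ring
    rw [e]
    exact (((hq0.mul hq0).congr (by norm_num) rfl).sub (two ((hp1.mul hq0).congr (by norm_num)
      (by push_cast; ring)))).add
      (two ((hp0.mul hq1).congr (by norm_num) (by push_cast; ring)))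
  have hε : Asy (ι (epsP p q)) 1 (q₁ * (q₁ - 2 * p₂)) := by
    rw [epsP, map_mul, map_sub]
    exact (hq0.mul ((hq1.congr (by norm_num : ((1 : ℕ) : ℤ) - 1 = 0) rfl).sub
      (hp2.congr (by norm_num) rfl))).congr (by norm_num) (by push_cast; ring)
  refine ⟨?_, ?_, ?_⟩
  · rw [dA, rD_algebraMap]
    refine Asy.degLE_pred (((((four hp0).mul hb1).congr (n := _) (m := (ν : ℤ)) (by push_cast; ring)
      rfl).add (((two hp1).mul hb0).congr (by push_cast; ring) rfl)).sub
      ((((four hp0).mul hσ).mul hb0).congr (by push_cast; ring) rfl)) ?_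
    push_cast
    ring
  · rw [dB, rD_algebraMap, rD_algebraMap, rD_algebraMap]
    have h1 := (ha1.sub ((hσ.mul ha0).congr (m := (ν : ℤ) - 1) (by ring) rfl)).add
      (((((((hp0.mul hb2).congr (m := (ν : ℤ) - 1) (by push_cast; ring) rfl).add
        (((two hp1).mul hb1).congr (by push_cast; ring) rfl)).sub
        ((((two hp1).mul hσ).mul hb0).congr (by push_cast; ring) rfl)).sub
        ((((two hp0).mul hσ).mul hb1).congr (by push_cast; ring) rfl)).add
        ((((hp2.congr (by norm_num) rfl).add hρ).mul hb0).congr (by ring) rfl)))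
    refine (h1.degLE_pred ?_).mono (by omega)
    push_cast
    ring
  · rw [dC, rD_algebraMap, rD_algebraMap, rD_algebraMap]
    have h1 := (((((hp0.mul ha2).congr (m := (ν : ℤ)) (by push_cast; ring) rfl).sub
      ((((two hp0).mul hσ).mul ha1).congr (by push_cast; ring) rfl)).add
      ((hρ.mul ha0).congr (by ring) rfl)).add
      ((hτ.mul (hb1.sub ((hσ.mul hb0).congr (by ring) rfl))).congr (by ring) rfl)).add
      ((hε.mul hb0).congr (by ring) rfl)
    refine h1.degLE_pred ?_
    ring

theorem mem_of_forall_X_sub_C_pow_mem (ζ : ℂ) (S : Submodule ℂ ℂ[X])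
    (h : ∀ k : ℕ, (X - C ζ) ^ k ∈ S) (a : ℂ[X]) : a ∈ S := by
  rw [← sum_taylor_eq a ζ, Polynomial.sum]
  refine S.sum_mem fun k _ => ?_
  rw [← smul_eq_C_mul]
  exact S.smul_mem _ (h k)

/-- A count of dimensions: operators of order less than `2n` and degree at most `ν` depend on
`n (2ν + 1)` parameters, and `2nν + O(1)` linear conditions force them to map polynomials into all
the spaces `W ζ`. -/
theorem exists_adm_of_finrank {p q : ℂ[X]} {σ ρ : RatFunc ℂ} {Z : Finset ℂ} {ν : ℂ → ℕ}
    (hW : ∀ ζ ∈ Z, ∃ (W : Submodule ℂ ℂ[X]) (m : ℕ),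
      (∀ a ∈ W, ∀ k : ℕ, (opS p q σ ρ ^ k) (ι a) ∈ regAt ζ) ∧
      (∀ a, (X - C ζ) ^ m ∣ a → a ∈ W) ∧ FiniteDimensional ℂ (ℂ[X] ⧸ W) ∧
      Module.finrank ℂ (ℂ[X] ⧸ W) ≤ ν ζ) :
    ∃ (n : ℕ) (w : ℕ → RatFunc ℂ × RatFunc ℂ), w ≠ 0 ∧ Adm p q σ ρ Z n w ∧
      ∀ i, ∃ a b : ℂ[X], w i = (ι a, ι b) ∧ a.degree < (∑ ζ ∈ Z, ν ζ + 1 : ℕ) ∧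
        b.degree < (∑ ζ ∈ Z, ν ζ : ℕ) := by
  choose! W m hreg hmem hfd hrank using hW
  set N := ∑ ζ ∈ Z, ν ζ with hN
  -- with this `n`, the number of parameters exceeds the number `∑ (m ζ + 2 n) ν ζ` of conditions
  set n := ∑ ζ ∈ Z, m ζ * ν ζ + 1 with hn
  choose B hB hBd using exists_opT_pow_algebraMap p q
  choose G hG hGd using exists_opX_algebraMap p q
  have hfd' : ∀ ζ : Z, FiniteDimensional ℂ (ℂ[X] ⧸ W ζ) := fun ζ => hfd ζ ζ.2
  -- the polynomial `M a`, as a linear function of the coefficients of `M`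
  let E : ℂ[X] → (Fin n → degreeLT ℂ (N + 1) × degreeLT ℂ N) →ₗ[ℂ] ℂ[X] := fun a =>
    ∑ i : Fin n, (LinearMap.mulRight ℂ (B i a) ∘ₗ (degreeLT ℂ (N + 1)).subtype ∘ₗ
        LinearMap.fst ℂ _ _ ∘ₗ LinearMap.proj i +
      LinearMap.mulRight ℂ (G (B i a)) ∘ₗ (degreeLT ℂ N).subtype ∘ₗ
        LinearMap.snd ℂ _ _ ∘ₗ LinearMap.proj i)
  have hE : ∀ a x, E a x = ∑ i : Fin n, ((x i).1.1 * B i a + (x i).2.1 * G (B i a)) := by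
    intro a x
    simp [E, LinearMap.sum_apply]
  have hEM : ∀ a x, opM p q n (coeffSeq n (N + 1) N x) (ι a) = ι (E a x) := by
    intro a x
    rw [opM_apply, ← Fin.sum_univ_eq_sum_range (fun i => (coeffSeq n (N + 1) N x i).1 *
      (opT p q ^ i) (ι a) + (coeffSeq n (N + 1) N x i).2 * opX p q ((opT p q ^ i) (ι a))) n, hE,
      map_sum]
    refine Finset.sum_congr rfl fun i _ => ?_
    rw [hB, hG]
    simp [coeffSeq]
  let Φ : (Fin n → degreeLT ℂ (N + 1) × degreeLT ℂ N) →ₗ[ℂ]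
      ((ζ : Z) → Fin (m ζ + 2 * n) → ℂ[X] ⧸ W ζ) :=
    LinearMap.pi fun ζ => LinearMap.pi fun k => (W ζ).mkQ ∘ₗ E ((X - C (ζ : ℂ)) ^ (k : ℕ))
  have hker : LinearMap.ker Φ ≠ ⊥ := by
    apply LinearMap.ker_ne_bot_of_finrank_lt
    rw [Module.finrank_pi_fintype, Module.finrank_pi_fintype]
    simp only [Module.finrank_prod, finrank_degreeLT, Module.finrank_pi_fintype, Finset.sum_const,
      Finset.card_univ, Fintype.card_fin, smul_eq_mul]
    calc ∑ ζ : Z, (m ζ + 2 * n) * Module.finrank ℂ (ℂ[X] ⧸ W ζ)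
        ≤ ∑ ζ : Z, (m ζ + 2 * n) * ν ζ :=
          Finset.sum_le_sum fun ζ _ => Nat.mul_le_mul le_rfl (hrank ζ ζ.2)
      _ = ∑ ζ ∈ Z, (m ζ + 2 * n) * ν ζ := Finset.sum_coe_sort Z fun ζ => (m ζ + 2 * n) * ν ζ
      _ = (n - 1) + 2 * n * N := by
          rw [hn, Nat.add_sub_cancel, hN, Finset.mul_sum, ← Finset.sum_add_distrib]
          exact Finset.sum_congr rfl fun ζ _ => by ring
      _ < n * (N + 1 + N) := by
          have : n * (N + 1 + N) = n + 2 * n * N := by ring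
          omega
  obtain ⟨x, hx, hx0⟩ := (Submodule.ne_bot_iff _).1 hker
  have hEW : ∀ ζ ∈ Z, ∀ a, E a x ∈ W ζ := by
    intro ζ hζ a
    have hlin : ∀ a b : ℂ[X], ∀ c : ℂ, E (a + c • b) x = E a x + c • E b x := by
      intro a b c
      apply RatFunc.algebraMap_injective ℂ
      have hs : ∀ f : ℂ[X], ι (c • f) = c • ι f := fun f => by
        rw [smul_eq_C_mul, map_mul, RatFunc.algebraMap_C, RatFunc.smul_eq_C_mul]
      have he : ι (a + c • b) = ι a + c • ι b := by rw [map_add, hs]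
      rw [← hEM, he, map_add (opM p q n _), map_smul, hEM, hEM, map_add, hs]
    have hlin0 : E 0 x = 0 := by
      have := hlin 0 0 (-1)
      simpa using this
    let S : Submodule ℂ ℂ[X] :=
      { carrier := {a | E a x ∈ W ζ}
        zero_mem' := by simp [hlin0]
        add_mem' := by
          intro a b ha hb
          have := hlin a b 1
          rw [one_smul, one_smul] at this
          change E (a + b) x ∈ W ζ
          rw [this]
          exact add_mem ha hb
        smul_mem' := by
          intro c a ha
          have := hlin 0 a c
          rw [zero_add, hlin0, zero_add] at this
          change E (c • a) x ∈ W ζ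
          rw [this]
          exact (W ζ).smul_mem c ha }
    refine mem_of_forall_X_sub_C_pow_mem ζ S (fun k => ?_) a
    change E ((X - C ζ) ^ k) x ∈ W ζ
    by_cases hk : k < m ζ + 2 * n
    · have h1 := congrFun (congrFun (LinearMap.mem_ker.1 hx) ⟨ζ, hζ⟩) ⟨k, hk⟩
      exact (Submodule.Quotient.mk_eq_zero _).1 h1
    · refine hmem ζ hζ _ ?_
      rw [hE]
      refine Finset.dvd_sum fun i _ => ?_
      have h1 : (X - C ζ) ^ (m ζ + 1) ∣ B i ((X - C ζ) ^ k) :=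
        hBd i _ ζ _ (pow_dvd_pow _ (by have := i.2; omega))
      exact dvd_add (((pow_dvd_pow _ (Nat.le_succ _)).trans h1).mul_left _)
        ((hGd _ ζ _ h1).mul_left _)
  refine ⟨n, coeffSeq n (N + 1) N x, fun h => hx0 (eq_zero_of_coeffSeq_eq_zero h),
    ⟨fun i => ?_, coeffSeq_zero x, fun ζ hζ k a => ?_⟩, coeffSeq_poly x⟩
  · obtain ⟨a, b, hab, -, -⟩ := coeffSeq_poly x i
    exact ⟨⟨a, by rw [hab]⟩, b, by rw [hab]⟩
  · rw [hEM]
    exact hreg ζ hζ _ (hEW ζ hζ a) k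

theorem opS_sub_C (p q : ℂ[X]) (σ ρ : RatFunc ℂ) (c : ℂ) (y : RatFunc ℂ) :
    opS p q σ (ρ - RatFunc.C c) y = opS p q σ ρ y - c • y := by
  rw [opS_apply, opS_apply, RatFunc.smul_eq_C_mul]
  ring

theorem opS_sub_C_pow_mem_regAt {p q : ℂ[X]} {σ ρ : RatFunc ℂ} (c : ℂ) {ζ : ℂ} (j : ℕ) :
    ∀ {y : RatFunc ℂ}, (∀ k : ℕ, (opS p q σ ρ ^ k) y ∈ regAt ζ) →
      (opS p q σ (ρ - RatFunc.C c) ^ j) y ∈ regAt ζ := by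
  induction j with
  | zero => intro y hy; exact hy 0
  | succ j ih =>
    intro y hy
    rw [pow_succ, Module.End.mul_apply]
    refine ih fun k => ?_
    rw [opS_sub_C, map_sub, map_smul, ← Module.End.mul_apply, ← pow_succ]
    exact sub_mem (hy _) (smul_mem_regAt c (hy k))

/-- There are a constant `c` and a nonzero operator `M = Σ (uᵢ + vᵢ X) T₀ⁱ` with polynomial
`uᵢ`, `vᵢ` such that `(T₀ - σ X + ρ) M = M (T₀ + c)`. -/
def HasIntertwiner (p q : ℂ[X]) (σ ρ : RatFunc ℂ) : Prop :=
  ∃ (n : ℕ) (w : ℕ → RatFunc ℂ × RatFunc ℂ) (c : ℂ), w ≠ 0 ∧ (∀ i, n ≤ i → w i = 0) ∧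
    (∀ i, (∃ a, (w i).1 = ι a) ∧ ∃ a, (w i).2 = ι a) ∧
    ∀ y, opS p q σ ρ (opM p q n w y) = opM p q n w (opT p q y + c • y)

/-- Admissible operators of degree at most `ν = deg η` exist, and for them `T M - M T₀` has degree
less than `ν`, hence vanishes, provided the constant term of `T` is suitably normalized. -/
theorem hasIntertwiner_of_finrank_le {p q : ℂ[X]} {ρ : RatFunc ℂ} {Z : Finset ℂ}
    {ν : ℂ → ℕ} (hp : p.natDegree ≤ 2)
    (hq : q.natDegree ≤ 1) (hpZ : ∀ ζ ∈ Z, p.eval ζ ≠ 0) (hρ : ∀ ζ ∉ Z, ρ ∈ regAt ζ)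
    (hρ0 : DegLE ρ 0)
    (hW : ∀ ζ ∈ Z, ∃ (W : Submodule ℂ ℂ[X]) (m : ℕ),
      (∀ a ∈ W, ∀ k : ℕ,
        (opS p q (ι (derivative (etaProd Z ν)) / ι (etaProd Z ν)) ρ ^ k) (ι a) ∈ regAt ζ) ∧
      (∀ a, (X - C ζ) ^ m ∣ a → a ∈ W) ∧ FiniteDimensional ℂ (ℂ[X] ⧸ W) ∧
      Module.finrank ℂ (ℂ[X] ⧸ W) ≤ ν ζ) :
    HasIntertwiner p q (ι (derivative (etaProd Z ν)) / ι (etaProd Z ν)) ρ := by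
  set σ := ι (derivative (etaProd Z ν)) / ι (etaProd Z ν) with hσdef
  have hσ : ∀ ζ ∉ (Z : Set ℂ), σ ∈ regAt ζ := fun ζ hζ =>
    logDeriv_mem_regAt (eval_etaProd_ne_zero (by simpa using hζ))
  set N := ∑ ζ ∈ Z, ν ζ with hN
  have hdeg : (etaProd Z ν).natDegree = N := natDegree_etaProd Z ν
  obtain ⟨ρ₀, hρ₀⟩ := exists_asy_of_degLE hρ0
  set c := ρ₀ - p.coeff 2 * N * (N + 1) with hc
  have hρ' : Asy (ρ - RatFunc.C c) 0 (p.coeff 2 * N * (N + 1)) := by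
    have h1 : Asy (RatFunc.C c) 0 c := by simpa [Asy] using DegLE.zero _
    exact (hρ₀.sub h1).congr rfl (by rw [hc]; ring)
  have hreg' : ∀ ζ ∉ (Z : Set ℂ), ρ - RatFunc.C c ∈ regAt ζ := fun ζ hζ => by
    rw [← RatFunc.algebraMap_C]
    exact sub_mem (hρ ζ (by simpa using hζ)) (algebraMap_mem_regAt ζ _)
  have hWc : ∀ ζ ∈ Z, ∃ (W : Submodule ℂ ℂ[X]) (m : ℕ),
      (∀ a ∈ W, ∀ k : ℕ, (opS p q σ (ρ - RatFunc.C c) ^ k) (ι a) ∈ regAt ζ) ∧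
      (∀ a, (X - C ζ) ^ m ∣ a → a ∈ W) ∧ FiniteDimensional ℂ (ℂ[X] ⧸ W) ∧
      Module.finrank ℂ (ℂ[X] ⧸ W) ≤ ν ζ := by
    intro ζ hζ
    obtain ⟨W, m, h1, h2⟩ := hW ζ hζ
    exact ⟨W, m, fun a ha k => opS_sub_C_pow_mem_regAt c k (h1 a ha), h2⟩
  obtain ⟨n, w, hw0, hadm, hwd⟩ := exists_adm_of_finrank hWc
  have hd := hadm.delta hq hpZ hσ hreg'
  have hsig : Asy σ (-1) N := by
    have := asy_logDeriv (etaProd_monic Z ν)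
    rwa [hdeg] at this
  have hzero : delta p q σ (ρ - RatFunc.C c) w = 0 := by
    refine hd.eq_zero_of_degree_lt hq hpZ (by simpa using hreg') fun i a ha => ?_
    have hnd : (etaProd Z ν).degree = (N : WithBot ℕ) := by
      rw [degree_eq_natDegree (etaProd_monic Z ν).ne_zero, hdeg]
    rw [hnd]
    have key : ∀ i, DegLE (dA p σ (w i).2) (N - 1) ∧
        DegLE (dB p σ (ρ - RatFunc.C c) (w i).1 (w i).2) (N - 2) ∧
        DegLE (dC p q σ (ρ - RatFunc.C c) (w i).1 (w i).2) (N - 1) := by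
      intro i
      obtain ⟨a, b, hab, ha, hb⟩ := hwd i
      rw [hab]
      refine delta_asy hp hq hsig hρ' ?_ hb
      by_cases ha0 : a = 0
      · simp [ha0]
      · exact Nat.lt_succ_iff.1 ((natDegree_lt_iff_degree_lt ha0).2 ha)
    rcases ha with ha | ha
    · refine degree_lt_of_degLE (n := N - 1) ?_ (by omega)
      rw [← ha]
      refine (key i).2.2.add ?_
      split_ifs
      · exact DegLE.zero _
      · exact (key _).1
    · refine degree_lt_of_degLE (n := N - 2) ?_ (by omega)
      rw [← ha]
      exact (key i).2.1
  refine ⟨n, w, c, hw0, hadm.zero, hadm.poly, fun y => ?_⟩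
  have h1 := opS_opM p q hq σ (ρ - RatFunc.C c) n w hadm.zero y
  rw [hzero, opS_sub_C] at h1
  have h2 : opM p q (n + 1) 0 y = 0 := by simp [opM_apply]
  rw [h2] at h1
  rw [map_add, map_smul]
  linear_combination h1

/-! ### Behaviour of exceptional operators at infinity -/

theorem act_eq_op2 {T : DiffOp} (hT : HasOrder T 2) (y : RatFunc ℂ) :
    act T y = op2 (T 2) (T 1) (T 0) y := by
  rw [act_eq_sum_of_support_subset T (Finset.range 3) (fun j hj => by
    rw [Finset.mem_range]
    by_contra h
    exact Finsupp.mem_support_iff.1 hj (hT.2 j (by omega)))]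
  simp only [Finset.sum_range_succ, Finset.sum_range_zero, Function.iterate_succ_apply',
    Function.iterate_zero_apply, op2_apply, rD_apply]
  ring

theorem exists_common_denom (p q r : RatFunc ℂ) :
    ∃ A₂ A₁ A₀ B : ℂ[X], B.Monic ∧ p = ι A₂ / ι B ∧ q = ι A₁ / ι B ∧ r = ι A₀ / ι B := by
  have h : ∀ f : RatFunc ℂ, ι f.denom ≠ 0 := fun f =>
    RatFunc.algebraMap_ne_zero (RatFunc.denom_ne_zero f)
  refine ⟨p.num * (q.denom * r.denom), q.num * (p.denom * r.denom), r.num * (p.denom * q.denom),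
    p.denom * (q.denom * r.denom), (RatFunc.monic_denom p).mul ((RatFunc.monic_denom q).mul
      (RatFunc.monic_denom r)), ?_, ?_, ?_⟩
  · conv_lhs => rw [← RatFunc.num_div_denom p]
    rw [div_eq_div_iff (h p) (by simp [h])]
    simp only [map_mul]
    ring
  · conv_lhs => rw [← RatFunc.num_div_denom q]
    rw [div_eq_div_iff (h q) (by simp [h])]
    simp only [map_mul]
    ring
  · conv_lhs => rw [← RatFunc.num_div_denom r]
    rw [div_eq_div_iff (h r) (by simp [h])]
    simp only [map_mul]
    ring

theorem op2_div_algebraMap (A₂ A₁ A₀ B a : ℂ[X]) (hB : B ≠ 0) :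
    op2 (ι A₂ / ι B) (ι A₁ / ι B) (ι A₀ / ι B) (ι a) =
      ι (A₂ * derivative (derivative a) + A₁ * derivative a + A₀ * a) / ι B := by
  have : ι B ≠ 0 := RatFunc.algebraMap_ne_zero hB
  rw [op2_apply, rD_algebraMap, rD_algebraMap]
  simp only [map_add, map_mul]
  field_simp

theorem quadratic_eq_zero {α β γ : ℂ} {s : Set ℕ} (hs : s.Infinite)
    (h : ∀ k ∈ s, α * (k * (k - 1)) + β * k + γ = 0) : α = 0 ∧ β = 0 ∧ γ = 0 := by
  have h0 : (C α * (X * (X - 1)) + C β * X + C γ : ℂ[X]) = 0 := by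
    refine eq_zero_of_infinite_isRoot _ ((hs.image Nat.cast_injective.injOn).mono ?_)
    rintro _ ⟨k, hk, rfl⟩
    have := h k hk
    simpa [IsRoot.def] using this
  have e0 := congrArg (eval 0) h0
  have e1 := congrArg (eval 1) h0
  have e2 := congrArg (eval 2) h0
  simp at e0 e1 e2
  subst e0
  have hβ : β = 0 := by simpa using e1
  subst hβ
  norm_num at e2
  exact ⟨e2, rfl, rfl⟩

/-- The operator acts on leading coefficients of degree `k` as multiplication by a quadratic
polynomial in `k`. -/
theorem coeff_op2 {A₂ A₁ A₀ y : ℂ[X]} {n k : ℕ} (h₂ : A₂.natDegree ≤ n + 2)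
    (h₁ : A₁.natDegree ≤ n + 1) (h₀ : A₀.natDegree ≤ n) (hk : 2 ≤ k) (hy : y.natDegree ≤ k) :
    (A₂ * derivative (derivative y) + A₁ * derivative y + A₀ * y).coeff (n + k) =
      (A₂.coeff (n + 2) * (k * (k - 1)) + A₁.coeff (n + 1) * k + A₀.coeff n) * y.coeff k := by
  obtain ⟨j, rfl⟩ : ∃ j, k = j + 2 := ⟨k - 2, by omega⟩
  have d1 : (derivative y).natDegree ≤ j + 1 := (natDegree_derivative_le y).trans (by omega)
  have d2 : (derivative (derivative y)).natDegree ≤ j :=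
    (natDegree_derivative_le _).trans (by omega)
  rw [coeff_add, coeff_add, coeff_mul_add_eq_of_natDegree_le h₀ hy,
    show n + (j + 2) = (n + 1) + (j + 1) by ring, coeff_mul_add_eq_of_natDegree_le h₁ d1,
    show n + 1 + (j + 1) = (n + 2) + j by ring, coeff_mul_add_eq_of_natDegree_le h₂ d2,
    coeff_derivative, coeff_derivative]
  push_cast
  ring

theorem natDegree_le_pred {a : ℂ[X]} {n : ℕ} (h : a.natDegree ≤ n + 1) (h0 : a.coeff (n + 1) = 0) :
    a.natDegree ≤ n := by
  rw [natDegree_le_iff_coeff_eq_zero] at h ⊢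
  intro N hN
  rcases (show n + 1 = N ∨ n + 1 < N by omega) with rfl | h1
  · exact h0
  · exact h N h1

/-- The eigenvalue equations bound the degrees of the coefficients: a positive degree of the
operator would make the coefficient of the highest power vanish for infinitely many degrees. -/
theorem natDegree_le_of_eigen {A₂ A₁ A₀ B : ℂ[X]} {s : Set ℕ} (hs : s.Infinite)
    (h : ∀ k ∈ s, ∃ (y : ℂ[X]) (lam : ℂ), y.degree = (k : WithBot ℕ) ∧
      A₂ * derivative (derivative y) + A₁ * derivative y + A₀ * y = C lam * (B * y)) :
    A₂.natDegree ≤ B.natDegree + 2 ∧ A₁.natDegree ≤ B.natDegree + 1 ∧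
      A₀.natDegree ≤ B.natDegree := by
  set b := B.natDegree
  have hs' : {k ∈ s | 2 ≤ k}.Infinite := by
    refine (hs.sdiff (Set.finite_lt_nat 2)).mono fun k hk => ⟨hk.1, not_lt.1 hk.2⟩
  have key : ∀ d, (A₂.natDegree ≤ (b + d) + 2 ∧ A₁.natDegree ≤ (b + d) + 1 ∧
      A₀.natDegree ≤ b + d) → A₂.natDegree ≤ b + 2 ∧ A₁.natDegree ≤ b + 1 ∧ A₀.natDegree ≤ b := by
    intro d
    induction d with
    | zero => exact fun h => h
    | succ d ih =>
      rintro ⟨h₂, h₁, h₀⟩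
      obtain ⟨z₂, z₁, z₀⟩ := quadratic_eq_zero (α := A₂.coeff (b + (d + 1) + 2))
        (β := A₁.coeff (b + (d + 1) + 1)) (γ := A₀.coeff (b + (d + 1))) hs' (by
          rintro k ⟨hk, hk2⟩
          obtain ⟨y, lam, hy, he⟩ := h k hk
          have hy' := natDegree_eq_of_degree_eq_some hy
          have hc := coeff_op2 h₂ h₁ h₀ hk2 hy'.le
          have hyk : y.coeff k ≠ 0 := coeff_ne_zero_of_eq_degree hy
          rw [he, coeff_C_mul, coeff_eq_zero_of_natDegree_lt
            (lt_of_le_of_lt natDegree_mul_le (by omega)), mul_zero] at hc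
          exact (mul_eq_zero.1 hc.symm).resolve_right hyk)
      exact ih ⟨natDegree_le_pred h₂ z₂, natDegree_le_pred h₁ z₁, natDegree_le_pred h₀ z₀⟩
  exact key (A₂.natDegree + A₁.natDegree + A₀.natDegree) ⟨by omega, by omega, by omega⟩

theorem eigenvalue_eq {A₂ A₁ A₀ B y : ℂ[X]} (hB : B.Monic) {lam : ℂ} {k : ℕ} (hk : 2 ≤ k)
    (h₂ : A₂.natDegree ≤ B.natDegree + 2) (h₁ : A₁.natDegree ≤ B.natDegree + 1)
    (h₀ : A₀.natDegree ≤ B.natDegree) (hy : y.degree = (k : WithBot ℕ))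
    (he : A₂ * derivative (derivative y) + A₁ * derivative y + A₀ * y = C lam * (B * y)) :
    A₂.coeff (B.natDegree + 2) * (k * (k - 1)) + A₁.coeff (B.natDegree + 1) * k +
      A₀.coeff B.natDegree = lam := by
  have hy' := natDegree_eq_of_degree_eq_some hy
  have hc := coeff_op2 h₂ h₁ h₀ hk hy'.le
  have hyk : y.coeff k ≠ 0 := coeff_ne_zero_of_eq_degree hy
  rw [he, coeff_C_mul, coeff_mul_add_eq_of_natDegree_le le_rfl hy'.le, hB.coeff_natDegree,
    one_mul] at hc
  exact (mul_right_cancel₀ hyk hc).symm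

/-- If the eigenvalues did not depend on the degree, `T` minus this eigenvalue would annihilate
polynomials of infinitely many degrees. -/
theorem coeff_ne_zero_of_eigen {A₂ A₁ A₀ B : ℂ[X]} (hA : A₂ ≠ 0) (hB : B.Monic) {s : Set ℕ}
    (hs : s.Infinite)
    (h : ∀ k ∈ s, ∃ (y : ℂ[X]) (lam : ℂ), y.degree = (k : WithBot ℕ) ∧
      A₂ * derivative (derivative y) + A₁ * derivative y + A₀ * y = C lam * (B * y)) :
    A₂.coeff (B.natDegree + 2) ≠ 0 ∨ A₁.coeff (B.natDegree + 1) ≠ 0 := by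
  obtain ⟨h₂, h₁, h₀⟩ := natDegree_le_of_eigen hs h
  by_contra! hcon
  obtain ⟨z₂, z₁⟩ := hcon
  set γ := A₀.coeff B.natDegree
  have hs' : {k ∈ s | 2 ≤ k}.Infinite :=
    (hs.sdiff (Set.finite_lt_nat 2)).mono fun k hk => ⟨hk.1, not_lt.1 hk.2⟩
  -- multiplication by `z²` makes all exponents below natural numbers
  have h' : ∀ k ∈ {k ∈ s | 2 ≤ k}, ∃ (y : ℂ[X]) (lam : ℂ), y.degree = (k : WithBot ℕ) ∧
      (X ^ 2 * A₂) * derivative (derivative y) + (X ^ 2 * A₁) * derivative y +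
        (X ^ 2 * (A₀ - C γ * B)) * y = C lam * (1 * y) := by
    rintro k ⟨hk, hk2⟩
    obtain ⟨y, lam, hy, he⟩ := h k hk
    have hl := eigenvalue_eq hB hk2 h₂ h₁ h₀ hy he
    rw [z₂, z₁, zero_mul, zero_mul, zero_add, zero_add] at hl
    refine ⟨y, 0, hy, ?_⟩
    rw [C_0, zero_mul]
    rw [← hl] at he
    linear_combination X ^ 2 * he
  obtain ⟨d₂, d₁, d₀⟩ := natDegree_le_of_eigen hs' h'
  have hz := quadratic_eq_zero (α := (X ^ 2 * A₂).coeff (0 + 2))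
    (β := (X ^ 2 * A₁).coeff (0 + 1)) (γ := (X ^ 2 * (A₀ - C γ * B)).coeff 0) hs' (by
      rintro k ⟨hk, hk2⟩
      obtain ⟨y, lam, hy, he⟩ := h k hk
      have hl := eigenvalue_eq hB hk2 h₂ h₁ h₀ hy he
      rw [z₂, z₁, zero_mul, zero_mul, zero_add, zero_add] at hl
      have hy' := natDegree_eq_of_degree_eq_some hy
      have hc := coeff_op2 (n := 0) (by simpa using d₂) (by simpa using d₁) (by simpa using d₀)
        hk2 hy'.le
      have hyk : y.coeff k ≠ 0 := coeff_ne_zero_of_eq_degree hy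
      have e0 : (X ^ 2 * A₂) * derivative (derivative y) + (X ^ 2 * A₁) * derivative y +
        (X ^ 2 * (A₀ - C γ * B)) * y = 0 := by
        rw [← hl] at he
        linear_combination X ^ 2 * he
      rw [e0, coeff_zero] at hc
      exact (mul_eq_zero.1 hc.symm).resolve_right hyk)
  have h3 : (X ^ 2 * A₂).natDegree ≤ 1 :=
    natDegree_le_pred (by simpa using d₂) (by simpa using hz.1)
  rw [natDegree_mul (pow_ne_zero 2 X_ne_zero) hA, natDegree_X_pow] at h3
  omega

/-- An exceptional operator has degree zero, and its coefficients at infinity of `D²` and `D` do not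
vanish simultaneously. -/
theorem exists_asy_of_isExceptional {T : DiffOp} (hT : IsExceptional T) :
    ∃ p₂ q₁ : ℂ, Asy (T 2) 2 p₂ ∧ Asy (T 1) 1 q₁ ∧ DegLE (T 0) 0 ∧ (p₂ ≠ 0 ∨ q₁ ≠ 0) := by
  obtain ⟨A₂, A₁, A₀, B, hB, e₂, e₁, e₀⟩ := exists_common_denom (T 2) (T 1) (T 0)
  have hB0 : ι B ≠ 0 := RatFunc.algebraMap_ne_zero hB.ne_zero
  have hs : {k | HasEigenpolynomial T k}.Infinite := by
    have := hT.2.infinite_compl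
    simpa [Set.compl_def] using this
  have h : ∀ k ∈ {k | HasEigenpolynomial T k}, ∃ (y : ℂ[X]) (lam : ℂ),
      y.degree = (k : WithBot ℕ) ∧
      A₂ * derivative (derivative y) + A₁ * derivative y + A₀ * y = C lam * (B * y) := by
    rintro k ⟨y, lam, hy, he⟩
    refine ⟨y, lam, hy, ?_⟩
    rw [act_eq_op2 hT.1, e₂, e₁, e₀, op2_div_algebraMap _ _ _ _ _ hB.ne_zero,
      RatFunc.smul_eq_C_mul, ← RatFunc.algebraMap_C, div_eq_iff hB0, ← map_mul, ← map_mul] at he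
    rw [RatFunc.algebraMap_injective ℂ he]
    ring
  have hA : A₂ ≠ 0 := by
    rintro rfl
    exact hT.1.1 (by rw [e₂, map_zero, zero_div])
  obtain ⟨h₂, h₁, h₀⟩ := natDegree_le_of_eigen hs h
  refine ⟨_, _, ?_, ?_, ?_, coeff_ne_zero_of_eigen hA hB hs h⟩
  · rw [e₂]
    exact (asy_div hB rfl h₂).congr (by push_cast; ring) rfl
  · rw [e₁]
    exact (asy_div hB rfl h₁).congr (by push_cast; ring) rfl
  · rw [e₀]
    have := (asy_div hB rfl h₀).degLE
    rwa [sub_self] at this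

/-! ### The maximal invariant polynomial subspace -/

/-- The embedding of polynomials as a `ℂ`-linear map. -/
def iotaL : ℂ[X] →ₗ[ℂ] RatFunc ℂ where
  toFun := ι
  map_add' := map_add _
  map_smul' c a := by
    rw [smul_eq_C_mul, map_mul, RatFunc.algebraMap_C, RatFunc.smul_eq_C_mul, RingHom.id_apply]

theorem iotaL_apply (a : ℂ[X]) : iotaL a = ι a := rfl

/-- The polynomials `a` for which all `Sᵏ a` lie in the space `R` of rational functions. -/
def stableIn (S : Module.End ℂ (RatFunc ℂ)) (R : Submodule ℂ (RatFunc ℂ)) :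
    Submodule ℂ ℂ[X] where
  carrier := {a | ∀ k : ℕ, (S ^ k) (iotaL a) ∈ R}
  zero_mem' k := by simp
  add_mem' ha hb k := by
    rw [map_add, map_add]
    exact add_mem (ha k) (hb k)
  smul_mem' c a ha k := by
    rw [map_smul, map_smul]
    exact R.smul_mem c (ha k)

theorem mem_stableIn {S : Module.End ℂ (RatFunc ℂ)} {R : Submodule ℂ (RatFunc ℂ)} {a : ℂ[X]} :
    a ∈ stableIn S R ↔ ∀ k : ℕ, (S ^ k) (ι a) ∈ R := Iff.rfl

/-- When `stableIn S R` has finite codimension, finitely many of its defining conditions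
suffice. -/
theorem exists_stableIn_bound (S : Module.End ℂ (RatFunc ℂ)) (R : Submodule ℂ (RatFunc ℂ))
    (hfd : FiniteDimensional ℂ (ℂ[X] ⧸ stableIn S R)) :
    ∃ J : ℕ, ∀ a, (∀ k ≤ J, (S ^ k) (ι a) ∈ R) → a ∈ stableIn S R := by
  set U := stableIn S R with hU
  let V : ℕ → Submodule ℂ ℂ[X] := fun j =>
    { carrier := {a | ∀ k ≤ j, (S ^ k) (iotaL a) ∈ R}
      zero_mem' := fun k _ => by simp
      add_mem' := fun ha hb k hk => by
        rw [map_add, map_add]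
        exact add_mem (ha k hk) (hb k hk)
      smul_mem' := fun c a ha k hk => by
        rw [map_smul, map_smul]
        exact R.smul_mem c (ha k hk) }
  have hUV : ∀ j, U ≤ V j := fun j a ha k _ => ha k
  let f : ℕ →o (Submodule ℂ (ℂ[X] ⧸ U))ᵒᵈ :=
    { toFun := fun j => OrderDual.toDual ((V j).map U.mkQ)
      monotone' := fun i j hij => Submodule.map_mono fun a ha k hk => ha k (hk.trans hij) }
  obtain ⟨J, hJ⟩ := IsArtinian.monotone_stabilizes f
  refine ⟨J, fun a ha k => ?_⟩
  have h1 : (V J).map U.mkQ = (V (max J k)).map U.mkQ := hJ (max J k) (le_max_left _ _)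
  have h2 : U.mkQ a ∈ (V (max J k)).map U.mkQ := by
    rw [← h1]
    exact Submodule.mem_map_of_mem ha
  obtain ⟨b, hb, hab⟩ := h2
  have h3 : a - b ∈ U := by
    rw [← Submodule.Quotient.mk_eq_zero, Submodule.Quotient.mk_sub]
    exact sub_eq_zero.2 hab.symm
  have h4 : a ∈ V (max J k) := by
    have := add_mem (hUV (max J k) h3) hb
    rwa [sub_add_cancel] at this
  exact h4 k (le_max_right _ _)

/-- The operator `T`, as a linear map. -/
def opOf (T : DiffOp) : Module.End ℂ (RatFunc ℂ) := op2 (T 2) (T 1) (T 0)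

/-- A polynomial belongs to the maximal invariant space if and only if all its iterates under `T`
are polynomials. -/
theorem maxInvariant_eq {T : DiffOp} (hT : HasOrder T 2) :
    maxInvariant T = stableIn (opOf T) (LinearMap.range iotaL) := by
  apply le_antisymm
  · intro a ha
    have key : ∀ k : ℕ, ∃ b ∈ maxInvariant T, (opOf T ^ k) (ι a) = ι b := by
      intro k
      induction k with
      | zero => exact ⟨a, ha, rfl⟩
      | succ k ih =>
        obtain ⟨b, hb, hab⟩ := ih
        obtain ⟨c, hc, hbc⟩ := (isGreatest_maxInvariant T).1 b hb
        refine ⟨c, hc, ?_⟩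
        rw [pow_succ', Module.End.mul_apply, hab, ← hbc, act_eq_op2 hT]
        rfl
    intro k
    obtain ⟨b, -, hb⟩ := key k
    exact ⟨b, hb.symm⟩
  · refine (isGreatest_maxInvariant T).2 fun a ha => ?_
    rw [mem_stableIn] at ha
    obtain ⟨b, hb⟩ := ha 1
    rw [iotaL_apply, pow_one] at hb
    refine ⟨b, ?_, by rw [act_eq_op2 hT]; exact hb.symm⟩
    rw [mem_stableIn]
    intro k
    rw [hb, ← Module.End.mul_apply, ← pow_succ]
    exact ha (k + 1)

theorem finiteDimensional_quotient_of_degree {U : Submodule ℂ ℂ[X]} {N : ℕ}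
    (h : ∀ k, N ≤ k → ∃ y ∈ U, y.degree = (k : WithBot ℕ)) :
    FiniteDimensional ℂ (ℂ[X] ⧸ U) := by
  have key : ∀ d (a : ℂ[X]), a.degree < (N + d : ℕ) → ∃ b ∈ degreeLT ℂ N, a - b ∈ U := by
    intro d
    induction d with
    | zero => intro a ha; exact ⟨a, mem_degreeLT.2 ha, by simp⟩
    | succ d ih =>
      intro a ha
      obtain ⟨y, hyU, hy⟩ := h (N + d) (by omega)
      have hy0 : y.coeff (N + d) ≠ 0 := coeff_ne_zero_of_eq_degree hy
      set c := a.coeff (N + d) / y.coeff (N + d)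
      obtain ⟨b, hb, hab⟩ := ih (a - c • y) (by
        rw [degree_lt_iff_coeff_zero] at ha ⊢
        intro m hm
        rcases hm.eq_or_lt with rfl | hm
        · simp [c, hy0]
        · rw [coeff_sub, coeff_smul, ha m (by omega), coeff_eq_zero_of_degree_lt (n := m)]
          · simp
          · rw [hy]
            exact_mod_cast hm)
      refine ⟨b, hb, ?_⟩
      have := add_mem hab (U.smul_mem c hyU)
      convert this using 1
      ring
  have hsurj : Function.Surjective (U.mkQ ∘ₗ (degreeLT ℂ N).subtype) := by
    intro z
    obtain ⟨a, rfl⟩ := U.mkQ_surjective z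
    obtain ⟨b, hb, hab⟩ := key (a.natDegree + 1) a
      (degree_le_natDegree.trans_lt (by exact_mod_cast (by omega)))
    refine ⟨⟨b, hb⟩, ?_⟩
    exact ((Submodule.Quotient.eq U).2 hab).symm
  exact Module.Finite.of_surjective _ hsurj

/-- Eigenpolynomials span invariant lines, hence belong to the maximal invariant space. -/
theorem finiteDimensional_maxInvariant {T : DiffOp} (hT : IsExceptional T) :
    FiniteDimensional ℂ (ℂ[X] ⧸ maxInvariant T) := by
  obtain ⟨N, hN⟩ := hT.2.bddAbove
  refine finiteDimensional_quotient_of_degree (N := N + 1) fun k hk => ?_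
  have h1 : HasEigenpolynomial T k := by
    by_contra h
    exact absurd (hN h) (by omega)
  obtain ⟨y, lam, hy, he⟩ := h1
  refine ⟨y, ?_, hy⟩
  have hinv : IsInvariant T (Submodule.span ℂ {y}) := by
    intro z hz
    obtain ⟨c, rfl⟩ := Submodule.mem_span_singleton.1 hz
    refine ⟨lam • (c • y), Submodule.smul_mem _ _ hz, ?_⟩
    have hs := iotaL.map_smul
    simp only [iotaL_apply] at hs
    rw [hs, hs, hs, act_smul, he, smul_comm]
  exact (isGreatest_maxInvariant T).2 hinv (Submodule.mem_span_singleton_self y)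

/-! ### Gaps of order sequences -/

/-- The natural numbers that are not the order of vanishing at `ζ` of an element of `U`. -/
def gapSet (U : Submodule ℂ ℂ[X]) (ζ : ℂ) : Set ℕ :=
  {k | ¬ ∃ y ∈ U, y ≠ 0 ∧ y.rootMultiplicity ζ = k}

theorem pow_mul_eq_pow_mul {ζ : ℂ} {i j : ℕ} {a c : ℂ[X]} (ha : a.eval ζ ≠ 0)
    (hc : c.eval ζ ≠ 0) (h : (X - C ζ) ^ i * a = (X - C ζ) ^ j * c) : i = j ∧ a = c := by
  wlog hij : i ≤ j generalizing i j a c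
  · obtain ⟨h1, h2⟩ := this hc ha h.symm (by omega)
    exact ⟨h1.symm, h2.symm⟩
  obtain ⟨d, rfl⟩ := Nat.exists_eq_add_of_le hij
  rw [pow_add, mul_assoc] at h
  have h1 := mul_left_cancel₀ (pow_ne_zero i (X_sub_C_ne_zero ζ)) h
  rcases d with _ | d
  · exact ⟨rfl, by simpa using h1⟩
  · exact absurd (by simp [h1]) ha

theorem exists_eq_pow_mul {y : ℂ[X]} (hy : y ≠ 0) (ζ : ℂ) :
    ∃ y₁ : ℂ[X], y = (X - C ζ) ^ y.rootMultiplicity ζ * y₁ ∧ y₁.eval ζ ≠ 0 := by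
  obtain ⟨y₁, h, hnd⟩ := exists_eq_pow_rootMultiplicity_mul_and_not_dvd y hy ζ
  exact ⟨y₁, h, by rwa [dvd_iff_isRoot, IsRoot.def] at hnd⟩

theorem notMem_gapSet {U : Submodule ℂ ℂ[X]} {ζ : ℂ} {k : ℕ} :
    k ∉ gapSet U ζ ↔ ∃ y₁ : ℂ[X], y₁.eval ζ ≠ 0 ∧ (X - C ζ) ^ k * y₁ ∈ U := by
  rw [gapSet, Set.mem_ofPred_eq, not_not]
  constructor
  · rintro ⟨y, hy, hy0, rfl⟩
    obtain ⟨y₁, h, h1⟩ := exists_eq_pow_mul hy0 ζ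
    exact ⟨y₁, h1, by rwa [← h]⟩
  · rintro ⟨y₁, h1, hy⟩
    have hy0 : (X - C ζ) ^ k * y₁ ≠ 0 :=
      mul_ne_zero (pow_ne_zero _ (X_sub_C_ne_zero ζ)) (ne_zero_of_eval h1)
    obtain ⟨y₂, h, h2⟩ := exists_eq_pow_mul hy0 ζ
    exact ⟨_, hy, hy0, (pow_mul_eq_pow_mul h1 h2 h).1.symm⟩

/-- The powers `(z - ζ)ᵏ`, `k` a gap, are linearly independent modulo `U`. -/
theorem finite_gapSet (U : Submodule ℂ ℂ[X]) [FiniteDimensional ℂ (ℂ[X] ⧸ U)] (ζ : ℂ) :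
    (gapSet U ζ).Finite := by
  have hli : LinearIndependent ℂ fun g : gapSet U ζ => U.mkQ ((X - C ζ) ^ (g : ℕ)) := by
    rw [linearIndependent_iff']
    intro s c hsum
    by_contra! hne
    have hne' : (s.filter fun i => c i ≠ 0).Nonempty := by
      obtain ⟨i, hi, hci⟩ := hne
      exact ⟨i, Finset.mem_filter.2 ⟨hi, hci⟩⟩
    obtain ⟨i₀, hi₀, hmin⟩ := Finset.exists_min_image _ (fun i : gapSet U ζ => (i : ℕ)) hne'
    rw [Finset.mem_filter] at hi₀
    -- the element of lowest order would have an order in the gap set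
    set y₁ : ℂ[X] := ∑ i ∈ s.filter (fun i => c i ≠ 0),
      C (c i) * (X - C ζ) ^ ((i : ℕ) - (i₀ : ℕ)) with hy₁
    have heq : (X - C ζ) ^ (i₀ : ℕ) * y₁ = ∑ i ∈ s, c i • (X - C ζ) ^ (i : ℕ) := by
      rw [hy₁, Finset.mul_sum, Finset.sum_filter]
      refine Finset.sum_congr rfl fun i hi => ?_
      by_cases hci : c i = 0
      · simp [hci]
      · rw [if_pos hci, mul_left_comm, ← pow_add, smul_eq_C_mul,
          Nat.add_sub_cancel' (hmin i (Finset.mem_filter.2 ⟨hi, hci⟩))]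
    have hev : y₁.eval ζ ≠ 0 := by
      rw [hy₁, eval_finsetSum, Finset.sum_eq_single i₀]
      · simpa using hi₀.2
      · intro i hi hii
        have h1 := hmin i hi
        have h2 : (i : ℕ) ≠ i₀ := fun h => hii (Subtype.ext h)
        have h3 : (i : ℕ) - i₀ ≠ 0 := by omega
        simp [h3]
      · intro h
        exact absurd (Finset.mem_filter.2 hi₀) h
    refine (notMem_gapSet (U := U) (ζ := ζ)).2 ⟨y₁, hev, ?_⟩ i₀.2
    rw [heq, ← Submodule.Quotient.mk_eq_zero, ← Submodule.mkQ_apply, map_sum]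
    simpa using hsum
  exact Set.finite_coe_iff.1 hli.finite

/-- If `W` contains all multiples of `(z - ζ)ᵐ`, then `(z - ζ)ᵏ`, `k` a gap of `W`, span the
quotient by `W`. -/
theorem finrank_quotient_le_ncard {W : Submodule ℂ ℂ[X]} {ζ : ℂ} {m : ℕ} {G : Set ℕ}
    (hm : ∀ a, (X - C ζ) ^ m ∣ a → a ∈ W) (hG : G.Finite) (hWG : gapSet W ζ ⊆ G) :
    Module.finrank ℂ (ℂ[X] ⧸ W) ≤ G.ncard := by
  classical
  set S : Finset ℂ[X] := hG.toFinset.image fun g => (X - C ζ) ^ g with hS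
  set V := W ⊔ Submodule.span ℂ (S : Set ℂ[X]) with hV
  have key : ∀ d ≤ m, ∀ a, (X - C ζ) ^ (m - d) ∣ a → a ∈ V := by
    intro d
    induction d with
    | zero => exact fun _ a ha => Submodule.mem_sup_left (hm a ha)
    | succ d ih =>
      rintro hd a ⟨a₁, rfl⟩
      set k := m - (d + 1)
      have hk : m - d = k + 1 := by omega
      have hred : ∀ y₁ : ℂ[X], y₁.eval ζ ≠ 0 → (X - C ζ) ^ k * y₁ ∈ V →
          (X - C ζ) ^ k * a₁ ∈ V := by
        intro y₁ hy₁ hV'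
        have h1 : (X - C ζ) ∣ a₁ - (a₁.eval ζ / y₁.eval ζ) • y₁ := by
          rw [dvd_iff_isRoot]
          simp [IsRoot.def, hy₁]
        have h2 := ih (by omega) ((X - C ζ) ^ k * (a₁ - (a₁.eval ζ / y₁.eval ζ) • y₁)) (by
          rw [hk, pow_succ]
          exact mul_dvd_mul_left _ h1)
        have h3 := V.add_mem h2 (V.smul_mem (a₁.eval ζ / y₁.eval ζ) hV')
        convert h3 using 1
        rw [mul_sub, mul_smul_comm, sub_add_cancel]
      by_cases hkG : k ∈ G
      · refine hred 1 (by simp) (Submodule.mem_sup_right (Submodule.subset_span ?_))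
        rw [mul_one, hS, Finset.coe_image]
        exact ⟨k, by simpa using hkG, rfl⟩
      · obtain ⟨y₁, h1, h2⟩ := notMem_gapSet.1 fun h => hkG (hWG h)
        exact hred y₁ h1 (Submodule.mem_sup_left h2)
  have htop : V = ⊤ := eq_top_iff.2 fun a _ => key m le_rfl a (by simp)
  have hspan : Submodule.span ℂ ((S.image W.mkQ : Finset _) : Set (ℂ[X] ⧸ W)) = ⊤ := by
    rw [Finset.coe_image, ← Submodule.map_span, ← Submodule.range_mkQ W, LinearMap.range_eq_map,
      ← htop, hV, Submodule.map_sup, W.mkQ_map_self, bot_sup_eq]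
  calc Module.finrank ℂ (ℂ[X] ⧸ W) = Module.finrank ℂ (⊤ : Submodule ℂ (ℂ[X] ⧸ W)) :=
        finrank_top ℂ _ |>.symm
    _ = Module.finrank ℂ (Submodule.span ℂ ((S.image W.mkQ : Finset _) : Set (ℂ[X] ⧸ W))) := by
        rw [hspan]
    _ ≤ (S.image W.mkQ).card := finrank_span_finset_le_card _
    _ ≤ S.card := Finset.card_image_le
    _ ≤ hG.toFinset.card := Finset.card_image_le
    _ = G.ncard := (Set.ncard_eq_toFinset_card G hG).symm

/-! ### Local form of a second-order operator at a point -/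

/-- At the point `ζ`, with `h = z - ζ`, the operator `p D² + q D + r` has the form
`(hᵇ B)⁻¹ hᵗ (h² P D² + h Q D + R)` with polynomials `P`, `Q`, `R`, `B`, where `B(ζ) ≠ 0` and
not all of `P`, `Q`, `R` vanish at `ζ`. It lowers orders of vanishing at `ζ` by `b - t`. -/
structure LocForm (p q r : RatFunc ℂ) (ζ : ℂ) (t b : ℕ) (P Q R B : ℂ[X]) : Prop where
  hB : B.eval ζ ≠ 0
  hne : ¬ (P.eval ζ = 0 ∧ Q.eval ζ = 0 ∧ R.eval ζ = 0)
  hp : ι ((X - C ζ) ^ b * B) * p = ι ((X - C ζ) ^ (t + 2) * P)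
  hq : ι ((X - C ζ) ^ b * B) * q = ι ((X - C ζ) ^ (t + 1) * Q)
  hr : ι ((X - C ζ) ^ b * B) * r = ι ((X - C ζ) ^ t * R)

/-- The exponent `t` is the largest one for which the required power of `z - ζ` can be extracted
from the numerators; the factor `(z - ζ)²` makes `t = 0` possible. -/
theorem exists_locForm {p : RatFunc ℂ} (hp : p ≠ 0) (q r : RatFunc ℂ) (ζ : ℂ) :
    ∃ t b P Q R B, LocForm p q r ζ t b P Q R B := by
  obtain ⟨A₂, A₁, A₀, B, hB, rfl, rfl, rfl⟩ := exists_common_denom p q r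
  have hB0 : ι B ≠ 0 := RatFunc.algebraMap_ne_zero hB.ne_zero
  have hA₂ : A₂ ≠ 0 := by
    rintro rfl
    simp at hp
  classical
  set h : ℂ[X] := X - C ζ with hh
  have hh0 : h ≠ 0 := X_sub_C_ne_zero ζ
  let Pr : ℕ → Prop := fun t => h ^ (t + 2) ∣ h ^ 2 * A₂ ∧ h ^ (t + 1) ∣ h ^ 2 * A₁ ∧
    h ^ t ∣ h ^ 2 * A₀
  have h0 : Pr 0 := ⟨by simp, (pow_dvd_pow h (by norm_num)).mul_right A₁, by simp⟩
  have hbd : ∀ t, Pr t → t ≤ A₂.rootMultiplicity ζ := by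
    intro t ht
    have h1 : h ^ t ∣ A₂ := by
      have := ht.1
      rw [pow_add, mul_comm (h ^ t)] at this
      exact (mul_dvd_mul_iff_left (pow_ne_zero 2 hh0)).1 this
    exact (le_rootMultiplicity_iff hA₂).2 h1
  set t := Nat.findGreatest Pr (A₂.rootMultiplicity ζ) with ht
  have hPt : Pr t := Nat.findGreatest_spec (hbd 0 h0) h0
  obtain ⟨⟨P, hP⟩, ⟨Q, hQ⟩, ⟨R, hR⟩⟩ := hPt
  obtain ⟨B₁, hB₁, hBev⟩ := exists_eq_pow_mul (mul_ne_zero (pow_ne_zero 2 hh0) hB.ne_zero) ζ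
  refine ⟨t, (h ^ 2 * B).rootMultiplicity ζ, P, Q, R, B₁, hBev, ?_, ?_, ?_, ?_⟩
  · rintro ⟨eP, eQ, eR⟩
    have hdvd : ∀ {A : ℂ[X]}, A.eval ζ = 0 → h ∣ A := fun {A} hA => by
      rwa [dvd_iff_isRoot]
    have hsucc : Pr (t + 1) := by
      refine ⟨?_, ?_, ?_⟩
      · rw [hP, show t + 1 + 2 = t + 2 + 1 by ring, pow_succ h (t + 2)]
        exact mul_dvd_mul_left _ (hdvd eP)
      · rw [hQ, pow_succ h (t + 1)]
        exact mul_dvd_mul_left _ (hdvd eQ)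
      · rw [hR, pow_succ h t]
        exact mul_dvd_mul_left _ (hdvd eR)
    exact absurd (Nat.le_findGreatest (hbd _ hsucc) hsucc) (by omega)
  · rw [← hB₁, ← hP, map_mul, map_mul]
    field_simp
  · rw [← hB₁, ← hQ, map_mul, map_mul]
    field_simp
  · rw [← hB₁, ← hR, map_mul, map_mul]
    field_simp

/-- The indicial polynomial `s (s - 1) P + s Q + R`, with coefficients in `ℂ[z]`. -/
def indP (P Q R : ℂ[X]) (s : ℕ) : ℂ[X] :=
  C ((s : ℂ) * (s - 1)) * P + C (s : ℂ) * Q + R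

theorem mul_rD_X_sub_C_pow (ζ : ℂ) (s : ℕ) :
    ι (X - C ζ) * rD (ι (X - C ζ) ^ s) = RatFunc.C (s : ℂ) * ι (X - C ζ) ^ s ∧
    ι (X - C ζ) ^ 2 * rD (rD (ι (X - C ζ) ^ s)) =
      RatFunc.C ((s : ℂ) * (s - 1)) * ι (X - C ζ) ^ s := by
  have hH : rD (ι (X - C ζ)) = 1 := by rw [rD_algebraMap]; simp
  have h1 : ι (X - C ζ) * rD (ι (X - C ζ) ^ s) = RatFunc.C (s : ℂ) * ι (X - C ζ) ^ s := by
    induction s with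
    | zero => simp [rD_one]
    | succ s ih =>
      rw [pow_succ, rD_mul, hH, mul_add, ← mul_assoc, ih]
      push_cast
      simp only [map_add, map_one]
      ring
  refine ⟨h1, ?_⟩
  have h2 := congrArg rD h1
  have hC : ∀ f, rD (RatFunc.C (s : ℂ) * f) = RatFunc.C (s : ℂ) * rD f := fun f => by
    rw [← RatFunc.smul_eq_C_mul, map_smul, RatFunc.smul_eq_C_mul]
  rw [rD_mul, hH, hC] at h2
  rw [map_mul RatFunc.C, map_sub RatFunc.C, map_one RatFunc.C]
  linear_combination ι (X - C ζ) * h2 + (RatFunc.C (s : ℂ) - 1) * h1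

/-- On functions of order `s` the operator acts, to leading order, through the indicial
polynomial. -/
theorem LocForm.op2_pow_mul {p q r : RatFunc ℂ} {ζ : ℂ} {t b : ℕ} {P Q R B : ℂ[X]}
    (hl : LocForm p q r ζ t b P Q R B) (s : ℕ) (f : RatFunc ℂ) :
    ι ((X - C ζ) ^ b * B) * op2 p q r (ι (X - C ζ) ^ s * f) = ι (X - C ζ) ^ (t + s) *
      (ι (indP P Q R s) * f + ι (X - C ζ) * (ι (2 * C (s : ℂ) * P + Q) * rD f) +
        ι (X - C ζ) ^ 2 * (ι P * rD (rD f))) := by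
  obtain ⟨h1, h2⟩ := mul_rD_X_sub_C_pow ζ s
  have e1 := hl.hp
  have e2 := hl.hq
  have e3 := hl.hr
  rw [map_mul ι ((X - C ζ) ^ (t + 2)), map_pow] at e1
  rw [map_mul ι ((X - C ζ) ^ (t + 1)), map_pow] at e2
  rw [map_mul ι ((X - C ζ) ^ t), map_pow] at e3
  rw [op2_apply, rD_mul, map_add, rD_mul, rD_mul, indP]
  simp only [map_add, map_mul, map_ofNat, RatFunc.algebraMap_C] at h1 h2 ⊢
  simp only [map_mul] at e1 e2 e3
  set H := ι (X - C ζ)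
  linear_combination (rD (rD (H ^ s)) * f + rD (H ^ s) * rD f + (rD (H ^ s) * rD f +
    H ^ s * rD (rD f))) * e1 + (rD (H ^ s) * f + H ^ s * rD f) * e2 + H ^ s * f * e3 +
    H ^ t * ι P * f * h2 + (2 * H ^ (t + 1) * ι P * rD f + H ^ t * ι Q * f) * h1

/-- If `ζ` occurs with order `k` in `U` and the indicial polynomial does not vanish at `k`, then
`k - (b - t)` is an order, too. -/
theorem LocForm.order_step {T : DiffOp} (hT : HasOrder T 2) {ζ : ℂ} {t b : ℕ} {P Q R B : ℂ[X]}
    (hl : LocForm (T 2) (T 1) (T 0) ζ t b P Q R B) {k : ℕ} (hk : k ∉ gapSet (maxInvariant T) ζ)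
    (hind : (indP P Q R k).eval ζ ≠ 0) : ∃ j, b + j = t + k ∧ j ∉ gapSet (maxInvariant T) ζ := by
  obtain ⟨y₁, hy₁, hy⟩ := notMem_gapSet.1 hk
  obtain ⟨w, hw, he⟩ := (isGreatest_maxInvariant T).1 _ hy
  rw [act_eq_op2 hT, map_mul, map_pow] at he
  have h1 := hl.op2_pow_mul k (ι y₁)
  rw [he, rD_algebraMap, rD_algebraMap] at h1
  simp only [← map_mul, ← map_pow, ← map_add] at h1
  have h2 := RatFunc.algebraMap_injective ℂ h1
  set Y := indP P Q R k * y₁ + (X - C ζ) * ((2 * C (k : ℂ) * P + Q) * derivative y₁) +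
    (X - C ζ) ^ 2 * (P * derivative (derivative y₁)) with hY
  have hY0 : Y.eval ζ ≠ 0 := by simp [hY, hind, hy₁]
  have hw0 : w ≠ 0 := by
    rintro rfl
    rw [mul_zero] at h2
    exact mul_ne_zero (pow_ne_zero _ (X_sub_C_ne_zero ζ)) (ne_zero_of_eval hY0) h2.symm
  obtain ⟨w₁, hw₁, hw₁'⟩ := exists_eq_pow_mul hw0 ζ
  refine ⟨w.rootMultiplicity ζ, ?_, notMem_gapSet.2 ⟨w₁, hw₁', by rwa [← hw₁]⟩⟩
  refine (pow_mul_eq_pow_mul (a := B * w₁) (by simp [hl.hB, hw₁']) hY0 ?_).1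
  rw [← h2]
  conv_rhs => rw [hw₁]
  ring

/-- If the operator lowers orders by `e > 0`, the smallest order in a residue class modulo `e` is a
root of the indicial polynomial. -/
theorem LocForm.exists_root {T : DiffOp} (hT : HasOrder T 2) {ζ : ℂ} {t b : ℕ} {P Q R B : ℂ[X]}
    (hl : LocForm (T 2) (T 1) (T 0) ζ t b P Q R B) (hfin : (gapSet (maxInvariant T) ζ).Finite)
    {e : ℕ} (he : b = t + e) {j : ℕ} (hj : j < e) :
    ∃ s, s % e = j ∧ s ∉ gapSet (maxInvariant T) ζ ∧ (indP P Q R s).eval ζ = 0 ∧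
      ∀ s' ∉ gapSet (maxInvariant T) ζ, s' % e = j → s ≤ s' := by
  classical
  have hex : ∃ s, s % e = j ∧ s ∉ gapSet (maxInvariant T) ζ := by
    obtain ⟨N, hN⟩ := hfin.bddAbove
    refine ⟨j + e * (N + 1), by rw [Nat.add_mul_mod_self_left, Nat.mod_eq_of_lt hj], fun h => ?_⟩
    have h1 := hN h
    have h2 : N + 1 ≤ e * (N + 1) := Nat.le_mul_of_pos_left _ (by omega)
    omega
  refine ⟨Nat.find hex, (Nat.find_spec hex).1, (Nat.find_spec hex).2, ?_,
    fun s' h1 h2 => Nat.find_min' hex ⟨h2, h1⟩⟩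
  by_contra hind
  obtain ⟨i, hi, hi'⟩ := hl.order_step hT (Nat.find_spec hex).2 hind
  have h1 : Nat.find hex = i + e := by omega
  have h2 := (Nat.find_spec hex).1
  rw [h1, Nat.add_mod_right] at h2
  have := Nat.find_min' hex ⟨h2, hi'⟩
  omega

theorem indP_eval (P Q R : ℂ[X]) (s : ℕ) (ζ : ℂ) :
    (indP P Q R s).eval ζ = (s : ℂ) * (s - 1) * P.eval ζ + s * Q.eval ζ + R.eval ζ := by
  simp [indP]

theorem indP_two_roots {P Q R : ℂ[X]} {ζ : ℂ} {s s' : ℕ} (hs : s ≠ s')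
    (h : (indP P Q R s).eval ζ = 0) (h' : (indP P Q R s').eval ζ = 0) :
    Q.eval ζ = (1 - s - s') * P.eval ζ := by
  rw [indP_eval] at h h'
  have hne : (s : ℂ) - s' ≠ 0 := by
    rw [sub_ne_zero]
    exact_mod_cast hs
  apply mul_left_cancel₀ hne
  linear_combination h - h'

theorem LocForm.eval_P_ne_zero {p q r : RatFunc ℂ} {ζ : ℂ} {t b : ℕ} {P Q R B : ℂ[X]}
    (hl : LocForm p q r ζ t b P Q R B) {s s' : ℕ} (hs : s ≠ s')
    (h : (indP P Q R s).eval ζ = 0) (h' : (indP P Q R s').eval ζ = 0) : P.eval ζ ≠ 0 := by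
  intro hP
  have hQ := indP_two_roots hs h h'
  rw [hP, mul_zero] at hQ
  rw [indP_eval, hP, hQ] at h
  exact hl.hne ⟨hP, hQ, by simpa using h⟩

/-- A class of orders modulo `b - t` has a smallest element, at which the indicial polynomial
vanishes; so there are at most two classes. -/
theorem LocForm.le_add_two {T : DiffOp} (hT : HasOrder T 2) {ζ : ℂ} {t b : ℕ} {P Q R B : ℂ[X]}
    (hl : LocForm (T 2) (T 1) (T 0) ζ t b P Q R B)
    (hfin : (gapSet (maxInvariant T) ζ).Finite) : b ≤ t + 2 := by
  by_contra hcon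
  obtain ⟨e, rfl⟩ : ∃ e, b = t + e := ⟨b - t, by omega⟩
  obtain ⟨s₀, h0, -, z0, -⟩ := hl.exists_root hT hfin rfl (j := 0) (by omega)
  obtain ⟨s₁, h1, -, z1, -⟩ := hl.exists_root hT hfin rfl (j := 1) (by omega)
  obtain ⟨s₂, h2, -, z2, -⟩ := hl.exists_root hT hfin rfl (j := 2) (by omega)
  have n01 : s₀ ≠ s₁ := by rintro rfl; omega
  have n02 : s₀ ≠ s₂ := by rintro rfl; omega
  have n12 : s₁ ≠ s₂ := by rintro rfl; omega
  have hP := hl.eval_P_ne_zero n01 z0 z1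
  have e1 := indP_two_roots n01 z0 z1
  have e2 := indP_two_roots n02 z0 z2
  rw [e1] at e2
  have := mul_right_cancel₀ hP e2
  exact n12 (by exact_mod_cast (show (s₁ : ℂ) = s₂ by linear_combination -this))

/-- If the operator lowers orders by two, the smallest even order `s₀` and the smallest odd order
`s₁` are the indicial roots. All orders above them occur, so the number of gaps is
`⌊s₀/2⌋ + ⌊s₁/2⌋`, while `s₀ + s₁` is read off from `P(ζ)` and `Q(ζ)`. -/
theorem LocForm.of_eq_add_two {T : DiffOp} (hT : HasOrder T 2) {ζ : ℂ} {t : ℕ}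
    {P Q R B : ℂ[X]} (hl : LocForm (T 2) (T 1) (T 0) ζ t (t + 2) P Q R B)
    (hfin : (gapSet (maxInvariant T) ζ).Finite) :
    P.eval ζ ≠ 0 ∧
      Q.eval ζ = -2 * ((gapSet (maxInvariant T) ζ).ncard : ℂ) * P.eval ζ := by
  obtain ⟨s₀, h0, i0, z0, m0⟩ := hl.exists_root hT hfin rfl (j := 0) (by omega)
  obtain ⟨s₁, h1, i1, z1, m1⟩ := hl.exists_root hT hfin rfl (j := 1) (by omega)
  have n01 : s₀ ≠ s₁ := by rintro rfl; omega
  have hP := hl.eval_P_ne_zero n01 z0 z1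
  have hQ := indP_two_roots n01 z0 z1
  refine ⟨hP, ?_⟩
  have hroots : ∀ s, (indP P Q R s).eval ζ = 0 → s = s₀ ∨ s = s₁ := by
    intro s hs
    by_contra! hne
    have e2 := indP_two_roots hne.1 hs z0
    rw [hQ] at e2
    have := mul_right_cancel₀ hP e2
    exact hne.2 (by exact_mod_cast (show (s : ℂ) = s₁ by linear_combination this))
  have hdown : ∀ d s, s₀ ≤ s ∧ s % 2 = 0 ∨ s₁ ≤ s ∧ s % 2 = 1 →
      s + 2 * d ∉ gapSet (maxInvariant T) ζ → s ∉ gapSet (maxInvariant T) ζ := by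
    intro d
    induction d with
    | zero => exact fun s _ h => h
    | succ d ih =>
      intro s hs h
      refine ih s hs ?_
      obtain ⟨j, hj, hj'⟩ := hl.order_step hT h fun hz => by
        rcases hroots _ hz with hz | hz <;> omega
      have : j = s + 2 * d := by omega
      rwa [← this]
  obtain ⟨N, hN⟩ := hfin.bddAbove
  have hgap : gapSet (maxInvariant T) ζ =
      ((Finset.range (s₀ / 2)).image (2 * ·) ∪ (Finset.range (s₁ / 2)).image (2 * · + 1) :
        Finset ℕ) := by
    ext k
    simp only [Finset.coe_union, Finset.coe_image, Finset.coe_range, Set.mem_union, Set.mem_image,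
      Set.mem_Iio]
    constructor
    · intro hk
      by_contra hcon
      push Not at hcon
      refine hdown (N + 1) k ?_ (fun h => ?_) hk
      · rcases Nat.mod_two_eq_zero_or_one k with hk2 | hk2
        · left
          refine ⟨?_, hk2⟩
          by_contra hlt
          exact hcon.1 (k / 2) (by omega) (by omega)
        · right
          refine ⟨?_, hk2⟩
          by_contra hlt
          exact hcon.2 (k / 2) (by omega) (by omega)
      · have := hN h
        omega
    · rintro (⟨i, hi, rfl⟩ | ⟨i, hi, rfl⟩)
      · by_contra hk
        have := m0 _ hk (by omega)
        omega
      · by_contra hk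
        have := m1 _ hk (by omega)
        omega
  have hcard : (gapSet (maxInvariant T) ζ).ncard = s₀ / 2 + s₁ / 2 := by
    rw [hgap, Set.ncard_coe_finset, Finset.card_union_of_disjoint, Finset.card_image_of_injective,
      Finset.card_image_of_injective, Finset.card_range, Finset.card_range]
    · intro a b h
      simpa using h
    · intro a b h
      simpa using h
    · rw [Finset.disjoint_left]
      simp only [Finset.mem_image, not_exists, not_and]
      rintro _ ⟨i, -, rfl⟩ j - h
      omega
  rw [hQ, hcard]
  have hs : s₀ + s₁ = 2 * (s₀ / 2 + s₁ / 2) + 1 := by omega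
  have hs' : (s₀ : ℂ) + s₁ = 2 * ((s₀ / 2 + s₁ / 2 : ℕ) : ℂ) + 1 := by exact_mod_cast hs
  linear_combination -P.eval ζ * hs'

/-! ### Poles, leading coefficient and invariant space of an exceptional operator -/

theorem exists_eq_X_sub_C_mul {a : ℂ[X]} {ζ : ℂ} (h : a.eval ζ = 0) :
    ∃ c, a = (X - C ζ) * c := dvd_iff_isRoot.2 h

theorem mul_eq_of_pow_mul_eq {ζ : ℂ} {f g : RatFunc ℂ} {B : ℂ[X]} {b s : ℕ} (hbs : b ≤ s)
    (h : ι ((X - C ζ) ^ b * B) * f = ι (X - C ζ) ^ s * g) :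
    ι B * f = ι (X - C ζ) ^ (s - b) * g := by
  have hX : ι (X - C ζ) ^ b ≠ 0 := pow_ne_zero _ (RatFunc.algebraMap_ne_zero (X_sub_C_ne_zero ζ))
  apply mul_left_cancel₀ hX
  rw [← mul_assoc, ← mul_assoc, ← pow_add, Nat.add_sub_cancel' hbs, ← h, map_mul, map_pow]

theorem algebraMap_mul_mem_regAt {ζ : ℂ} {f : RatFunc ℂ} (a : ℂ[X]) (hf : f ∈ regAt ζ) :
    ι a * f ∈ regAt ζ := mul_mem (algebraMap_mem_regAt ζ a) hf

theorem pow_mul_mem_regAt {ζ : ℂ} {f : RatFunc ℂ} (a : ℂ[X]) (n : ℕ) (hf : f ∈ regAt ζ) :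
    ι a ^ n * f ∈ regAt ζ := by
  rw [← map_pow]
  exact algebraMap_mul_mem_regAt _ hf

theorem exists_eq_mul_of_algebraMap_mul_eq {ζ : ℂ} {f g F : RatFunc ℂ} {B : ℂ[X]}
    (hB : B.eval ζ ≠ 0) (hF : F ∈ regAt ζ) (h : ι B * f = g * F) :
    ∃ G ∈ regAt ζ, f = g * G := by
  have hB' := algebraMap_ne_zero_of_eval hB
  exact ⟨F / ι B, div_mem_regAt hF hB, by rw [← mul_div_assoc, ← h, mul_div_cancel_left₀ _ hB']⟩

section LocForm

variable {p q r : RatFunc ℂ} {ζ : ℂ} {t b : ℕ} {P Q R B : ℂ[X]}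

theorem LocForm.eq₂ (hl : LocForm p q r ζ t b P Q R B) (hb : b ≤ t + 2) :
    ι B * p = ι (X - C ζ) ^ (t + 2 - b) * ι P :=
  mul_eq_of_pow_mul_eq hb (by rw [hl.hp, map_mul, map_pow])

theorem LocForm.mem₂ (hl : LocForm p q r ζ t b P Q R B) (hb : b ≤ t + 2) : p ∈ regAt ζ := by
  refine mem_regAt_of_mul hl.hB ?_
  rw [hl.eq₂ hb]
  exact mul_mem (pow_mem (algebraMap_mem_regAt _ _) _) (algebraMap_mem_regAt _ _)

theorem LocForm.mem₁ (hl : LocForm p q r ζ t b P Q R B) (hb : b ≤ t + 1) : q ∈ regAt ζ := by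
  refine mem_regAt_of_mul hl.hB ?_
  rw [mul_eq_of_pow_mul_eq hb (g := ι Q) (by rw [hl.hq, map_mul, map_pow])]
  exact mul_mem (pow_mem (algebraMap_mem_regAt _ _) _) (algebraMap_mem_regAt _ _)

theorem LocForm.mem₀ (hl : LocForm p q r ζ t b P Q R B) (hb : b ≤ t) : r ∈ regAt ζ := by
  refine mem_regAt_of_mul hl.hB ?_
  rw [mul_eq_of_pow_mul_eq hb (g := ι R) (by rw [hl.hr, map_mul, map_pow])]
  exact mul_mem (pow_mem (algebraMap_mem_regAt _ _) _) (algebraMap_mem_regAt _ _)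

theorem LocForm.exists_mul_op2_eq (hl : LocForm p q r ζ t b P Q R B) (s : ℕ)
    {f : RatFunc ℂ} (hf : f ∈ regAt ζ) :
    ∃ F ∈ regAt ζ, ι ((X - C ζ) ^ b * B) * op2 p q r (ι (X - C ζ) ^ s * f) =
      ι (X - C ζ) ^ (t + s) * F := by
  have hf1 := rD_mem_regAt hf
  exact ⟨_, add_mem (add_mem (algebraMap_mul_mem_regAt (indP P Q R s) hf)
    (algebraMap_mul_mem_regAt (X - C ζ) (algebraMap_mul_mem_regAt
      (2 * C (s : ℂ) * P + Q) hf1)))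
    (pow_mul_mem_regAt (X - C ζ) 2 (algebraMap_mul_mem_regAt P (rD_mem_regAt hf1))),
    hl.op2_pow_mul s f⟩

theorem LocForm.exists_lower (hl : LocForm p q r ζ t b P Q R B) (hb : b ≤ t + 2) (n : ℕ)
    {f : RatFunc ℂ} (hf : f ∈ regAt ζ) :
    ∃ g ∈ regAt ζ, op2 p q r (ι (X - C ζ) ^ (n + 2) * f) = ι (X - C ζ) ^ n * g := by
  obtain ⟨s, hs⟩ : ∃ s, s = n + 2 := ⟨_, rfl⟩
  rw [← hs]
  obtain ⟨F, hF, h⟩ := hl.exists_mul_op2_eq s hf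
  have h' := mul_eq_of_pow_mul_eq (show b ≤ t + s by omega) h
  rw [show t + s - b = n + (t + 2 - b) by omega, pow_add, mul_assoc] at h'
  have hG := pow_mul_mem_regAt (X - C ζ) (t + 2 - b) hF
  exact exists_eq_mul_of_algebraMap_mul_eq hl.hB hG h'

/-- An operator lowering orders by at most one preserves functions of order at least `s` if `s` is
a root of the indicial polynomial. -/
theorem LocForm.exists_preserve (hl : LocForm p q r ζ t (t + 1) P Q R B) {s : ℕ}
    (hs : (indP P Q R s).eval ζ = 0) {f : RatFunc ℂ} (hf : f ∈ regAt ζ) :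
    ∃ g ∈ regAt ζ, op2 p q r (ι (X - C ζ) ^ s * f) = ι (X - C ζ) ^ s * g := by
  obtain ⟨c, hc⟩ := exists_eq_X_sub_C_mul hs
  have hf1 := rD_mem_regAt hf
  have hF := add_mem (add_mem (algebraMap_mul_mem_regAt c hf)
    (algebraMap_mul_mem_regAt (2 * C (s : ℂ) * P + Q) hf1))
    (algebraMap_mul_mem_regAt (X - C ζ) (algebraMap_mul_mem_regAt P (rD_mem_regAt hf1)))
  have h := hl.op2_pow_mul s f
  rw [hc] at h
  have h' : ι ((X - C ζ) ^ (t + 1) * B) * op2 p q r (ι (X - C ζ) ^ s * f) =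
      ι (X - C ζ) ^ (t + 1 + s) * (ι c * f + ι (2 * C (s : ℂ) * P + Q) * rD f +
        ι (X - C ζ) * (ι P * rD (rD f))) := by
    rw [h, map_mul ι (X - C ζ) c]
    ring
  have h2 := mul_eq_of_pow_mul_eq (by omega) h'
  rw [Nat.add_sub_cancel_left] at h2
  exact exists_eq_mul_of_algebraMap_mul_eq hl.hB hF h2

end LocForm

theorem op2_mem_regAt {p q r y : RatFunc ℂ} {ζ : ℂ} (hp : p ∈ regAt ζ) (hq : q ∈ regAt ζ)
    (hr : r ∈ regAt ζ) (hy : y ∈ regAt ζ) : op2 p q r y ∈ regAt ζ := by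
  have hy1 := rD_mem_regAt hy
  rw [op2_apply]
  exact add_mem (add_mem (mul_mem hp (rD_mem_regAt hy1)) (mul_mem hq hy1)) (mul_mem hr hy)

theorem notMem_primaryPoles {T : DiffOp} {ζ : ℂ} :
    ζ ∉ primaryPoles T ↔ T 1 ∈ regAt ζ ∧ T 0 ∈ regAt ζ := by
  rw [mem_primaryPoles, not_or, not_isPole_iff, not_isPole_iff]

theorem IsExceptional.finite_gapSet {T : DiffOp} (hT : IsExceptional T) (ζ : ℂ) :
    (gapSet (maxInvariant T) ζ).Finite :=
  haveI := finiteDimensional_maxInvariant hT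
  ExcOp.finite_gapSet _ ζ

theorem IsExceptional.exists_locForm {T : DiffOp} (hT : IsExceptional T) (ζ : ℂ) :
    ∃ t b P Q R B, LocForm (T 2) (T 1) (T 0) ζ t b P Q R B ∧ b ≤ t + 2 := by
  obtain ⟨t, b, P, Q, R, B, hl⟩ := ExcOp.exists_locForm hT.1.1 (T 1) (T 0) ζ
  exact ⟨t, b, P, Q, R, B, hl, hl.le_add_two hT.1 (hT.finite_gapSet ζ)⟩

theorem IsExceptional.exists_lower {T : DiffOp} (hT : IsExceptional T) (ζ : ℂ) (n k : ℕ)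
    {f : RatFunc ℂ} (hf : f ∈ regAt ζ) :
    ∃ g ∈ regAt ζ, (opOf T ^ k) (ι (X - C ζ) ^ (n + 2 * k) * f) = ι (X - C ζ) ^ n * g := by
  obtain ⟨t, b, P, Q, R, B, hl, hb⟩ := hT.exists_locForm ζ
  induction k generalizing n with
  | zero => exact ⟨f, hf, rfl⟩
  | succ k ih =>
    obtain ⟨g, hg, he⟩ := ih (n + 2)
    obtain ⟨g', hg', he'⟩ := hl.exists_lower hb n hg
    refine ⟨g', hg', ?_⟩
    rw [pow_succ', Module.End.mul_apply, show n + 2 * (k + 1) = n + 2 + 2 * k by ring, he]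
    exact he'

/-- The leading coefficient is regular everywhere, because `T` lowers orders of vanishing by at most
two. -/
theorem IsExceptional.exists_polynomial {T : DiffOp} (hT : IsExceptional T) :
    ∃ p : ℂ[X], p.natDegree ≤ 2 ∧ T 2 = ι p := by
  obtain ⟨p, hp⟩ := exists_polynomial_of_forall_mem_regAt (f := T 2) fun ζ => by
    obtain ⟨t, b, P, Q, R, B, hl, hb⟩ := hT.exists_locForm ζ
    exact hl.mem₂ hb
  obtain ⟨p₂, q₁, h2, -⟩ := exists_asy_of_isExceptional hT
  have := h2.degLE
  rw [hp] at this
  exact ⟨p, degLE_algebraMap.1 this, hp⟩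

/-- At a point where the leading coefficient does not vanish, `q` has at most a simple pole, with
residue `-2 ν p(ζ)`. -/
theorem IsExceptional.mem_regAt_of_ne_zero {T : DiffOp} (hT : IsExceptional T) {p : ℂ[X]}
    (hp : T 2 = ι p) {ζ : ℂ} (hpζ : p.eval ζ ≠ 0) :
    T 1 + 2 * ι p * (ι (C (gapCard T ζ : ℂ)) / ι (X - C ζ)) ∈ regAt ζ := by
  obtain ⟨t, b, P, Q, R, B, hl, hb⟩ := hT.exists_locForm ζ
  have hbt : b = t + 2 := by
    by_contra hne
    have h := hl.eq₂ hb
    rw [hp, ← map_pow, ← map_mul, ← map_mul] at h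
    have h1 := congrArg (eval ζ) (RatFunc.algebraMap_injective ℂ h)
    have h2 : t + 2 - b ≠ 0 := by omega
    simp only [eval_mul, eval_pow, eval_sub, eval_X, eval_C, sub_self, zero_pow h2, zero_mul,
      mul_eq_zero] at h1
    exact h1.elim hl.hB hpζ
  subst hbt
  obtain ⟨hP, hQ⟩ := hl.of_eq_add_two hT.1 (hT.finite_gapSet ζ)
  have h2 : B * p = P := by
    have h := hl.eq₂ le_rfl
    rw [hp, Nat.sub_self, pow_zero, one_mul, ← map_mul] at h
    exact RatFunc.algebraMap_injective ℂ h
  obtain ⟨c, hc⟩ := exists_eq_X_sub_C_mul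
    (show (Q + 2 * C (gapCard T ζ : ℂ) * P).eval ζ = 0 by
      simp only [eval_add, eval_mul, hQ, eval_C, eval_ofNat]
      change -2 * (gapCard T ζ : ℂ) * _ + _ = _
      ring)
  have hX := RatFunc.algebraMap_ne_zero (X_sub_C_ne_zero ζ)
  have h1 : ι (X - C ζ) * ι B * T 1 = ι Q := by
    have := hl.hq
    apply mul_left_cancel₀ (pow_ne_zero (t + 1) hX)
    rw [map_mul, map_mul, map_pow, map_pow] at this
    linear_combination this
  refine mem_regAt_of_mul hl.hB ?_
  have : ι B * (T 1 + 2 * ι p * (ι (C (gapCard T ζ : ℂ)) / ι (X - C ζ))) = ι c := by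
    have hc' := congrArg ι hc
    rw [← h2] at hc'
    simp only [map_add, map_mul, map_ofNat] at hc'
    apply mul_left_cancel₀ hX
    rw [← hc', ← h1]
    field_simp
  rw [this]
  exact algebraMap_mem_regAt _ _

/-- At a primary pole where the leading coefficient vanishes, the operator has a simple pole only,
and the invariant space has no gaps beyond its minimal order, which is a root of the indicial
polynomial. So it consists of functions of order at least `ν`, and `T` preserves this condition. -/
theorem IsExceptional.preserve_of_eq_zero {T : DiffOp} (hT : IsExceptional T) {p : ℂ[X]}
    (hp : T 2 = ι p) {ζ : ℂ} (hpζ : p.eval ζ = 0) (hζ : ζ ∈ primaryPoles T) :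
    T 1 ∈ regAt ζ ∧ (∀ y ∈ maxInvariant T, (X - C ζ) ^ gapCard T ζ ∣ y) ∧
      ∀ f ∈ regAt ζ, ∃ g ∈ regAt ζ,
        opOf T (ι (X - C ζ) ^ gapCard T ζ * f) = ι (X - C ζ) ^ gapCard T ζ * g := by
  classical
  obtain ⟨t, b, P, Q, R, B, hl, hb⟩ := hT.exists_locForm ζ
  have hfin := hT.finite_gapSet ζ
  have hb1 : b ≤ t + 1 := by
    by_contra hne
    obtain rfl : b = t + 2 := by omega
    have h := hl.eq₂ le_rfl
    rw [hp, Nat.sub_self, pow_zero, one_mul, ← map_mul] at h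
    refine (hl.of_eq_add_two hT.1 hfin).1 ?_
    rw [← RatFunc.algebraMap_injective ℂ h, eval_mul, hpζ, mul_zero]
  have hb2 : b = t + 1 := by
    by_contra hne
    exact notMem_primaryPoles.2 ⟨hl.mem₁ hb1, hl.mem₀ (by omega)⟩ hζ
  subst hb2
  obtain ⟨s, -, hs, hroot, hmin⟩ := hl.exists_root hT.1 hfin rfl (j := 0) one_pos
  have hpres := fun f hf => hl.exists_preserve hroot (f := f) hf
  have hU := maxInvariant_eq hT.1
  obtain ⟨J, hJ⟩ := exists_stableIn_bound (opOf T) (LinearMap.range iotaL)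
    (hU ▸ finiteDimensional_maxInvariant hT)
  rw [← hU] at hJ
  have hgap : gapSet (maxInvariant T) ζ = (Finset.range s : Finset ℕ) := by
    ext k
    rw [Finset.coe_range, Set.mem_Iio]
    constructor
    · contrapose!
      intro hk
      obtain ⟨d, rfl⟩ := Nat.exists_eq_add_of_le hk
      -- high orders at the other primary poles keep the iterates regular there
      refine notMem_gapSet.2 ⟨∏ z ∈ (primaryPoles T).erase ζ, (X - C z) ^ (2 * J), ?_, hJ _ ?_⟩
      · exact eval_etaProd_ne_zero (ν := fun _ => 2 * J) (by simp)
      set N := ∏ z ∈ (primaryPoles T).erase ζ, (X - C z) ^ (2 * J)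
      intro j hj
      obtain ⟨a, ha⟩ := exists_polynomial_of_forall_mem_regAt
        (f := (opOf T ^ j) (ι ((X - C ζ) ^ (s + d) * N))) fun z => by
        by_cases hzζ : z = ζ
        · subst hzζ
          have key : ∃ g ∈ regAt z, (opOf T ^ j) (ι ((X - C z) ^ (s + d) * N)) =
              ι (X - C z) ^ s * g := by
            clear hj
            induction j with
            | zero =>
              refine ⟨ι ((X - C z) ^ d * N), algebraMap_mem_regAt _ _, ?_⟩
              rw [pow_zero, Module.End.one_apply, ← map_pow, ← map_mul]
              ring_nf
            | succ j ih =>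
              obtain ⟨g, hg, he⟩ := ih
              rw [pow_succ', Module.End.mul_apply, he]
              exact hpres g hg
          obtain ⟨g, hg, he⟩ := key
          rw [he]
          exact pow_mul_mem_regAt _ _ hg
        by_cases hz : z ∈ primaryPoles T
        · obtain ⟨c, hc⟩ : (X - C z) ^ (2 * J) ∣ (X - C ζ) ^ (s + d) * N :=
            (Finset.dvd_prod_of_mem (fun z => (X - C z) ^ (2 * J))
              (Finset.mem_erase.2 ⟨hzζ, hz⟩)).mul_left _
          obtain ⟨g, hg, he⟩ := hT.exists_lower z (2 * J - 2 * j) j (algebraMap_mem_regAt z c)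
          rw [Nat.sub_add_cancel (by omega), ← map_pow, ← map_mul, ← hc] at he
          rw [he]
          exact pow_mul_mem_regAt _ _ hg
        · obtain ⟨h1, h0⟩ := notMem_primaryPoles.1 hz
          clear hj
          induction j with
          | zero => exact algebraMap_mem_regAt _ _
          | succ j ih =>
            rw [pow_succ', Module.End.mul_apply]
            exact op2_mem_regAt (hp ▸ algebraMap_mem_regAt _ _) h1 h0 ih
      exact ⟨a, ha.symm⟩
    · intro hk
      by_contra hk'
      exact absurd (hmin k hk' (by omega)) (by omega)
  have hcard : gapCard T ζ = s := by
    change (gapSet (maxInvariant T) ζ).ncard = s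
    rw [hgap, Set.ncard_coe_finset, Finset.card_range]
  rw [hcard]
  refine ⟨hl.mem₁ le_rfl, fun y hy => ?_, hpres⟩
  by_cases hy0 : y = 0
  · simp [hy0]
  · obtain ⟨y₁, h, h1⟩ := exists_eq_pow_mul hy0 ζ
    refine (pow_dvd_pow _ (hmin _ (notMem_gapSet.2 ⟨y₁, h1, ?_⟩) (by omega))).trans ⟨y₁, h⟩
    rwa [← h]

/-! ### Gauge transformation and reduction to the intertwining problem -/

theorem logDeriv_mul_eq {a b : ℂ[X]} (ha : a ≠ 0) (hb : b ≠ 0) :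
    ι (derivative (a * b)) / ι (a * b) = ι (derivative a) / ι a + ι (derivative b) / ι b := by
  have ha' := RatFunc.algebraMap_ne_zero (K := ℂ) ha
  have hb' := RatFunc.algebraMap_ne_zero (K := ℂ) hb
  rw [derivative_mul, map_add, map_mul, map_mul, map_mul]
  field_simp

theorem logDeriv_pow_eq (ζ : ℂ) (n : ℕ) :
    ι (derivative ((X - C ζ) ^ n)) / ι ((X - C ζ) ^ n) = ι (C (n : ℂ)) / ι (X - C ζ) := by
  have hX := RatFunc.algebraMap_ne_zero (X_sub_C_ne_zero ζ)
  have h := (mul_rD_X_sub_C_pow ζ n).1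
  rw [← map_pow, rD_algebraMap, ← RatFunc.algebraMap_C] at h
  rw [div_eq_div_iff (RatFunc.algebraMap_ne_zero (pow_ne_zero n (X_sub_C_ne_zero ζ))) hX, ← h]
  ring

/-- Conjugation with `μ` turns `p D² + q D + r` into `T₀ - σ X + ρ`, where
`T₀ = p D² + (q + 2 p (μ' / μ + σ)) D`. -/
theorem op2_gauge {p qt μ : ℂ[X]} {q r σ : RatFunc ℂ} (hμ : μ ≠ 0)
    (hq : q + 2 * ι p * (ι (derivative μ) / ι μ + σ) = ι qt) (y : RatFunc ℂ) :
    op2 (ι p) q r (ι μ * y) =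
      ι μ * opS p qt σ (op2 (ι p) q r (ι μ) / ι μ + σ * ι qt) y := by
  have hμ' := RatFunc.algebraMap_ne_zero (K := ℂ) hμ
  obtain rfl : q = ι qt - 2 * ι p * (ι (derivative μ) / ι μ + σ) := by rw [← hq]; ring
  rw [opS_apply, opT_apply, opX_apply, op2_apply, op2_apply, rD_mul, map_add, rD_mul, rD_mul,
    rD_algebraMap, rD_algebraMap]
  field_simp
  ring

theorem pow_gauge {S S' : Module.End ℂ (RatFunc ℂ)} {μ : RatFunc ℂ}
    (h : ∀ y, S (μ * y) = μ * S' y) (k : ℕ) (y : RatFunc ℂ) :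
    (S ^ k) (μ * y) = μ * (S' ^ k) y := by
  induction k with
  | zero => rfl
  | succ k ih => rw [pow_succ', pow_succ', Module.End.mul_apply, Module.End.mul_apply, ih, h]

/-- Rational functions regular at `ζ`, as a complex vector space. -/
def regL (ζ : ℂ) : Submodule ℂ (RatFunc ℂ) where
  carrier := {f | f ∈ regAt ζ}
  zero_mem' := (regAt ζ).zero_mem
  add_mem' := (regAt ζ).add_mem
  smul_mem' c _ hf := smul_mem_regAt c hf

theorem finite_quotient_of_mul_mem {U W : Submodule ℂ ℂ[X]} [FiniteDimensional ℂ (ℂ[X] ⧸ U)]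
    (μ : ℂ[X]) (h : ∀ a, μ * a ∈ U → a ∈ W) : FiniteDimensional ℂ (ℂ[X] ⧸ W) := by
  set g : ℂ[X] →ₗ[ℂ] ℂ[X] ⧸ U := U.mkQ ∘ₗ LinearMap.mulLeft ℂ μ
  have hker : LinearMap.ker g ≤ W := fun a ha => h a (by simpa [g] using ha)
  have : FiniteDimensional ℂ (ℂ[X] ⧸ LinearMap.ker g) :=
    Module.Finite.equiv g.quotKerEquivRange.symm
  exact Module.Finite.of_surjective (Submodule.factor hker) (Submodule.factor_surjective hker)

theorem eval_eta_ne_zero {T : DiffOp} {z : ℂ} (hz : z ∉ primaryPoles T) : (eta T).eval z ≠ 0 :=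
  eval_etaProd_ne_zero hz

/-- The first-order coefficient of the classical operator is a polynomial. -/
theorem IsExceptional.exists_eq_add_logDeriv {T : DiffOp} (hT : IsExceptional T) {p : ℂ[X]}
    (hp : T 2 = ι p) :
    ∃ qt : ℂ[X], T 1 + 2 * ι p * (ι (derivative (eta T)) / ι (eta T)) = ι qt := by
  refine exists_polynomial_of_forall_mem_regAt fun z => ?_
  have h2p : 2 * ι p ∈ regAt z := by
    rw [← map_ofNat ι 2, ← map_mul]
    exact algebraMap_mem_regAt _ _
  by_cases hz : z ∈ primaryPoles T
  · set E := etaProd ((primaryPoles T).erase z) (gapCard T)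
    have hE : E.eval z ≠ 0 := eval_etaProd_ne_zero (by simp)
    have hηE : eta T = (X - C z) ^ gapCard T z * E := etaProd_eq_mul (gapCard T) hz
    rw [hηE, logDeriv_mul_eq (pow_ne_zero _ (X_sub_C_ne_zero z)) (ne_zero_of_eval hE),
      logDeriv_pow_eq, mul_add, ← add_assoc]
    refine add_mem ?_ (mul_mem h2p (logDeriv_mem_regAt hE))
    by_cases hpz : p.eval z = 0
    · refine add_mem (hT.preserve_of_eq_zero hp hpz hz).1 ?_
      obtain ⟨c, rfl⟩ := exists_eq_X_sub_C_mul hpz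
      have hX := RatFunc.algebraMap_ne_zero (X_sub_C_ne_zero z)
      have : 2 * ι ((X - C z) * c) * (ι (C (gapCard T z : ℂ)) / ι (X - C z)) =
          ι (2 * c * C (gapCard T z : ℂ)) := by
        simp only [map_mul, map_ofNat]
        field_simp
      rw [this]
      exact algebraMap_mem_regAt _ _
    · exact hT.mem_regAt_of_ne_zero hp hpz
  · exact add_mem (notMem_primaryPoles.1 hz).1
      (mul_mem h2p (logDeriv_mem_regAt (eval_eta_ne_zero hz)))

/-- Near a primary pole `ζ` at which `μ` does not vanish, the polynomials `a` for which all
`Tᵏ (μ a)` are regular at `ζ` form a space of codimension at most `ν`. -/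
theorem IsExceptional.exists_local_space {T : DiffOp} (hT : IsExceptional T) {μ : ℂ[X]} {ζ : ℂ}
    (hμ : μ.eval ζ ≠ 0) (hdvd : ∀ y ∈ maxInvariant T, μ ∣ y) {S : Module.End ℂ (RatFunc ℂ)}
    (hS : ∀ y, opOf T (ι μ * y) = ι μ * S y) :
    ∃ (W : Submodule ℂ ℂ[X]) (m : ℕ), (∀ a ∈ W, ∀ k : ℕ, (S ^ k) (ι a) ∈ regAt ζ) ∧
      (∀ a, (X - C ζ) ^ m ∣ a → a ∈ W) ∧ FiniteDimensional ℂ (ℂ[X] ⧸ W) ∧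
      Module.finrank ℂ (ℂ[X] ⧸ W) ≤ gapCard T ζ := by
  have hpow := pow_gauge hS
  have hμ0 := ne_zero_of_eval hμ
  set W := stableIn S (regL ζ) with hW
  have hWreg : ∀ a, a ∈ W ↔ ∀ k : ℕ, (S ^ k) (ι a) ∈ regAt ζ := fun a => by
    rw [hW, mem_stableIn]
    rfl
  have hUW : ∀ a, μ * a ∈ maxInvariant T → a ∈ W := by
    intro a ha
    rw [maxInvariant_eq hT.1, mem_stableIn] at ha
    refine (hWreg a).2 fun k => mem_regAt_of_mul hμ ?_
    obtain ⟨b, hb⟩ := ha k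
    rw [iotaL_apply, map_mul, hpow] at hb
    rw [← hb]
    exact algebraMap_mem_regAt _ _
  have := finiteDimensional_maxInvariant hT
  have hfd : FiniteDimensional ℂ (ℂ[X] ⧸ W) := finite_quotient_of_mul_mem μ hUW
  obtain ⟨J, hJ⟩ := exists_stableIn_bound S (regL ζ) hfd
  have hmem : ∀ a, (X - C ζ) ^ (2 * J) ∣ a → a ∈ W := by
    rintro _ ⟨c, rfl⟩
    refine hJ _ fun k hk => ?_
    obtain ⟨g, hg, he⟩ := hT.exists_lower ζ (2 * J - 2 * k) k (algebraMap_mem_regAt ζ (μ * c))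
    rw [Nat.sub_add_cancel (by omega), map_mul ι, mul_left_comm, hpow, ← map_pow, ← map_mul] at he
    refine mem_regAt_of_mul hμ ?_
    rw [he]
    exact pow_mul_mem_regAt _ _ hg
  refine ⟨W, 2 * J, fun a ha => (hWreg a).1 ha, hmem, hfd,
    finrank_quotient_le_ncard hmem (hT.finite_gapSet ζ) fun k hk => ?_⟩
  by_contra hkU
  obtain ⟨y₁, hy₁, hy⟩ := notMem_gapSet.1 hkU
  obtain ⟨a, ha⟩ := hdvd _ hy
  have ha0 : a ≠ 0 := by
    rintro rfl
    rw [mul_zero] at ha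
    exact mul_ne_zero (pow_ne_zero _ (X_sub_C_ne_zero ζ)) (ne_zero_of_eval hy₁) ha
  obtain ⟨a₁, h1, h2⟩ := exists_eq_pow_mul ha0 ζ
  have hk' : k = a.rootMultiplicity ζ := by
    refine (pow_mul_eq_pow_mul (c := μ * a₁) hy₁ (by simp [hμ, h2]) ?_).1
    rw [ha]
    conv_lhs => rw [h1]
    ring
  refine (notMem_gapSet.2 ⟨a₁, h2, ?_⟩) hk
  rw [hk', ← h1]
  exact hUW a (ha ▸ hy)

/-- With the product `μ` of the factors of `η` belonging to zeros of `p` as gauge factor, the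
operator satisfies the assumptions of `hasIntertwiner_of_finrank_le`. -/
theorem IsExceptional.exists_hasIntertwiner {T : DiffOp} (hT : IsExceptional T) {p qt : ℂ[X]}
    (hp : T 2 = ι p) (hp2 : p.natDegree ≤ 2) (hq1 : qt.natDegree ≤ 1)
    (hqt : T 1 + 2 * ι p * (ι (derivative (eta T)) / ι (eta T)) = ι qt) (hr : DegLE (T 0) 0)
    (hq : DegLE (T 1) 1) :
    ∃ (μ : ℂ[X]) (σ ρ : RatFunc ℂ), μ ≠ 0 ∧ (∀ y, opOf T (ι μ * y) = ι μ * opS p qt σ ρ y) ∧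
      HasIntertwiner p qt σ ρ := by
  classical
  set ν := gapCard T
  set Z := (primaryPoles T).filter fun z => ¬ p.eval z = 0 with hZ
  set μ := etaProd ((primaryPoles T).filter fun z => p.eval z = 0) ν with hμ
  have hη : eta T = μ * etaProd Z ν := (Finset.prod_filter_mul_prod_filter_not _ _ _).symm
  have hμm : μ.Monic := etaProd_monic _ _
  have hμ0 := RatFunc.algebraMap_ne_zero (K := ℂ) hμm.ne_zero
  set σ := ι (derivative (etaProd Z ν)) / ι (etaProd Z ν) with hσ
  rw [hη, logDeriv_mul_eq hμm.ne_zero (etaProd_monic _ _).ne_zero] at hqt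
  set ρ := op2 (ι p) (T 1) (T 0) (ι μ) / ι μ + σ * ι qt with hρ
  have hS : ∀ y, opOf T (ι μ * y) = ι μ * opS p qt σ ρ y := fun y => by
    rw [opOf, hp]
    exact op2_gauge hμm.ne_zero hqt y
  refine ⟨μ, σ, ρ, hμm.ne_zero, hS, hasIntertwiner_of_finrank_le hp2 hq1
    (fun ζ hζ => (Finset.mem_filter.1 hζ).2) (fun ζ hζ => ?_) ?_ fun ζ hζ =>
    hT.exists_local_space (eval_etaProd_ne_zero ?_) (fun y hy => etaProd_dvd fun z hz => ?_) hS⟩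
  · refine add_mem ?_ (mul_mem (logDeriv_mem_regAt (eval_etaProd_ne_zero hζ))
      (algebraMap_mem_regAt _ _))
    by_cases hζT : ζ ∈ primaryPoles T
    · have hpζ : p.eval ζ = 0 := by
        by_contra h
        exact hζ (Finset.mem_filter.2 ⟨hζT, h⟩)
      obtain ⟨g, hg, he⟩ := (hT.preserve_of_eq_zero hp hpζ hζT).2.2 _ (algebraMap_mem_regAt ζ
        (etaProd (((primaryPoles T).filter fun z => p.eval z = 0).erase ζ) ν))
      have hE := etaProd_eq_mul ν (Finset.mem_filter.2 ⟨hζT, hpζ⟩ :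
        ζ ∈ (primaryPoles T).filter fun z => p.eval z = 0)
      have hX := RatFunc.algebraMap_ne_zero (pow_ne_zero (ν ζ) (X_sub_C_ne_zero ζ))
      rw [opOf, hp, ← map_pow, ← map_mul, ← hE] at he
      rw [he, hμ, hE, map_mul, mul_div_mul_left _ _ hX]
      exact div_mem_regAt hg (eval_etaProd_ne_zero (by simp))
    · obtain ⟨h1, h0⟩ := notMem_primaryPoles.1 hζT
      refine div_mem_regAt (op2_mem_regAt (algebraMap_mem_regAt _ _) h1 h0
        (algebraMap_mem_regAt _ _)) (eval_etaProd_ne_zero ?_)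
      simp [hζT]
  · have hinv : DegLE (ι 1 / ι μ) (-μ.natDegree) :=
      (asy_div (m := 0) hμm rfl (by simp)).degLE.mono (by simp)
    have h0 := degLE_algebraMap.2 (le_refl μ.natDegree)
    have e : ρ = (ι p * (ι (derivative (derivative μ)) * (ι 1 / ι μ)) +
        T 1 * (ι (derivative μ) * (ι 1 / ι μ)) + T 0) + σ * ι qt := by
      rw [hρ, op2_apply, rD_algebraMap, rD_algebraMap, map_one ι]
      field_simp
    rw [e]
    refine ((DegLE.add ?_ ?_).add hr).add ?_
    · exact ((degLE_algebraMap.2 hp2).mul (h0.derivative.derivative.mul hinv)).mono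
        (by push_cast; omega)
    · exact (hq.mul (h0.derivative.mul hinv)).mono (by omega)
    · exact ((asy_logDeriv (etaProd_monic Z ν)).degLE.mul (degLE_algebraMap.2 hq1)).mono
        (by norm_num)
  · simp [(Finset.mem_filter.1 hζ).2]
  · obtain ⟨hzT, hpz⟩ := Finset.mem_filter.1 hz
    exact (hT.preserve_of_eq_zero hp hpz hzT).2.1 y hy

/-! ### The Bochner operator -/

/-- The operator `p D² + q D + c`. -/
def bochnerOp (p q : ℂ[X]) (c : ℂ) : DiffOp :=
  Finsupp.single 2 (ι p) + Finsupp.single 1 (ι q) + Finsupp.single 0 (RatFunc.C c)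

section bochnerOp

variable (p q : ℂ[X]) (c : ℂ)

theorem bochnerOp_two : bochnerOp p q c 2 = ι p := by simp [bochnerOp]

theorem bochnerOp_one : bochnerOp p q c 1 = ι q := by simp [bochnerOp]

theorem bochnerOp_zero : bochnerOp p q c 0 = RatFunc.C c := by simp [bochnerOp]

theorem bochnerOp_of_lt {j : ℕ} (hj : 2 < j) : bochnerOp p q c j = 0 := by
  simp [bochnerOp, show (2 : ℕ) ≠ j by omega, show (1 : ℕ) ≠ j by omega,
    show (0 : ℕ) ≠ j by omega]

variable {p q}

theorem hasOrder_bochnerOp (hp : p ≠ 0) : HasOrder (bochnerOp p q c) 2 :=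
  ⟨by rw [bochnerOp_two]; exact RatFunc.algebraMap_ne_zero hp, fun _ => bochnerOp_of_lt p q c⟩

theorem act_bochnerOp (hp : p ≠ 0) (y : RatFunc ℂ) :
    act (bochnerOp p q c) y = opT p q y + c • y := by
  rw [act_eq_op2 (hasOrder_bochnerOp c hp), op2_apply, bochnerOp_two, bochnerOp_one,
    bochnerOp_zero, opT_apply, RatFunc.smul_eq_C_mul]

theorem isBochner_bochnerOp (hp0 : p ≠ 0) (hp : p.natDegree ≤ 2) (hq : q.natDegree ≤ 1)
    (h : p.natDegree = 2 ∨ q.natDegree = 1) : IsBochner (bochnerOp p q c) := by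
  have hcases : ∀ j, j = 2 ∨ j = 1 ∨ j = 0 ∨ 2 < j := fun j => by omega
  refine ⟨hasOrder_bochnerOp c hp0, fun j => ?_, le_antisymm (Finset.sup_le fun j hj => ?_) ?_⟩
  · rcases hcases j with rfl | rfl | rfl | hj
    · exact ⟨p, bochnerOp_two p q c⟩
    · exact ⟨q, bochnerOp_one p q c⟩
    · exact ⟨C c, by rw [bochnerOp_zero, RatFunc.algebraMap_C]⟩
    · exact ⟨0, by rw [bochnerOp_of_lt p q c hj, map_zero]⟩
  · rw [← WithBot.coe_zero, WithBot.coe_le_coe]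
    rcases hcases j with rfl | rfl | rfl | hj'
    · rw [bochnerOp_two, RatFunc.intDegree_polynomial]
      push_cast
      omega
    · rw [bochnerOp_one, RatFunc.intDegree_polynomial]
      push_cast
      omega
    · rw [bochnerOp_zero, RatFunc.intDegree_C]
      simp
    · exact absurd (bochnerOp_of_lt p q c hj') (Finsupp.mem_support_iff.1 hj)
  · rcases h with h | h
    · have h2 : 2 ∈ (bochnerOp p q c).support := Finsupp.mem_support_iff.2
        (hasOrder_bochnerOp c hp0).1
      refine le_trans (le_of_eq ?_) (Finset.le_sup h2)
      rw [bochnerOp_two, RatFunc.intDegree_polynomial, h]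
      rfl
    · have hq0 : q ≠ 0 := by
        rintro rfl
        simp at h
      have h1 : 1 ∈ (bochnerOp p q c).support := by
        rw [Finsupp.mem_support_iff, bochnerOp_one]
        exact RatFunc.algebraMap_ne_zero hq0
      refine le_trans (le_of_eq ?_) (Finset.le_sup h1)
      rw [bochnerOp_one, RatFunc.intDegree_polynomial, h]
      rfl

end bochnerOp

/-- A polynomial multiple of the solution of the gauged intertwining problem is an intertwiner. -/
theorem exists_isIntertwiner {T : DiffOp} (hT : HasOrder T 2) {p qt μ : ℂ[X]} (hp : p ≠ 0)
    {σ ρ : RatFunc ℂ} (hμ : μ ≠ 0) (hS : ∀ y, opOf T (ι μ * y) = ι μ * opS p qt σ ρ y)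
    (h : HasIntertwiner p qt σ ρ) :
    ∃ (c : ℂ) (L : DiffOp), HasPolyCoeffs L ∧ IsIntertwiner T (bochnerOp p qt c) L := by
  obtain ⟨n, w, c, hw, hwn, hpoly, hint⟩ := h
  obtain ⟨M, N, hM⟩ := exists_realizes_opM p qt n w hpoly
  have hL := hM.mul μ
  refine ⟨c, _, hL.2.1, fun hL0 => hw ?_, fun y => ?_⟩
  · have hM0 : ∀ y, opM p qt n w y = 0 := fun y => by
      have h1 := hL.1 y
      rw [hL0] at h1
      have h2 : ι μ * opM p qt n w y = 0 := h1.symm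
      exact (mul_eq_zero.1 h2).resolve_left (RatFunc.algebraMap_ne_zero hμ)
    funext i
    rcases lt_or_ge i n with hi | hi
    · exact eq_zero_of_opM_eq_zero p qt hp n w hM0 i hi
    · exact hwn i hi
  · rw [hL.1, hL.1, act_eq_op2 hT, act_bochnerOp c hp]
    exact (hS _).trans (congrArg _ (hint y))

/-! ### Weights -/

theorem evalAt_div {z : ℂ} (a b : ℂ[X]) (hb : b.eval z ≠ 0) :
    evalAt z (ι a / ι b) = a.eval z / b.eval z := by
  set f := ι a / ι b with hf
  have hd : f.denom.eval z ≠ 0 := mem_regAt_iff_denom.1 ⟨a, b, hb, hf⟩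
  have h : f.num * b = a * f.denom := by
    have h2 := (RatFunc.num_div_denom f).trans hf
    rw [div_eq_div_iff (algebraMap_ne_zero_of_eval hd) (algebraMap_ne_zero_of_eval hb), ← map_mul,
      ← map_mul] at h2
    exact RatFunc.algebraMap_injective ℂ h2
  have h' := congrArg (eval z) h
  rw [eval_mul, eval_mul] at h'
  change f.num.eval z / f.denom.eval z = _
  rw [div_eq_div_iff hd hb, h']

theorem evalAt_algebraMap (z : ℂ) (a : ℂ[X]) : evalAt z (ι a) = a.eval z := by
  have := evalAt_div (z := z) a 1 (by simp)
  simpa using this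

theorem IsRegularAt.notMem_primaryPoles {T : DiffOp} {z : ℂ} (h : IsRegularAt T z) :
    z ∉ primaryPoles T := by
  rw [mem_primaryPoles, not_or]
  exact ⟨h.1 1, h.1 0⟩

/-- The identity `q / p = q̃ / p - 2 η' / η`, evaluated at a regular point. -/
theorem IsRegularAt.evalAt_div_eq {T : DiffOp} {z : ℂ} (h : IsRegularAt T z) {p qt : ℂ[X]}
    (hp : T 2 = ι p) (hqt : T 1 + 2 * ι p * (ι (derivative (eta T)) / ι (eta T)) = ι qt) :
    evalAt z (T 1 / T 2) =
      evalAt z (ι qt / ι p) - 2 * ((derivative (eta T)).eval z / (eta T).eval z) := by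
  have hpz : p.eval z ≠ 0 := by
    have := h.2
    rwa [hp, evalAt_algebraMap] at this
  have hη := eval_eta_ne_zero h.notMem_primaryPoles
  have hη' := algebraMap_ne_zero_of_eval hη
  have hp' := algebraMap_ne_zero_of_eval hpz
  have e : T 1 / T 2 = ι (qt * eta T - 2 * p * derivative (eta T)) / ι (p * eta T) := by
    rw [hp, ← eq_sub_iff_add_eq.2 hqt |>.symm]
    simp only [map_sub, map_mul, map_ofNat]
    field_simp
  rw [e, evalAt_div _ _ (by simp [hpz, hη]), evalAt_div _ _ hpz]
  simp only [eval_sub, eval_mul, eval_ofNat]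
  field_simp

/-- `W η² / W_B = exp (∫ q / p - ∫ q̃ / p) η²` has derivative zero. -/
theorem weight_relation {T TB : DiffOp} {p qt : ℂ[X]} (hp : T 2 = ι p) (hTB2 : TB 2 = ι p)
    (hTB1 : TB 1 = ι qt)
    (hqt : T 1 + 2 * ι p * (ι (derivative (eta T)) / ι (eta T)) = ι qt) {Ω : Set ℂ}
    (hΩ : IsOpen Ω) (hΩ' : IsPreconnected Ω) (hreg : ∀ z ∈ Ω, IsRegularAt T z) {W WB : ℂ → ℂ}
    (hW : IsWeight T Ω W) (hWB : IsWeight TB Ω WB) :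
    ∃ c : ℂ, c ≠ 0 ∧ ∀ z ∈ Ω, W z = c * (WB z * (1 / (eta T).eval z ^ 2)) := by
  obtain ⟨F, hF⟩ := hW
  obtain ⟨G, hG⟩ := hWB
  have hη : ∀ z ∈ Ω, (eta T).eval z ≠ 0 := fun z hz =>
    eval_eta_ne_zero (hreg z hz).notMem_primaryPoles
  have hder : ∀ z ∈ Ω, HasDerivAt (fun z => Complex.exp (F z - G z) * (eta T).eval z ^ 2) 0 z := by
    intro z hz
    have h1 := ((hF z hz).1.sub (hG z hz).1).cexp.mul (((eta T).hasDerivAt z).pow 2)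
    refine h1.congr_deriv ?_
    rw [(hreg z hz).evalAt_div_eq hp hqt, hTB1, hTB2]
    have := hη z hz
    simp only [Pi.sub_apply, Pi.pow_apply]
    field_simp
    ring
  obtain ⟨c, hc⟩ := hΩ.exists_is_const_of_deriv_eq_zero hΩ'
    (fun z hz => (hder z hz).differentiableAt.differentiableWithinAt) fun z hz => (hder z hz).deriv
  rcases Ω.eq_empty_or_nonempty with rfl | ⟨z₀, hz₀⟩
  · exact ⟨1, one_ne_zero, by simp⟩
  refine ⟨c, ?_, fun z hz => ?_⟩
  · rw [← hc z₀ hz₀]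
    exact mul_ne_zero (Complex.exp_ne_zero _) (pow_ne_zero 2 (hη z₀ hz₀))
  · have h1 := hη z hz
    rw [(hF z hz).2, (hG z hz).2, hTB2, hp, ← hc z hz, Complex.exp_sub]
    have := Complex.exp_ne_zero (G z)
    field_simp

end ExcOp

end

theorem mainTheorem2 (T : ExcOp.DiffOp) (hT : ExcOp.IsExceptional T) :
    -- the second-order coefficient is a polynomial of degree at most two
    (∃ p : Polynomial ℂ, p.natDegree ≤ 2 ∧ T 2 = algebraMap (Polynomial ℂ) (RatFunc ℂ) p) ∧
    -- the gap cardinalities are finite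
    (∀ ζ : ℂ, (ExcOp.orderGaps T ζ).Finite) ∧
    ∃ TB : ExcOp.DiffOp, ExcOp.IsBochner TB ∧
      -- Darboux connectedness, through an intertwiner with polynomial coefficients
      ExcOp.DarbouxConnected T TB ∧
      (∃ L : ExcOp.DiffOp, ExcOp.HasPolyCoeffs L ∧ ExcOp.IsIntertwiner T TB L) ∧
      -- the relation of the weights
      ∃ (χ : RatFunc ℂ) (k : ℂ), χ ≠ 0 ∧ ExcOp.rderiv χ / χ = RatFunc.C k / T 2 ∧
        ∀ Ω : Set ℂ, IsOpen Ω → IsPreconnected Ω → (∀ z ∈ Ω, ExcOp.IsRegularAt T z) →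
          ∀ W WB : ℂ → ℂ, ExcOp.IsWeight T Ω W → ExcOp.IsWeight TB Ω WB →
            ∃ c : ℂ, c ≠ 0 ∧ ∀ z ∈ Ω,
              W z = c * (WB z * (ExcOp.evalAt z χ / (ExcOp.eta T).eval z ^ 2)) := by
  obtain ⟨p, hp2, hp⟩ := hT.exists_polynomial
  obtain ⟨qt, hqt⟩ := hT.exists_eq_add_logDeriv hp
  obtain ⟨p₂, q₁, has2, has1, has0, hne⟩ := ExcOp.exists_asy_of_isExceptional hT
  have hp0 : p ≠ 0 := by
    rintro rfl
    exact hT.1.1 (by rw [hp, map_zero])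
  have hlog := ExcOp.asy_logDeriv (ExcOp.etaProd_monic (ExcOp.primaryPoles T) (ExcOp.gapCard T))
  rw [hp] at has2
  -- the leading coefficients at infinity of `p` and `q̃` are not both zero
  have hq := has1.add (((has2.const_mul 2).mul hlog).congr (by norm_num) rfl)
  rw [map_ofNat RatFunc.C 2] at hq
  rw [show ExcOp.etaProd (ExcOp.primaryPoles T) (ExcOp.gapCard T) = ExcOp.eta T from rfl, hqt] at hq
  have hq1 : qt.natDegree ≤ 1 := ExcOp.degLE_algebraMap.1 hq.degLE
  have hdeg : p.natDegree = 2 ∨ qt.natDegree = 1 := by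
    by_contra! hcon
    have h2 : p₂ = 0 := ExcOp.asy_eq_zero has2
      ((ExcOp.degLE_algebraMap (n := 1)).2 (by omega))
    have h1 := ExcOp.asy_eq_zero hq ((ExcOp.degLE_algebraMap (n := 0)).2 (by omega))
    rw [h2, mul_zero, zero_mul, add_zero] at h1
    exact hne.elim (fun h => h h2) fun h => h h1
  obtain ⟨μ, σ, ρ, hμ, hS, hint⟩ :=
    hT.exists_hasIntertwiner hp hp2 hq1 hqt has0 has1.degLE
  obtain ⟨c, L, hLpoly, hL⟩ := ExcOp.exists_isIntertwiner hT.1 hp0 hμ hS hint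
  refine ⟨⟨p, hp2, hp⟩, hT.finite_gapSet, ExcOp.bochnerOp p qt c,
    ExcOp.isBochner_bochnerOp c hp0 hp2 hq1 hdeg, ⟨L, hL⟩, ⟨L, hLpoly, hL⟩, 1, 0, one_ne_zero, ?_,
    fun Ω hΩ hΩ' hreg W WB hW hWB => ?_⟩
  · rw [← ExcOp.rD_apply, ExcOp.rD_one, map_zero, zero_div, zero_div]
  · have h1 : ∀ z, ExcOp.evalAt z 1 = 1 := fun z => by
      simpa using ExcOp.evalAt_algebraMap z 1
    simp only [h1]
    exact ExcOp.weight_relation hp (ExcOp.bochnerOp_two p qt c) (ExcOp.bochnerOp_one p qt c) hqt hΩ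
      hΩ' hreg hW hWB
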